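/- Let $(g,I,J)$ be a nondegenerate generalized Kähler structure on a compact smooth manifold $M$ of real dimension $4n$: $g$ is a Riemannian metric, $I$ and $J$ are integrable complex structures compatible with $g$, the forms $\omega_I=g(I\cdot,\cdot)$ and $\omega_J=g(J\cdot,\cdot)$ satisfy $d^c_I\omega_I=-d^c_J\omega_J$ and $d\,d^c_I\omega_I=0$, and $[I,J]$ is invertible at every point. Here $d^c_I\omega=-(d\omega)(I\cdot,I\cdot,I\cdot)$. Put $\Omega=g([I,J]^{-1}\cdot,\cdot)$, $\Psi_1=-\Omega(I\cdot,\cdot)$, $\Psi_2=-\Omega(J\cdot,\cdot)$ (so that $\Omega+i\Psi_1$ and $\Omega+i\Psi_2$ are the holomorphic symplectic forms of $I$ and $J$), $F_\pm=2(\pm\Psi_1-\Psi_2)$, and $\lambda=\log\left(\int_M F_+^{2n}\Big/\int_M F_-^{2n}\right)$, where $M$ is oriented by $\Omega^{2n}$. Let $h$ be a smooth time-independent function on $M$ with $\int_M h\,\Omega^{2n}=0$, and let $\varphi_t$ be the flow of the Hamiltonian vector field $X=-\Omega^{-1}(dh)$, i.e. $\Omega(X,\cdot)=-dh$. Let $T\subset\mathbb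 R$ be an interval such that for every $t\in T$ the $(1,1)$-part of $-\varphi_t^*\Psi_2$ with respect to $I$ is positive definite (so that $(I,\varphi_t^*J)$ is again the pair of complex structures of a nondegenerate generalized Kähler structure with the same $\Omega$). For $t\in T$ put $(F_\pm)_t=2(\pm\Psi_1-\varphi_t^*\Psi_2)$ and $$\delta\mathbf F_h(t)=-\frac1{(2n)!}\int_M h\left((F_+)_t^{2n}-e^{\lambda}(F_-)_t^{2n}\right).$$ Then $t\mapsto\delta\mathbf F_h(t)$ is monotone nondecreasing on $T$. -/

import Mathlib

open scoped Manifold ContDiff Bundle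
open MeasureTheory

noncomputable section

namespace GenKahler

/-! ### Linear algebra of alternating forms -/

/-- The 2-form `(v, w) ↦ β v w` of a bilinear form `β` with `β v v = 0`. -/
def twoForm {d : ℕ}
    (β : EuclideanSpace ℝ (Fin d) →L[ℝ] EuclideanSpace ℝ (Fin d) →L[ℝ] ℝ)
    (h : ∀ v, β v v = 0) : EuclideanSpace ℝ (Fin d) [⋀^Fin 2]→L[ℝ] ℝ where
  toFun v := β (v 0) (v 1)
  map_update_add' := by
    intro _ m i x y
    fin_cases i <;> simp [Function.update]
  map_update_smul' := by
    intro _ m i c x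
    fin_cases i <;> simp [Function.update]
  cont := by fun_prop
  map_eq_zero_of_eq' := by
    intro v i j hv hij
    fin_cases i <;> fin_cases j <;> simp_all

section Pow

variable {V : Type*}

theorem evenIdx_lt {m : ℕ} (i : Fin m) : 2 * i.1 < 2 * m := by omega

theorem oddIdx_lt {m : ℕ} (i : Fin m) : 2 * i.1 + 1 < 2 * m := by omega

/-- The pair `(v_{2i}, v_{2i+1})` extracted from `v_0, …, v_{2m-1}`. -/
def pairAt {m : ℕ} (v : Fin (2 * m) → V) (i : Fin m) : Fin 2 → V :=
  ![v ⟨2 * i.1, evenIdx_lt i⟩, v ⟨2 * i.1 + 1, oddIdx_lt i⟩]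

theorem pairAt_update_ne {m : ℕ} [DecidableEq (Fin (2 * m))] (v : Fin (2 * m) → V)
    (k : Fin (2 * m)) (x : V) (i : Fin m) (hi : i.1 ≠ k.1 / 2) :
    pairAt (Function.update v k x) i = pairAt v i := by
  unfold pairAt
  rw [Function.update_of_ne, Function.update_of_ne]
  · intro h; apply hi; rw [← h]; simp only; omega
  · intro h; apply hi; rw [← h]; simp only; omega

theorem exists_pairAt_update {m : ℕ} [DecidableEq (Fin (2 * m))] (v : Fin (2 * m) → V)
    (k : Fin (2 * m)) (i : Fin m) (hi : i.1 = k.1 / 2) :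
    ∃ l : Fin 2, ∀ x : V,
      pairAt (Function.update v k x) i = Function.update (pairAt v i) l x := by
  rcases Nat.even_or_odd' k.1 with ⟨c, hc | hc⟩
  · refine ⟨0, fun x => ?_⟩
    have h0 : (⟨2 * i.1, evenIdx_lt i⟩ : Fin (2 * m)) = k := by ext; simp only; omega
    have h1 : (⟨2 * i.1 + 1, oddIdx_lt i⟩ : Fin (2 * m)) ≠ k := by
      intro h; rw [Fin.ext_iff] at h; simp only at h; omega
    unfold pairAt
    rw [h0, Function.update_self, Function.update_of_ne h1]
    ext j; fin_cases j <;> simp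
  · refine ⟨1, fun x => ?_⟩
    have h0 : (⟨2 * i.1 + 1, oddIdx_lt i⟩ : Fin (2 * m)) = k := by ext; simp only; omega
    have h1 : (⟨2 * i.1, evenIdx_lt i⟩ : Fin (2 * m)) ≠ k := by
      intro h; rw [Fin.ext_iff] at h; simp only at h; omega
    unfold pairAt
    rw [h0, Function.update_self, Function.update_of_ne h1]
    ext j; fin_cases j <;> simp

variable [AddCommGroup V] [Module ℝ V] [TopologicalSpace V]

/-- The multilinear map `(v_0, …, v_{2m-1}) ↦ ∏ i, α (v_{2i}, v_{2i+1})`. -/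
def pairProd (α : V [⋀^Fin 2]→L[ℝ] ℝ) (m : ℕ) :
    ContinuousMultilinearMap ℝ (fun _ : Fin (2 * m) => V) ℝ where
  toFun v := ∏ i : Fin m, α (pairAt v i)
  map_update_add' := by
    intro _ v k x y
    have hk : k.1 / 2 < m := by have := k.2; omega
    obtain ⟨l, hl⟩ := exists_pairAt_update v k ⟨k.1 / 2, hk⟩ rfl
    have key : ∀ z, ∏ i : Fin m, α (pairAt (Function.update v k z) i) =
        α (Function.update (pairAt v ⟨k.1 / 2, hk⟩) l z) *
          ∏ i ∈ Finset.univ.erase (⟨k.1 / 2, hk⟩ : Fin m), α (pairAt v i) := by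
      intro z
      rw [← Finset.mul_prod_erase _ _ (Finset.mem_univ (⟨k.1 / 2, hk⟩ : Fin m)), hl]
      congr 1
      refine Finset.prod_congr rfl fun i hi => ?_
      rw [pairAt_update_ne]
      intro h; exact (Finset.ne_of_mem_erase hi) (Fin.ext h)
    rw [key, key, key, α.map_update_add, add_mul]
  map_update_smul' := by
    intro _ v k c x
    have hk : k.1 / 2 < m := by have := k.2; omega
    obtain ⟨l, hl⟩ := exists_pairAt_update v k ⟨k.1 / 2, hk⟩ rfl
    have key : ∀ z, ∏ i : Fin m, α (pairAt (Function.update v k z) i) =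
        α (Function.update (pairAt v ⟨k.1 / 2, hk⟩) l z) *
          ∏ i ∈ Finset.univ.erase (⟨k.1 / 2, hk⟩ : Fin m), α (pairAt v i) := by
      intro z
      rw [← Finset.mul_prod_erase _ _ (Finset.mem_univ (⟨k.1 / 2, hk⟩ : Fin m)), hl]
      congr 1
      refine Finset.prod_congr rfl fun i hi => ?_
      rw [pairAt_update_ne]
      intro h; exact (Finset.ne_of_mem_erase hi) (Fin.ext h)
    rw [key, key, α.map_update_smul, smul_eq_mul, smul_eq_mul, mul_assoc]
  cont := by
    refine continuous_finsetProd _ fun i _ => α.cont.comp ?_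
    refine continuous_pi fun j => ?_
    fin_cases j <;> simp [pairAt] <;> fun_prop

variable [IsTopologicalAddGroup V] [ContinuousSMul ℝ V]

theorem top_degree (n : ℕ) : 2 * (2 * n) = 4 * n := by omega

/-- The top exterior power `α^{2n} = α ∧ ⋯ ∧ α` of a 2-form on a `4n`-dimensional space:
`α^{2n} (v_0, …, v_{4n-1}) = 2^{-2n} ∑_σ sgn σ ∏_{i < 2n} α (v_{σ (2i)}, v_{σ (2i+1)})`. -/
def topPow (n : ℕ) (α : V [⋀^Fin 2]→L[ℝ] ℝ) : V [⋀^Fin (4 * n)]→L[ℝ] ℝ :=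
  ((1 / 2 : ℝ) ^ (2 * n)) • ContinuousMultilinearMap.alternatization
    ((pairProd α (2 * n)).domDomCongr (finCongr (top_degree n)))

end Pow

/-! ### Differential forms on a manifold -/

section Forms

variable (d : ℕ) (M : Type*) [TopologicalSpace M] [ChartedSpace (EuclideanSpace ℝ (Fin d)) M]

/-- (Not necessarily smooth) differential `k`-forms on `M`. -/
abbrev DForm (k : ℕ) := ∀ x : M, TangentSpace (𝓡 d) x [⋀^Fin k]→L[ℝ] ℝ

/-- Fields of endomorphisms of the tangent spaces of `M`. -/
abbrev EndField := ∀ x : M, TangentSpace (𝓡 d) x →L[ℝ] TangentSpace (𝓡 d) x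

/-- Smooth Riemannian metrics on `M`. -/
abbrev SmoothMetric [IsManifold (𝓡 d) ∞ M] :=
  Bundle.ContMDiffRiemannianMetric (𝓡 d) ∞ (EuclideanSpace ℝ (Fin d))
    (fun x : M => TangentSpace (𝓡 d) x)

variable {d M}

/-- The expression of a form in the chart centred at `x₀`. -/
def inChart {k : ℕ} (α : DForm d M k) (x₀ : M) (y : EuclideanSpace ℝ (Fin d)) :
    EuclideanSpace ℝ (Fin d) [⋀^Fin k]→L[ℝ] ℝ :=
  (α ((extChartAt (𝓡 d) x₀).symm y)).compContinuousLinearMap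
    (mfderiv 𝓘(ℝ, EuclideanSpace ℝ (Fin d)) (𝓡 d) (extChartAt (𝓡 d) x₀).symm y)

/-- The exterior derivative of a form, computed at each point in the chart at that point. -/
def dForm {k : ℕ} (α : DForm d M k) : DForm d M (k + 1) := fun x =>
  (extDeriv (inChart α x) (extChartAt (𝓡 d) x x)).compContinuousLinearMap
    (mfderiv (𝓡 d) 𝓘(ℝ, EuclideanSpace ℝ (Fin d)) (extChartAt (𝓡 d) x) x)

/-- The pull-back `φ^* α`. -/
def pullback {k : ℕ} (φ : M → M) (α : DForm d M k) : DForm d M k := fun x =>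
  (α (φ x)).compContinuousLinearMap (mfderiv (𝓡 d) (𝓡 d) φ x)

/-- A partition of unity on `M` subordinate to the domains of the charts. -/
def chartPartition [IsManifold (𝓡 d) ∞ M] [T2Space M] [CompactSpace M] :
    SmoothPartitionOfUnity M (𝓡 d) M Set.univ :=
  (SmoothPartitionOfUnity.exists_isSubordinate_chartAt_source (𝓡 d) M).choose

theorem chartPartition_isSubordinate [IsManifold (𝓡 d) ∞ M] [T2Space M] [CompactSpace M] :
    (chartPartition (d := d) (M := M)).IsSubordinate
      (fun x => (chartAt (EuclideanSpace ℝ (Fin d)) x).source) :=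
  (SmoothPartitionOfUnity.exists_isSubordinate_chartAt_source (𝓡 d) M).choose_spec

/-- The coefficient of a top-degree form in the chart centred at `x₀`. -/
def coeff (η : DForm d M d) (x₀ : M) (y : EuclideanSpace ℝ (Fin d)) : ℝ :=
  inChart η x₀ y (fun i => EuclideanSpace.basisFun (Fin d) ℝ i)

/-- The integral `∫_M η` of a top-degree form over the compact manifold `M`, with the orientation
in which the nowhere vanishing top-degree form `θ` is positive. -/
def integral [IsManifold (𝓡 d) ∞ M] [T2Space M] [CompactSpace M] (θ η : DForm d M d) : ℝ :=
  ∑ᶠ x₀ : M, ∫ y in (extChartAt (𝓡 d) x₀).target,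
    chartPartition (d := d) x₀ ((extChartAt (𝓡 d) x₀).symm y) *
      (Real.sign (coeff θ x₀ y) * coeff η x₀ y)

end Forms

/-! ### Generalized Kähler structures -/

section GK

variable {d : ℕ} {M : Type*} [TopologicalSpace M] [ChartedSpace (EuclideanSpace ℝ (Fin d)) M]
  [IsManifold (𝓡 d) ∞ M]

/-- `J` is a smooth integrable almost complex structure: `J² = -1` and the Nijenhuis tensor
`[X, Y] + J [J X, Y] + J [X, J Y] - [J X, J Y]` vanishes. -/
structure IsComplexStructure (J : EndField d M) : Prop where
  smooth : ContMDiff (𝓡 d)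
    ((𝓡 d).prod 𝓘(ℝ, EuclideanSpace ℝ (Fin d) →L[ℝ] EuclideanSpace ℝ (Fin d))) ∞
    (fun x => Bundle.TotalSpace.mk'
      (EuclideanSpace ℝ (Fin d) →L[ℝ] EuclideanSpace ℝ (Fin d))
      (E := fun x : M => TangentSpace (𝓡 d) x →L[ℝ] TangentSpace (𝓡 d) x) x (J x))
  sq : ∀ (x : M) (v : TangentSpace (𝓡 d) x), J x (J x v) = -v
  nijenhuis : ∀ (U : Set M), IsOpen U → ∀ X Y : (x : M) → TangentSpace (𝓡 d) x,
    ContMDiffOn (𝓡 d) ((𝓡 d).prod 𝓘(ℝ, EuclideanSpace ℝ (Fin d))) ∞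
      (fun x => (Bundle.TotalSpace.mk x (X x) : TangentBundle (𝓡 d) M)) U →
    ContMDiffOn (𝓡 d) ((𝓡 d).prod 𝓘(ℝ, EuclideanSpace ℝ (Fin d))) ∞
      (fun x => (Bundle.TotalSpace.mk x (Y x) : TangentBundle (𝓡 d) M)) U →
    ∀ x ∈ U,
      VectorField.mlieBracket (𝓡 d) X Y x
        + J x (VectorField.mlieBracket (𝓡 d) (fun z => J z (X z)) Y x)
        + J x (VectorField.mlieBracket (𝓡 d) X (fun z => J z (Y z)) x)
        - VectorField.mlieBracket (𝓡 d) (fun z => J z (X z)) (fun z => J z (Y z)) x = 0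

theorem fundamentalForm_aux (g : SmoothMetric d M) (J : EndField d M)
    (sq : ∀ (x : M) (v : TangentSpace (𝓡 d) x), J x (J x v) = -v)
    (compat : ∀ (x : M) (v w : TangentSpace (𝓡 d) x),
      g.inner x (J x v) (J x w) = g.inner x v w) (x : M) (v : TangentSpace (𝓡 d) x) :
    g.inner x (J x v) v = 0 := by
  have h1 := compat x (J x v) v
  have h2 := g.symm x (J x v) v
  rw [sq, map_neg] at h1
  have h3 : -(g.inner x v (J x v)) = g.inner x (J x v) v := h1
  linarith

/-- The fundamental form `ω_J (v, w) = g (J v, w)` of a Hermitian structure. -/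
def fundamentalForm (g : SmoothMetric d M) (J : EndField d M)
    (sq : ∀ (x : M) (v : TangentSpace (𝓡 d) x), J x (J x v) = -v)
    (compat : ∀ (x : M) (v w : TangentSpace (𝓡 d) x),
      g.inner x (J x v) (J x w) = g.inner x v w) : DForm d M 2 := fun x =>
  twoForm (d := d) (g.inner x ∘L J x) (fundamentalForm_aux g J sq compat x)

/-- `d^c_J α = -(dα)(J ·, J ·, J ·)` for a 2-form `α`. -/
def dc (J : EndField d M) (α : DForm d M 2) : DForm d M 3 := fun x =>
  -(dForm α x).compContinuousLinearMap (J x)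

variable (d M) in
/-- Generalized Kähler structures `(g, I, J)`. -/
structure GKStructure where
  /-- The Riemannian metric. -/
  g : SmoothMetric d M
  /-- The first complex structure. -/
  I : EndField d M
  /-- The second complex structure. -/
  J : EndField d M
  complexI : IsComplexStructure I
  complexJ : IsComplexStructure J
  compatI : ∀ (x : M) (v w : TangentSpace (𝓡 d) x),
    g.inner x (I x v) (I x w) = g.inner x v w
  compatJ : ∀ (x : M) (v w : TangentSpace (𝓡 d) x),
    g.inner x (J x v) (J x w) = g.inner x v w
  dc_eq : dc I (fundamentalForm g I complexI.sq compatI) =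
    -dc J (fundamentalForm g J complexJ.sq compatJ)
  dH_eq : dForm (dc I (fundamentalForm g I complexI.sq compatI)) = 0

namespace GKStructure

/-- The commutator `[I, J]`. -/
def comm (S : GKStructure d M) : EndField d M := fun x =>
  S.I x ∘L S.J x - S.J x ∘L S.I x

/-- The bivector `σ = g⁻¹ [I, J]` is nondegenerate, that is, `[I, J]` is invertible. -/
def Nondegenerate (S : GKStructure d M) : Prop := ∀ x, (S.comm x).IsInvertible

/-- The endomorphism field `[I, J]⁻¹`. -/
def commInv (S : GKStructure d M) : EndField d M := fun x => (S.comm x).inverse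

theorem inner_I (S : GKStructure d M) (x : M) (v w : TangentSpace (𝓡 d) x) :
    S.g.inner x (S.I x v) w = -S.g.inner x v (S.I x w) := by
  have h := S.compatI x v (S.I x w)
  rw [S.complexI.sq, map_neg] at h
  linarith

theorem inner_J (S : GKStructure d M) (x : M) (v w : TangentSpace (𝓡 d) x) :
    S.g.inner x (S.J x v) w = -S.g.inner x v (S.J x w) := by
  have h := S.compatJ x v (S.J x w)
  rw [S.complexJ.sq, map_neg] at h
  linarith

theorem comm_apply (S : GKStructure d M) (x : M) (v : TangentSpace (𝓡 d) x) :
    S.comm x v = S.I x (S.J x v) - S.J x (S.I x v) := rfl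

theorem inner_comm (S : GKStructure d M) (x : M) (v w : TangentSpace (𝓡 d) x) :
    S.g.inner x (S.comm x v) w = -S.g.inner x v (S.comm x w) := by
  rw [comm_apply, comm_apply, map_sub, map_sub, sub_apply,
    inner_I, inner_J, inner_J, inner_I]
  ring

theorem comm_I (S : GKStructure d M) (x : M) (v : TangentSpace (𝓡 d) x) :
    S.comm x (S.I x v) = -S.I x (S.comm x v) := by
  rw [comm_apply, comm_apply, S.complexI.sq, map_sub, S.complexI.sq, map_neg]
  abel

theorem comm_J (S : GKStructure d M) (x : M) (v : TangentSpace (𝓡 d) x) :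
    S.comm x (S.J x v) = -S.J x (S.comm x v) := by
  rw [comm_apply, comm_apply, S.complexJ.sq, map_sub, S.complexJ.sq, map_neg]
  abel

theorem comm_commInv (S : GKStructure d M) (x : M) (h : (S.comm x).IsInvertible)
    (v : TangentSpace (𝓡 d) x) : S.comm x (S.commInv x v) = v := by
  obtain ⟨e, he⟩ := h
  rw [commInv, ← he, ContinuousLinearMap.inverse_equiv]
  simp

theorem commInv_comm (S : GKStructure d M) (x : M) (h : (S.comm x).IsInvertible)
    (v : TangentSpace (𝓡 d) x) : S.commInv x (S.comm x v) = v := by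
  obtain ⟨e, he⟩ := h
  rw [commInv, ← he, ContinuousLinearMap.inverse_equiv]
  simp

theorem commInv_of_not (S : GKStructure d M) (x : M) (h : ¬ (S.comm x).IsInvertible)
    (v : TangentSpace (𝓡 d) x) : S.commInv x v = 0 := by
  rw [commInv, ContinuousLinearMap.inverse_of_not_isInvertible h]
  rfl

theorem inner_commInv (S : GKStructure d M) (x : M) (v w : TangentSpace (𝓡 d) x) :
    S.g.inner x (S.commInv x v) w = -S.g.inner x v (S.commInv x w) := by
  by_cases h : (S.comm x).IsInvertible
  · have := S.inner_comm x (S.commInv x v) (S.commInv x w)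
    rw [S.comm_commInv x h, S.comm_commInv x h] at this
    linarith
  · rw [S.commInv_of_not x h, S.commInv_of_not x h]
    simp

theorem commInv_I (S : GKStructure d M) (x : M) (v : TangentSpace (𝓡 d) x) :
    S.commInv x (S.I x v) = -S.I x (S.commInv x v) := by
  by_cases h : (S.comm x).IsInvertible
  · have := S.comm_I x (S.commInv x v)
    rw [S.comm_commInv x h] at this
    rw [← neg_eq_iff_eq_neg, ← map_neg, ← this, S.commInv_comm x h]
  · rw [S.commInv_of_not x h, S.commInv_of_not x h]
    simp

theorem commInv_J (S : GKStructure d M) (x : M) (v : TangentSpace (𝓡 d) x) :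
    S.commInv x (S.J x v) = -S.J x (S.commInv x v) := by
  by_cases h : (S.comm x).IsInvertible
  · have := S.comm_J x (S.commInv x v)
    rw [S.comm_commInv x h] at this
    rw [← neg_eq_iff_eq_neg, ← map_neg, ← this, S.commInv_comm x h]
  · rw [S.commInv_of_not x h, S.commInv_of_not x h]
    simp

theorem Omega_aux (S : GKStructure d M) (x : M) (v : TangentSpace (𝓡 d) x) :
    S.g.inner x (S.commInv x v) v = 0 := by
  have h1 := S.inner_commInv x v v
  have h2 := S.g.symm x v (S.commInv x v)
  linarith

theorem Psi1_aux (S : GKStructure d M) (x : M) (v : TangentSpace (𝓡 d) x) :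
    (-(S.g.inner x ∘L S.commInv x ∘L S.I x)) v v = 0 := by
  change -(S.g.inner x (S.commInv x (S.I x v)) v) = 0
  have h1 := S.inner_commInv x (S.I x v) v
  have h2 := S.inner_I x v (S.commInv x v)
  have h3 := S.g.symm x v (S.I x (S.commInv x v))
  rw [S.commInv_I, map_neg, neg_apply] at h1 ⊢
  linarith

theorem Psi2_aux (S : GKStructure d M) (x : M) (v : TangentSpace (𝓡 d) x) :
    (-(S.g.inner x ∘L S.commInv x ∘L S.J x)) v v = 0 := by
  change -(S.g.inner x (S.commInv x (S.J x v)) v) = 0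
  have h1 := S.inner_commInv x (S.J x v) v
  have h2 := S.inner_J x v (S.commInv x v)
  have h3 := S.g.symm x v (S.J x (S.commInv x v))
  rw [S.commInv_J, map_neg, neg_apply] at h1 ⊢
  linarith

/-- `Ω = σ⁻¹ = g [I, J]⁻¹`, that is, `Ω (v, w) = g ([I, J]⁻¹ v, w)`. -/
def Omega (S : GKStructure d M) : DForm d M 2 := fun x =>
  twoForm (d := d) (S.g.inner x ∘L S.commInv x) (S.Omega_aux x)

/-- `Ψ₁ = Im Ω_I`, that is, `Ψ₁ (v, w) = -Ω (I v, w)`; the form `Ω + i Ψ₁` has type `(2, 0)`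
with respect to `I`. -/
def Psi1 (S : GKStructure d M) : DForm d M 2 := fun x =>
  twoForm (d := d) (-(S.g.inner x ∘L S.commInv x ∘L S.I x)) (S.Psi1_aux x)

/-- `Ψ₂ = Im Ω_J`, that is, `Ψ₂ (v, w) = -Ω (J v, w)`; the form `Ω + i Ψ₂` has type `(2, 0)`
with respect to `J`. -/
def Psi2 (S : GKStructure d M) : DForm d M 2 := fun x =>
  twoForm (d := d) (-(S.g.inner x ∘L S.commInv x ∘L S.J x)) (S.Psi2_aux x)

theorem Omega_apply (S : GKStructure d M) (x : M) (v : Fin 2 → TangentSpace (𝓡 d) x) :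
    S.Omega x v = S.g.inner x (S.commInv x (v 0)) (v 1) := rfl

theorem Psi1_apply (S : GKStructure d M) (x : M) (v : Fin 2 → TangentSpace (𝓡 d) x) :
    S.Psi1 x v = -S.Omega x ![S.I x (v 0), v 1] := rfl

theorem Psi2_apply (S : GKStructure d M) (x : M) (v : Fin 2 → TangentSpace (𝓡 d) x) :
    S.Psi2 x v = -S.Omega x ![S.J x (v 0), v 1] := rfl

end GKStructure

/-- The `(1,1)`-part `½ (β + β (I ·, I ·))` of a 2-form with respect to `I`. -/
def part11 (I : EndField d M) (β : DForm d M 2) : DForm d M 2 := fun x =>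
  (1 / 2 : ℝ) • (β x + (β x).compContinuousLinearMap (I x))

/-- The 2-form `β` is positive definite with respect to `I`: `β (v, I v) > 0` for `v ≠ 0`. -/
def PositiveForm (I : EndField d M) (β : DForm d M 2) : Prop :=
  ∀ (x : M) (v : TangentSpace (𝓡 d) x), v ≠ 0 → 0 < β x ![v, I x v]

/-- `X = -Ω⁻¹ (dh)`: the vector field `X` satisfies `Ω (X, ·) = -dh`. -/
def IsHamiltonianField (Ω : DForm d M 2) (h : M → ℝ) (X : ∀ x : M, TangentSpace (𝓡 d) x) : Prop :=
  ∀ (x : M) (v : TangentSpace (𝓡 d) x), Ω x ![X x, v] = -mvfderiv (𝓡 d) h x v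

/-- `φ` is the (global, smooth) flow of the vector field `X`. -/
structure IsFlow (X : ∀ x : M, TangentSpace (𝓡 d) x) (φ : ℝ → M → M) : Prop where
  smooth : ContMDiff (𝓘(ℝ, ℝ).prod (𝓡 d)) (𝓡 d) ∞ (fun p : ℝ × M => φ p.1 p.2)
  zero : ∀ x, φ 0 x = x
  integralCurve : ∀ x, IsMIntegralCurve (fun t => φ t x) X

end GK

/-! ### The functional -/

section Functional

variable {n : ℕ} {M : Type*} [TopologicalSpace M]
  [ChartedSpace (EuclideanSpace ℝ (Fin (4 * n))) M] [IsManifold (𝓡 (4 * n)) ∞ M]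

/-- `F₊ = 2 (Ψ₁ - Ψ₂)`. -/
def Fplus (Ψ₁ Ψ₂ : DForm (4 * n) M 2) : DForm (4 * n) M 2 := fun x => (2 : ℝ) • (Ψ₁ x - Ψ₂ x)

/-- `F₋ = 2 (-Ψ₁ - Ψ₂)`. -/
def Fminus (Ψ₁ Ψ₂ : DForm (4 * n) M 2) : DForm (4 * n) M 2 := fun x => (2 : ℝ) • (-Ψ₁ x - Ψ₂ x)

variable [T2Space M] [CompactSpace M]

/-- The integral `∫_M f α^{2n}` of a function against the top power of a 2-form, where `M` carries
the orientation given by the symplectic volume form `Ω^{2n}`. -/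
def integralPow (Ω : DForm (4 * n) M 2) (f : M → ℝ) (α : DForm (4 * n) M 2) : ℝ :=
  integral (fun x => topPow n (Ω x)) (fun x => f x • topPow n (α x))

/-- The cohomological constant `λ = log (∫ F₊^{2n} / ∫ F₋^{2n})`. -/
def GKStructure.lam (S : GKStructure (4 * n) M) : ℝ :=
  Real.log (integralPow S.Omega (fun _ => 1) (Fplus S.Psi1 S.Psi2) /
    integralPow S.Omega (fun _ => 1) (Fminus S.Psi1 S.Psi2))

/-- The value at the point given by `(Ω, Ψ₁, Ψ₂)` of the 1-form
`σ (f, h) = 1 / (2n)! ∫ (f - h) (F₊^{2n} - e^λ F₋^{2n})`. -/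
def sigmaForm (Ω : DForm (4 * n) M 2) (lam : ℝ) (Ψ₁ Ψ₂ : DForm (4 * n) M 2) (f h : M → ℝ) : ℝ :=
  1 / ((2 * n).factorial : ℝ) *
    integral (fun x => topPow n (Ω x))
      (fun x => (f x - h x) •
        (topPow n (Fplus Ψ₁ Ψ₂ x) - Real.exp lam • topPow n (Fminus Ψ₁ Ψ₂ x)))

/-- `δF_h (t) = σ (0, h)` at the point `(Ψ₁, φ_t^* Ψ₂)` of the path generated by `h`, where `φ` is
the flow of the Hamiltonian field of `h`. -/
def deltaF (S : GKStructure (4 * n) M) (h : M → ℝ) (φ : ℝ → M → M) (t : ℝ) : ℝ :=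
  sigmaForm S.Omega S.lam S.Psi1 (pullback (φ t) S.Psi2) (fun _ => 0) h

end Functional

end GenKahler

end

/-!
Write `F_ε = 2 (ε Ψ₁ - φ_t^* Ψ₂)`, so that `F_±` are the cases `ε = ±1`, and `J_t = φ_t^* J`, so that
`φ_t^* Ψ₂ = -Ω (J_t ·, ·)`. The function is an affine combination of the two integrals
`G_ε = ∫ h F_ε^{2n}`, with a negative coefficient for `ε = 1` and a positive one for `ε = -1`, and
it suffices to show `ε G_ε' ≤ 0` on `T`; the value of the constant `λ` is irrelevant.

*Closedness.* The forms `Ω`, `Ψ₁` and `Ψ₂` are closed. The condition `d^c_I ω_I = -d^c_J ω_J` provides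
one 3-form `H` which determines `∇I` and `∇J` for the Levi-Civita connection `∇`, with opposite
signs, and integrability makes `H` of type `(2,1) + (1,2)` for `I` and for `J`. For an invertible
skew endomorphism field `A`, the exterior derivative of `g (A⁻¹ ·, ·)` is the cyclic sum of
`g ((∇_{A ·} A) ·, ·)`, and the type conditions make it vanish for `A = [I, J]`, which gives `Ω`, and
for `A = I ± J`, which gives `Ψ₂ ∓ Ψ₁` (`cyclic_covDeriv_commutator`, `cyclic_covDeriv_add_smul`).

*Variation.* The flow is Hamiltonian, so it preserves `Ω` and `h`, and
`∂_t φ_t^* Ψ₂ = d (φ_t^* (ι_X Ψ₂)) = d (dh ∘ J_t)`. Define the vector field `Z` by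
`F_ε (Z, ·) = -2 dh ∘ J_t`. Then `∂_t F_ε = d (ι_Z F_ε)`, hence `∂_t F_ε^{2n} = d (ι_Z F_ε^{2n})`
(`deriv_coeff_signedForm`), and by Stokes `G_ε' = -∫ dh (Z) F_ε^{2n}`
(`hasDerivAt_integral_of_divergence`).

*Sign.* Let `F_ε (ξ, ·) = dh`. Then `dh (Z) = 2 dh (J_t ξ) = 2 F_ε (ξ, J_t ξ)`, which is
`-4 ε φ_t^* Ψ₂ (ξ, I ξ)`, so `ε dh (Z) ≥ 0` by the positivity hypothesis (`lieD_moser_field`). By the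
same hypothesis `F_ε (v, I v) > 0` for `v ≠ 0`, while `Ω (v, I v) = 0`; so the segment from `Ω` to `F_ε`
consists of nondegenerate forms, and `F_ε^{2n}` is a positive volume form for the orientation of
`Ω^{2n}` (`sign_coeff_signedForm`). Therefore `ε G_ε' ≤ 0`.

Exterior powers and integrals are handled through their coefficients in charts. An infinitesimal
change of coordinates `B` acts on the coefficient of a top power by `tr B`, which yields both
Cartan's formula for the top power (`fderiv_topPow_eq_divergence`) and the constancy of its sign
along a path of nondegenerate forms (`sign_topPow_eq_of_path`).
-/

open scoped Manifold ContDiff Bundle Topology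
open MeasureTheory

noncomputable section

namespace GenKahler

/-! ### Top powers of 2-forms -/

section TopPow

theorem topPow_apply {V : Type*} [AddCommGroup V] [Module ℝ V] [TopologicalSpace V]
    [IsTopologicalAddGroup V] [ContinuousSMul ℝ V] (n : ℕ) (α : V [⋀^Fin 2]→L[ℝ] ℝ)
    (v : Fin (4 * n) → V) :
    topPow n α v = (1 / 2 : ℝ) ^ (2 * n) * ∑ σ : Equiv.Perm (Fin (4 * n)),
      Equiv.Perm.sign σ • ∏ i : Fin (2 * n), α (pairAt (fun j => v (σ (finCongr (top_degree n) j))) i) := by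
  simp only [topPow, ContinuousAlternatingMap.smul_apply, smul_eq_mul,
    ContinuousMultilinearMap.alternatization_apply_apply]
  rfl

theorem topPow_compContinuousLinearMap {V W : Type*} [AddCommGroup V] [Module ℝ V]
    [TopologicalSpace V] [IsTopologicalAddGroup V] [ContinuousSMul ℝ V] [AddCommGroup W]
    [Module ℝ W] [TopologicalSpace W] [IsTopologicalAddGroup W] [ContinuousSMul ℝ W] (n : ℕ)
    (α : W [⋀^Fin 2]→L[ℝ] ℝ) (A : V →L[ℝ] W) :
    topPow n (α.compContinuousLinearMap A) = (topPow n α).compContinuousLinearMap A := by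
  ext v
  rw [ContinuousAlternatingMap.compContinuousLinearMap_apply, topPow_apply, topPow_apply]
  congr 1
  refine Finset.sum_congr rfl fun σ _ => ?_
  congr 1
  refine Finset.prod_congr rfl fun i _ => ?_
  rw [ContinuousAlternatingMap.compContinuousLinearMap_apply]
  congr 1
  ext j
  fin_cases j <;> rfl

theorem contDiff_alternating_apply {V : Type*} [NormedAddCommGroup V] [NormedSpace ℝ V] {k : ℕ}
    (v : Fin k → V) : ContDiff ℝ ∞ (fun α : V [⋀^Fin k]→L[ℝ] ℝ => α v) :=
  ContinuousLinearMap.contDiff (E := V [⋀^Fin k]→L[ℝ] ℝ) (F := ℝ)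
    (ContinuousAlternatingMap.apply ℝ V ℝ v)

theorem contDiff_topPow_apply {V : Type*} [NormedAddCommGroup V] [NormedSpace ℝ V] (n : ℕ)
    (v : Fin (4 * n) → V) :
    ContDiff ℝ ∞ (fun α : V [⋀^Fin 2]→L[ℝ] ℝ => topPow n α v) := by
  simp only [topPow_apply]
  refine contDiff_const.mul (ContDiff.sum fun σ _ => ?_)
  refine ContDiff.const_smul _ (contDiff_prod fun i _ => ?_)
  exact contDiff_alternating_apply _

/-- A form of top degree is multiplied by the determinant under an endomorphism. -/
theorem compContinuousLinearMap_eq_det_smul {d : ℕ}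
    (η : EuclideanSpace ℝ (Fin d) [⋀^Fin d]→L[ℝ] ℝ)
    (A : EuclideanSpace ℝ (Fin d) →L[ℝ] EuclideanSpace ℝ (Fin d))
    (v : Fin d → EuclideanSpace ℝ (Fin d)) :
    η (fun i => A (v i)) = A.det * η v := by
  have h := AlternatingMap.eq_smul_basis_det (EuclideanSpace.basisFun (Fin d) ℝ).toBasis
    η.toAlternatingMap
  have h1 : ∀ w, η w = η.toAlternatingMap w := fun _ => rfl
  rw [h1, h1, h]
  simp only [AlternatingMap.smul_apply, smul_eq_mul]
  have := Module.Basis.det_comp (EuclideanSpace.basisFun (Fin d) ℝ).toBasis A.toLinearMap v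
  have h2 : (fun i => A (v i)) = ⇑A.toLinearMap ∘ v := rfl
  rw [h2, this]
  simp only [ContinuousLinearMap.det]
  ring

theorem hasDerivAt_det_id_add_smul {d : ℕ}
    (B : EuclideanSpace ℝ (Fin d) →L[ℝ] EuclideanSpace ℝ (Fin d)) :
    HasDerivAt (fun s : ℝ => (ContinuousLinearMap.id ℝ _ + s • B).det)
      (LinearMap.trace ℝ _ B.toLinearMap) 0 := by
  set b := (EuclideanSpace.basisFun (Fin d) ℝ).toBasis
  set N := LinearMap.toMatrix b b B.toLinearMap with hN
  have h1 : ∀ s : ℝ, (ContinuousLinearMap.id ℝ (EuclideanSpace ℝ (Fin d)) + s • B).det =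
      Polynomial.eval s (1 + (Polynomial.X : Polynomial ℝ) • N.map Polynomial.C).det := by
    intro s
    rw [ContinuousLinearMap.det, ← LinearMap.det_toMatrix b, ← Polynomial.coe_evalRingHom,
      RingHom.map_det]
    congr 1
    have : (↑(ContinuousLinearMap.id ℝ (EuclideanSpace ℝ (Fin d)) + s • B) :
        EuclideanSpace ℝ (Fin d) →ₗ[ℝ] EuclideanSpace ℝ (Fin d)) =
        LinearMap.id + s • B.toLinearMap := rfl
    rw [this, map_add, map_smul, LinearMap.toMatrix_id, ← hN]
    ext i j
    simp only [Matrix.add_apply, Matrix.smul_apply, RingHom.mapMatrix_apply, Matrix.map_apply,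
      map_add, smul_eq_mul, Polynomial.coe_evalRingHom, Matrix.one_apply, apply_ite, Polynomial.eval_one, Polynomial.eval_zero]
    rw [Polynomial.eval_mul, Polynomial.eval_X, Polynomial.eval_C]
  simp only [h1]
  rw [LinearMap.trace_eq_matrix_trace ℝ b, ← hN, ← Matrix.derivative_det_one_add_X_smul]
  exact Polynomial.hasDerivAt _ _

/-- The derivative of the top power in the direction of the infinitesimal pull-back
`α (B ·, ·) + α (·, B ·)` of `α` is `tr B` times the top power. -/
theorem fderiv_topPow_fderivCompContinuousLinearMap (n : ℕ)
    (α : EuclideanSpace ℝ (Fin (4 * n)) [⋀^Fin 2]→L[ℝ] ℝ)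
    (B : EuclideanSpace ℝ (Fin (4 * n)) →L[ℝ] EuclideanSpace ℝ (Fin (4 * n)))
    (v : Fin (4 * n) → EuclideanSpace ℝ (Fin (4 * n))) :
    fderiv ℝ (fun α => topPow n α v) α
        (α.fderivCompContinuousLinearMap (ContinuousLinearMap.id ℝ _) B) =
      LinearMap.trace ℝ _ B.toLinearMap * topPow n α v := by
  have hl : HasDerivAt (fun s : ℝ => ContinuousLinearMap.id ℝ (EuclideanSpace ℝ (Fin (4 * n))) + s • B)
      B 0 := by
    simpa using ((hasDerivAt_id (0 : ℝ)).smul_const B).const_add (ContinuousLinearMap.id ℝ _)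
  have hc : HasDerivAt (fun s : ℝ => α.compContinuousLinearMap
      (ContinuousLinearMap.id ℝ (EuclideanSpace ℝ (Fin (4 * n))) + s • B))
      (α.fderivCompContinuousLinearMap (ContinuousLinearMap.id ℝ _) B) 0 := by
    have := ((hasFDerivAt_const α (0 : ℝ)).continuousAlternatingMapCompContinuousLinearMap
      hl.hasFDerivAt).hasDerivAt
    have h0 : ContinuousLinearMap.id ℝ (EuclideanSpace ℝ (Fin (4 * n))) + (0 : ℝ) • B =
        ContinuousLinearMap.id ℝ _ := by ext w; simp
    rw [h0] at this
    simpa using this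
  have hd : HasFDerivAt (fun α => topPow n α v) (fderiv ℝ (fun α => topPow n α v) α)
      (α.compContinuousLinearMap
        (ContinuousLinearMap.id ℝ (EuclideanSpace ℝ (Fin (4 * n))) + (0 : ℝ) • B)) := by
    have : α.compContinuousLinearMap
        (ContinuousLinearMap.id ℝ (EuclideanSpace ℝ (Fin (4 * n))) + (0 : ℝ) • B) = α := by
      ext w; simp
    rw [this]
    exact ((contDiff_topPow_apply n v).differentiable (by simp)).differentiableAt.hasFDerivAt
  have h1 := hd.comp_hasDerivAt (0 : ℝ) hc
  have h2 := (hasDerivAt_det_id_add_smul B).mul_const (topPow n α v)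
  refine h1.unique (h2.congr_of_eventuallyEq (Filter.Eventually.of_forall fun s => ?_))
  simp only [Function.comp_def]
  rw [topPow_compContinuousLinearMap, ContinuousAlternatingMap.compContinuousLinearMap_apply,
    ← compContinuousLinearMap_eq_det_smul]
  rfl

end TopPow

/-! ### Forms of degree two as bilinear maps -/

section Two

variable {V : Type*} [AddCommGroup V] [Module ℝ V] [TopologicalSpace V]

theorem apply_swap (α : V [⋀^Fin 2]→L[ℝ] ℝ) (v w : V) : α ![v, w] = -α ![w, v] := by
  have h : α (![v, w] ∘ Equiv.swap 0 1) = -α ![v, w] :=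
    α.toAlternatingMap.map_swap ![v, w] (by decide)
  have h1 : ![v, w] ∘ Equiv.swap 0 1 = ![w, v] := by ext i; fin_cases i <;> rfl
  rw [h1] at h
  linarith

theorem apply_self (α : V [⋀^Fin 2]→L[ℝ] ℝ) (v : V) : α ![v, v] = 0 := by
  have := apply_swap α v v
  linarith

theorem ext_two {α β : V [⋀^Fin 2]→L[ℝ] ℝ} (h : ∀ v w, α ![v, w] = β ![v, w]) : α = β := by
  ext v
  have : v = ![v 0, v 1] := by ext i; fin_cases i <;> rfl
  rw [this]
  exact h _ _

/-- A 2-form is nondegenerate if only the zero vector is orthogonal to all vectors. -/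
def Nondeg (α : V [⋀^Fin 2]→L[ℝ] ℝ) : Prop := ∀ v, (∀ w, α ![v, w] = 0) → v = 0

end Two

section Bilin

variable {V : Type*} [NormedAddCommGroup V] [NormedSpace ℝ V]

/-- The bilinear map `v w ↦ α (v, w)` of a 2-form. -/
def bilin (α : V [⋀^Fin 2]→L[ℝ] ℝ) : V →L[ℝ] V →L[ℝ] ℝ :=
  ((ContinuousAlternatingMap.ofSubsingletonLIE (𝕜 := ℝ) (E := V) (F := ℝ) (0 : Fin 1)).symm.toContinuousLinearEquiv :
    V [⋀^Fin 1]→L[ℝ] ℝ →L[ℝ] V →L[ℝ] ℝ) ∘L α.curryLeft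

@[simp]
theorem bilin_apply (α : V [⋀^Fin 2]→L[ℝ] ℝ) (v w : V) : bilin α v w = α ![v, w] := by
  have : ∀ β : V [⋀^Fin 1]→L[ℝ] ℝ,
      (ContinuousAlternatingMap.ofSubsingletonLIE (𝕜 := ℝ) (E := V) (F := ℝ) (0 : Fin 1)).symm β w = β ![w] := by
    intro β
    change β (fun _ => w) = _
    congr 1
    ext i
    fin_cases i
    rfl
  exact this (α.curryLeft v)

theorem Nondeg.isInvertible_bilin [FiniteDimensional ℝ V] {α : V [⋀^Fin 2]→L[ℝ] ℝ}
    (h : Nondeg α) : (bilin α).IsInvertible := by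
  have hinj : Function.Injective (bilin α).toLinearMap := by
    rw [← LinearMap.ker_eq_bot, LinearMap.ker_eq_bot']
    intro v hv
    refine h v fun w => ?_
    rw [← bilin_apply]
    exact congrArg (fun l : V →L[ℝ] ℝ => l w) hv
  have hdim : Module.finrank ℝ V = Module.finrank ℝ (V →L[ℝ] ℝ) := by
    rw [← (LinearMap.toContinuousLinearMap (𝕜 := ℝ) (E := V) (F' := ℝ)).finrank_eq]
    exact (Subspace.dual_finrank_eq).symm
  refine ⟨(LinearEquiv.ofInjectiveOfFinrankEq _ hinj hdim).toContinuousLinearEquiv, ?_⟩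
  ext v w
  rfl

theorem contDiff_bilin [FiniteDimensional ℝ V] :
    ContDiff ℝ ∞ (fun α : V [⋀^Fin 2]→L[ℝ] ℝ => bilin α) := by
  rw [contDiff_clm_apply_iff]
  intro v
  rw [contDiff_clm_apply_iff]
  intro w
  simp only [bilin_apply]
  exact contDiff_alternating_apply _

theorem fderivCompContinuousLinearMap_id_apply (α : V [⋀^Fin 2]→L[ℝ] ℝ) (B : V →L[ℝ] V)
    (v w : V) :
    α.fderivCompContinuousLinearMap (ContinuousLinearMap.id ℝ _) B ![v, w] =
      α ![B v, w] + α ![v, B w] := by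
  rw [ContinuousAlternatingMap.fderivCompContinuousLinearMap_apply, Fin.sum_univ_two]
  congr 2 <;> ext i <;> fin_cases i <;> rfl

/-- Every 2-form `γ` is an infinitesimal pull-back of a given nondegenerate 2-form `α`. -/
theorem Nondeg.fderivComp_inverse [FiniteDimensional ℝ V] {α : V [⋀^Fin 2]→L[ℝ] ℝ}
    (h : Nondeg α) (γ : V [⋀^Fin 2]→L[ℝ] ℝ) :
    α.fderivCompContinuousLinearMap (ContinuousLinearMap.id ℝ _)
      ((1 / 2 : ℝ) • (bilin α).inverse ∘L bilin γ) = γ := by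
  have key : ∀ v w, α ![((1 / 2 : ℝ) • (bilin α).inverse ∘L bilin γ) v, w] = 1 / 2 * γ ![v, w] := by
    intro v w
    obtain ⟨e, he⟩ := h.isInvertible_bilin
    rw [← bilin_apply, ← bilin_apply, ← he, ContinuousLinearMap.inverse_equiv]
    simp
  refine ext_two fun v w => ?_
  rw [fderivCompContinuousLinearMap_id_apply, key, apply_swap α v, key, apply_swap γ w]
  ring

end Bilin

/-! ### The sign of the top power along a path of nondegenerate forms -/

/-- A solution of a linear equation `c' = f c` does not change sign. -/
theorem sign_eq_of_hasDerivAt_mul {c f : ℝ → ℝ} (hf : Continuous f)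
    (hc : ∀ s ∈ Set.Icc (0 : ℝ) 1, HasDerivAt c (f s * c s) s) :
    Real.sign (c 0) = Real.sign (c 1) := by
  set Φ : ℝ → ℝ := fun s => ∫ r in (0 : ℝ)..s, f r
  have hΦ : ∀ s, HasDerivAt Φ (f s) s := fun s =>
    intervalIntegral.integral_hasDerivAt_right (hf.intervalIntegrable _ _)
      hf.stronglyMeasurable.stronglyMeasurableAtFilter hf.continuousAt
  have hd : ∀ s ∈ Set.Icc (0 : ℝ) 1, HasDerivAt (fun s => c s * Real.exp (-Φ s)) 0 s := by
    intro s hs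
    have := (hc s hs).mul (hΦ s).neg.exp
    have h0 : f s * c s * Real.exp (-Φ s) + c s * (Real.exp (-Φ s) * -f s) = 0 := by ring
    rw [← h0]
    exact this
  have hconst := constant_of_has_deriv_right_zero
    (f := fun s => c s * Real.exp (-Φ s)) (a := 0) (b := 1)
    (fun s hs => (hd s hs).continuousAt.continuousWithinAt)
    (fun s hs => (hd s (Set.Ico_subset_Icc_self hs)).hasDerivWithinAt) 1 (by simp)
  have h0 : Φ 0 = 0 := intervalIntegral.integral_same
  simp only [h0, neg_zero, Real.exp_zero, mul_one] at hconst
  rw [← hconst]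
  have hpos := Real.exp_pos (-Φ 1)
  rcases lt_trichotomy (c 1) 0 with h | h | h
  · rw [Real.sign_of_neg h, Real.sign_of_neg (mul_neg_of_neg_of_pos h hpos)]
  · simp [h]
  · rw [Real.sign_of_pos h, Real.sign_of_pos (mul_pos h hpos)]

/-- Along a path of nondegenerate 2-forms the top power `p` satisfies a linear equation
`p' = f p`, so its sign is constant. -/
theorem sign_topPow_eq_of_path (n : ℕ)
    {α : ℝ → EuclideanSpace ℝ (Fin (4 * n)) [⋀^Fin 2]→L[ℝ] ℝ}
    {U : Set ℝ} (hU : IsOpen U) (h01 : Set.Icc (0 : ℝ) 1 ⊆ U) (hα : ContDiffOn ℝ 1 α U)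
    (hnd : ∀ s ∈ Set.Icc (0 : ℝ) 1, Nondeg (α s))
    (v : Fin (4 * n) → EuclideanSpace ℝ (Fin (4 * n))) :
    Real.sign (topPow n (α 0) v) = Real.sign (topPow n (α 1) v) := by
  set B := fun s => ((1 / 2 : ℝ) • (bilin (α s)).inverse ∘L bilin (deriv α s)) with hB
  set f : ℝ → ℝ := fun s => LinearMap.trace ℝ _ (B s).toLinearMap with hf
  have hcont : ContinuousOn f (Set.Icc 0 1) := by
    have h1 : ContinuousOn B (Set.Icc 0 1) := by
      intro s hs
      have hs' : U ∈ 𝓝 s := hU.mem_nhds (h01 hs)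
      have hαs : ContinuousAt α s := (hα.continuousOn.continuousAt hs')
      have hb1 : ContinuousAt (fun s => bilin (α s)) s :=
        contDiff_bilin.continuous.continuousAt.comp hαs
      have hb2 : ContinuousAt (fun s => bilin (deriv α s)) s :=
        contDiff_bilin.continuous.continuousAt.comp
          ((hα.continuousOn_deriv_of_isOpen hU le_rfl).continuousAt hs')
      have hb3 : ContinuousAt (fun s => (bilin (α s)).inverse) s :=
        ContinuousAt.comp (f := fun s => bilin (α s))
          ((hnd s hs).isInvertible_bilin.contDiffAt_map_inverse (n := 1)).continuousAt hb1
      exact ((hb3.clm_comp hb2).const_smul (1 / 2 : ℝ)).continuousWithinAt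
    have h2 : Continuous (fun A : EuclideanSpace ℝ (Fin (4 * n)) →L[ℝ] EuclideanSpace ℝ (Fin (4 * n))
        => LinearMap.trace ℝ _ A.toLinearMap) :=
      LinearMap.continuous_of_finiteDimensional
        ((LinearMap.trace ℝ _) ∘ₗ (ContinuousLinearMap.coeLM ℝ :
          (EuclideanSpace ℝ (Fin (4 * n)) →L[ℝ] EuclideanSpace ℝ (Fin (4 * n))) →ₗ[ℝ]
            (EuclideanSpace ℝ (Fin (4 * n)) →ₗ[ℝ] EuclideanSpace ℝ (Fin (4 * n)))))
    exact h2.comp_continuousOn h1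
  set f' : ℝ → ℝ := Set.IccExtend zero_le_one ((Set.Icc (0 : ℝ) 1).domRestrict f) with hf'
  have hf'c : Continuous f' := (continuousOn_iff_continuous_domRestrict.1 hcont).Icc_extend'
  refine sign_eq_of_hasDerivAt_mul (c := fun s => topPow n (α s) v) hf'c fun s hs => ?_
  have hd : HasDerivAt α (deriv α s) s :=
    ((hα.differentiableOn one_ne_zero).differentiableAt (hU.mem_nhds (h01 hs))).hasDerivAt
  have hp := ((contDiff_topPow_apply n v).differentiable (by simp)).differentiableAt.hasFDerivAt
    (x := α s)
  have := hp.comp_hasDerivAt s hd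
  have h1 : f' s * topPow n (α s) v = fderiv ℝ (fun α => topPow n α v) (α s) (deriv α s) := by
    rw [hf', Set.IccExtend_of_mem _ _ hs]
    conv_rhs => rw [← (hnd s hs).fderivComp_inverse (deriv α s)]
    rw [fderiv_topPow_fderivCompContinuousLinearMap]
    rfl
  rw [h1]
  exact this

/-! ### Calculus of forms on normed spaces -/

section Smooth

variable {D V W : Type*} [NormedAddCommGroup D] [NormedSpace ℝ D] [NormedAddCommGroup V]
  [NormedSpace ℝ V] [NormedAddCommGroup W] [NormedSpace ℝ W]

/-- In finite dimensions a form-valued map is smooth if all its evaluations are. -/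
theorem contDiffAt_alternating [FiniteDimensional ℝ V] {k : ℕ} {m : WithTop ℕ∞}
    {f : D → V [⋀^Fin k]→L[ℝ] ℝ} {x : D} (h : ∀ v, ContDiffAt ℝ m (fun y => f y v) x) :
    ContDiffAt ℝ m f x := by
  classical
  set b := Module.finBasis ℝ V
  let ev : V [⋀^Fin k]→L[ℝ] ℝ →ₗ[ℝ] ((Fin k → Fin (Module.finrank ℝ V)) → ℝ) :=
    { toFun := fun α s => α (fun i => b (s i))
      map_add' := fun _ _ => rfl
      map_smul' := fun _ _ => rfl }
  have hinj : LinearMap.ker ev = ⊥ := by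
    rw [LinearMap.ker_eq_bot']
    intro α hα
    have : α.toAlternatingMap = 0 := by
      refine Module.Basis.ext_alternating b fun s _ => ?_
      exact congrFun hα s
    exact ContinuousAlternatingMap.toAlternatingMap_injective this
  obtain ⟨l, hl⟩ := LinearMap.exists_leftInverse_of_injective ev hinj
  have h1 : f = fun y => (LinearMap.toContinuousLinearMap l) (ev (f y)) := by
    ext1 y
    exact (congrArg (fun g => g (f y)) hl).symm
  rw [h1]
  refine (LinearMap.toContinuousLinearMap l).contDiff.contDiffAt.comp x ?_
  rw [contDiffAt_pi]
  intro s
  exact h _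

theorem contDiffAt_compContinuousLinearMap [FiniteDimensional ℝ V] {k : ℕ} {m : WithTop ℕ∞}
    {f : D → W [⋀^Fin k]→L[ℝ] ℝ} {A : D → V →L[ℝ] W} {x : D} (hf : ContDiffAt ℝ m f x)
    (hA : ContDiffAt ℝ m A x) :
    ContDiffAt ℝ m (fun y => (f y).compContinuousLinearMap (A y)) x := by
  refine contDiffAt_alternating fun v => ?_
  have h1 : ContDiffAt ℝ m (fun y =>
      ContinuousMultilinearMap.compContinuousLinearMapContinuousMultilinear ℝ
        (fun _ : Fin k => V) (fun _ => W) ℝ (fun _ => A y)) x :=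
    (ContinuousMultilinearMap.contDiff _).contDiffAt.comp x
      (contDiffAt_pi.2 fun _ => hA)
  have h2 : ContDiffAt ℝ m (fun y =>
      (ContinuousAlternatingMap.toContinuousMultilinearMapLI :
        W [⋀^Fin k]→L[ℝ] ℝ →ₗᵢ[ℝ] ContinuousMultilinearMap ℝ (fun _ : Fin k => W) ℝ) (f y)) x :=
    (LinearIsometry.contDiff _).contDiffAt.comp x hf
  have h3 := h1.clm_apply h2
  exact (ContinuousLinearMap.contDiff (ContinuousMultilinearMap.apply ℝ (fun _ : Fin k => V) ℝ v)).contDiffAt.comp x h3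

theorem extDeriv_two_apply {ζ : V → V [⋀^Fin 2]→L[ℝ] ℝ} {y : V} (u v w : V) :
    extDeriv ζ y ![u, v, w] =
      fderiv ℝ ζ y u ![v, w] - fderiv ℝ ζ y v ![u, w] + fderiv ℝ ζ y w ![u, v] := by
  rw [extDeriv, ContinuousAlternatingMap.alternatizeUncurryFin_apply, Fin.sum_univ_three]
  have h0 : (0 : Fin 3).removeNth ![u, v, w] = ![v, w] := by ext i; fin_cases i <;> rfl
  have h1 : (1 : Fin 3).removeNth ![u, v, w] = ![u, w] := by ext i; fin_cases i <;> rfl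
  have h2 : (2 : Fin 3).removeNth ![u, v, w] = ![u, v] := by ext i; fin_cases i <;> rfl
  rw [h0, h1, h2]
  simp
  ring

theorem sum_fderiv_of_extDeriv_eq_zero {ζ : V → V [⋀^Fin 2]→L[ℝ] ℝ} {y : V}
    (hcl : extDeriv ζ y = 0) (u v w : V) :
    fderiv ℝ ζ y u ![v, w] - fderiv ℝ ζ y v ![u, w] + fderiv ℝ ζ y w ![u, v] = 0 := by
  rw [← extDeriv_two_apply, hcl]
  rfl

theorem fderiv_alternating_apply {k : ℕ} {f : D → V [⋀^Fin k]→L[ℝ] ℝ} {x : D}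
    (h : DifferentiableAt ℝ f x) (v : Fin k → V) (u : D) :
    fderiv ℝ (fun y => f y v) x u = fderiv ℝ f x u v := by
  have := ((contDiff_alternating_apply v).differentiable (by simp)).differentiableAt.hasFDerivAt
    (x := f x)
  have h1 : HasFDerivAt (fun α : V [⋀^Fin k]→L[ℝ] ℝ => α v)
      (ContinuousAlternatingMap.apply ℝ V ℝ v : V [⋀^Fin k]→L[ℝ] ℝ →L[ℝ] ℝ) (f x) :=
    ContinuousLinearMap.hasFDerivAt (E := V [⋀^Fin k]→L[ℝ] ℝ) (F := ℝ)
      (ContinuousAlternatingMap.apply ℝ V ℝ v)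
  have h2 := h1.comp x h.hasFDerivAt
  have h3 := h2.fderiv
  exact congrArg (fun l : D →L[ℝ] ℝ => l u) h3

/-- For a closed 2-form `Θ` on `ℝ × V`, the time derivative of its restriction to the slices
`{t} × V` is the exterior derivative of the 1-form `Θ (∂_t, ·)` on the slice. -/
theorem fderiv_time_of_closed {Θ : ℝ × V → (ℝ × V) [⋀^Fin 2]→L[ℝ] ℝ} {t : ℝ} {y : V}
    (hΘ : DifferentiableAt ℝ Θ (t, y)) (hcl : extDeriv Θ (t, y) = 0) (v w : V) :
    deriv (fun s => Θ (s, y) ![(0, v), (0, w)]) t =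
      fderiv ℝ (fun z => Θ (t, z) ![(1, 0), (0, w)]) y v -
        fderiv ℝ (fun z => Θ (t, z) ![(1, 0), (0, v)]) y w := by
  have h := sum_fderiv_of_extDeriv_eq_zero hcl (1, 0) (0, v) (0, w)
  have hd : ∀ a : Fin 2 → ℝ × V, HasFDerivAt (fun p => Θ p a) (fderiv ℝ (fun p => Θ p a) (t, y))
      (t, y) := fun a =>
    (DifferentiableAt.comp (t, y) ((contDiff_alternating_apply a).differentiable
      (by simp)).differentiableAt hΘ).hasFDerivAt
  have e1 : deriv (fun s => Θ (s, y) ![(0, v), (0, w)]) t =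
      fderiv ℝ Θ (t, y) (1, 0) ![(0, v), (0, w)] := by
    rw [← fderiv_alternating_apply hΘ]
    exact ((hd _).comp_hasDerivAt t ((hasDerivAt_id t).prodMk (hasDerivAt_const t y))).deriv
  have e2 : ∀ (a : Fin 2 → ℝ × V) (u : V), fderiv ℝ (fun z => Θ (t, z) a) y u =
      fderiv ℝ Θ (t, y) (0, u) a := by
    intro a u
    rw [← fderiv_alternating_apply hΘ]
    have := ((hd a).comp y ((hasFDerivAt_const t y).prodMk (hasFDerivAt_id y))).fderiv
    have h3 := congrArg (fun l : V →L[ℝ] ℝ => l u) this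
    have h4 : fderiv ℝ ((fun p => Θ p a) ∘ fun z => (t, z)) y u =
        fderiv ℝ (fun p => Θ p a) (t, y) (0, u) := by simpa using h3
    exact h4
  rw [e1, e2, e2]
  linarith

set_option synthInstance.maxHeartbeats 200000 in
/-- The product rule for the contraction of a 2-form with a vector field. -/
theorem fderiv_contract [FiniteDimensional ℝ V] {ζ : V → V [⋀^Fin 2]→L[ℝ] ℝ} {Z : V → V} {y : V}
    (hζ : DifferentiableAt ℝ ζ y) (hZ : DifferentiableAt ℝ Z y) (v w : V) :
    fderiv ℝ (fun z => ζ z ![Z z, w]) y v =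
      fderiv ℝ ζ y v ![Z y, w] + ζ y ![fderiv ℝ Z y v, w] := by
  have h0 : DifferentiableAt ℝ (fun z => bilin (ζ z)) y :=
    DifferentiableAt.comp y (contDiff_bilin.differentiable (by simp)).differentiableAt hζ
  have h1 := h0.hasFDerivAt
  have h2 := (h1.clm_apply hZ.hasFDerivAt).clm_apply (hasFDerivAt_const w y)
  have h3 := congrArg (fun l : V →L[ℝ] ℝ => l v) h2.fderiv
  have h4 : fderiv ℝ (fun z => bilin (ζ z)) y v (Z y) w = fderiv ℝ ζ y v ![Z y, w] := by
    rw [← fderiv_alternating_apply hζ]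
    have h5 := ((h1.clm_apply (hasFDerivAt_const (Z y) y)).clm_apply
      (hasFDerivAt_const w y)).fderiv
    have h6 := congrArg (fun l : V →L[ℝ] ℝ => l v) h5
    simp only [bilin_apply] at h6
    rw [h6]
    simp
  simp only [bilin_apply] at h3
  rw [h3]
  simp [h4]
  ring

end Smooth

section Divergence

variable {d : ℕ}

/-- The divergence of a vector field on Euclidean space. -/
def divergence (W : EuclideanSpace ℝ (Fin d) → EuclideanSpace ℝ (Fin d))
    (y : EuclideanSpace ℝ (Fin d)) : ℝ :=
  LinearMap.trace ℝ _ (fderiv ℝ W y).toLinearMap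

theorem divergence_eq_sum {W : EuclideanSpace ℝ (Fin d) → EuclideanSpace ℝ (Fin d)}
    {y : EuclideanSpace ℝ (Fin d)} (h : DifferentiableAt ℝ W y) :
    divergence W y = ∑ i, fderiv ℝ (fun z => W z i) y (EuclideanSpace.basisFun (Fin d) ℝ i) := by
  rw [divergence, LinearMap.trace_eq_matrix_trace ℝ (EuclideanSpace.basisFun (Fin d) ℝ).toBasis,
    Matrix.trace]
  refine Finset.sum_congr rfl fun i _ => ?_
  have h1 : HasFDerivAt (fun z => W z i) ((EuclideanSpace.proj i : _ →L[ℝ] ℝ) ∘L fderiv ℝ W y) y :=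
    (EuclideanSpace.proj i : EuclideanSpace ℝ (Fin d) →L[ℝ] ℝ).hasFDerivAt.comp y h.hasFDerivAt
  rw [h1.fderiv, Matrix.diag_apply, LinearMap.toMatrix_apply]
  simp

theorem divergence_smul {c : EuclideanSpace ℝ (Fin d) → ℝ}
    {W : EuclideanSpace ℝ (Fin d) → EuclideanSpace ℝ (Fin d)}
    {y : EuclideanSpace ℝ (Fin d)} (hc : DifferentiableAt ℝ c y) (h : DifferentiableAt ℝ W y) :
    divergence (fun z => c z • W z) y = c y * divergence W y + fderiv ℝ c y (W y) := by
  have h1 := (hc.hasFDerivAt.smul h.hasFDerivAt).fderiv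
  have h2 : fderiv ℝ (fun z => c z • W z) y =
      c y • fderiv ℝ W y + (fderiv ℝ c y).smulRight (W y) := h1
  rw [divergence, divergence, h2]
  have h3 : (c y • fderiv ℝ W y + (fderiv ℝ c y).smulRight (W y)).toLinearMap =
      c y • (fderiv ℝ W y).toLinearMap + (fderiv ℝ c y).toLinearMap.smulRight (W y) := rfl
  rw [h3, map_add, map_smul, LinearMap.trace_smulRight]
  rfl

theorem divergence_congr {W W' : EuclideanSpace ℝ (Fin d) → EuclideanSpace ℝ (Fin d)}
    {y : EuclideanSpace ℝ (Fin d)} (h : W =ᶠ[𝓝 y] W') : divergence W y = divergence W' y := by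
  rw [divergence, divergence, h.fderiv_eq]

/-- The divergence theorem for compactly supported vector fields. -/
theorem integral_divergence_eq_zero
    {W : EuclideanSpace ℝ (Fin d) → EuclideanSpace ℝ (Fin d)} (hW : ContDiff ℝ 1 W)
    (hs : HasCompactSupport W) : ∫ y, divergence W y = 0 := by
  have hWi : ∀ i, ContDiff ℝ 1 (fun z => W z i) := fun i =>
    (EuclideanSpace.proj i : EuclideanSpace ℝ (Fin d) →L[ℝ] ℝ).contDiff.comp hW
  have hsi : ∀ i, HasCompactSupport (fun z => W z i) := fun i =>
    hs.comp_left (g := fun x : EuclideanSpace ℝ (Fin d) => x i) rfl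
  have hint : ∀ i, Integrable (fun y => fderiv ℝ (fun z => W z i) y
      (EuclideanSpace.basisFun (Fin d) ℝ i)) := fun i =>
    Continuous.integrable_of_hasCompactSupport
      (((hWi i).continuous_fderiv one_ne_zero).clm_apply continuous_const)
      ((hsi i).fderiv_apply (𝕜 := ℝ) _)
  have hz : ∀ i, ∫ y, fderiv ℝ (fun z => W z i) y (EuclideanSpace.basisFun (Fin d) ℝ i) = 0 := by
    intro i
    have := integral_mul_fderiv_eq_neg_fderiv_mul_of_integrable (μ := volume)
      (f := fun _ : EuclideanSpace ℝ (Fin d) => (1 : ℝ)) (g := fun z => W z i)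
      (v := EuclideanSpace.basisFun (Fin d) ℝ i) (by simp) (by simpa using hint i)
      (by simpa using (hWi i).continuous.integrable_of_hasCompactSupport (hsi i))
      (fun x _ => differentiableAt_const _)
      (fun x _ => ((hWi i).differentiable one_ne_zero).differentiableAt)
    simpa using this
  have h1 : (fun y => divergence W y) = fun y => ∑ i, fderiv ℝ (fun z => W z i) y
      (EuclideanSpace.basisFun (Fin d) ℝ i) := by
    ext y
    exact divergence_eq_sum ((hW.differentiable one_ne_zero).differentiableAt)
  rw [h1, integral_finsetSum _ fun i _ => hint i]
  exact Finset.sum_eq_zero fun i _ => hz i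

end Divergence

/-- Cartan's formula for the top power `p` of a closed 2-form `ζ`: if `ζ (Z, ·) = β` and
`γ = dβ`, then the derivative of `p` in the direction `γ` is the divergence of `p(ζ) Z`. -/
theorem fderiv_topPow_eq_divergence (n : ℕ)
    {ζ : EuclideanSpace ℝ (Fin (4 * n)) → EuclideanSpace ℝ (Fin (4 * n)) [⋀^Fin 2]→L[ℝ] ℝ}
    {Z : EuclideanSpace ℝ (Fin (4 * n)) → EuclideanSpace ℝ (Fin (4 * n))}
    {y : EuclideanSpace ℝ (Fin (4 * n))} (hζ : DifferentiableAt ℝ ζ y)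
    (hZ : DifferentiableAt ℝ Z y) (hcl : extDeriv ζ y = 0)
    {γ : EuclideanSpace ℝ (Fin (4 * n)) [⋀^Fin 2]→L[ℝ] ℝ}
    (hγ : ∀ v w, γ ![v, w] = fderiv ℝ (fun z => ζ z ![Z z, w]) y v -
      fderiv ℝ (fun z => ζ z ![Z z, v]) y w)
    (e : Fin (4 * n) → EuclideanSpace ℝ (Fin (4 * n))) :
    fderiv ℝ (fun α => topPow n α e) (ζ y) γ =
      divergence (fun z => topPow n (ζ z) e • Z z) y := by
  have hβ := fun v w => fderiv_contract hζ hZ v w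
  have hγ' : γ = fderiv ℝ ζ y (Z y) +
      (ζ y).fderivCompContinuousLinearMap (ContinuousLinearMap.id ℝ _) (fderiv ℝ Z y) := by
    refine ext_two fun v w => ?_
    have h := sum_fderiv_of_extDeriv_eq_zero hcl (Z y) v w
    rw [hγ, hβ, hβ, ContinuousAlternatingMap.add_apply, fderivCompContinuousLinearMap_id_apply,
      apply_swap (ζ y) v]
    linarith
  have hp := ((contDiff_topPow_apply n e).differentiable (by simp)).differentiableAt.hasFDerivAt
    (x := ζ y)
  have hc := hp.comp y hζ.hasFDerivAt
  have hc' : HasFDerivAt (fun z => topPow n (ζ z) e)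
      (fderiv ℝ (fun α => topPow n α e) (ζ y) ∘L fderiv ℝ ζ y) y := hc
  rw [hγ', map_add, fderiv_topPow_fderivCompContinuousLinearMap,
    divergence_smul hc'.differentiableAt hZ, hc'.fderiv, add_comm, divergence, mul_comm]
  rfl

/-! ### First jets of Hermitian structures and the torsion 3-form -/

section Jets

set_option synthInstance.maxHeartbeats 200000

variable {V : Type*} [NormedAddCommGroup V] [NormedSpace ℝ V]

/-- The trilinear map of a 3-form. -/
def trilin (η : V [⋀^Fin 3]→L[ℝ] ℝ) : V →ₗ[ℝ] V →ₗ[ℝ] V →ₗ[ℝ] ℝ where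
  toFun u :=
    { toFun := fun v =>
        { toFun := fun w => η ![u, v, w]
          map_add' := fun w w' => congrArg (fun l => l ![])
            (map_add ((η.curryLeft u).curryLeft v).curryLeft w w')
          map_smul' := fun c w => congrArg (fun l => l ![])
            (map_smul ((η.curryLeft u).curryLeft v).curryLeft c w) }
      map_add' := fun v v' => LinearMap.ext fun w => congrArg (fun l => l ![w])
        (map_add (η.curryLeft u).curryLeft v v')
      map_smul' := fun c v => LinearMap.ext fun w => congrArg (fun l => l ![w])
        (map_smul (η.curryLeft u).curryLeft c v) }
  map_add' u u' := LinearMap.ext fun v => LinearMap.ext fun w => congrArg (fun l => l ![v, w])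
    (map_add η.curryLeft u u')
  map_smul' c u := LinearMap.ext fun v => LinearMap.ext fun w => congrArg (fun l => l ![v, w])
    (map_smul η.curryLeft c u)

theorem trilin_swap (η : V [⋀^Fin 3]→L[ℝ] ℝ) (u v w : V) :
    trilin η u v w = -trilin η v u w := by
  have h : η (![v, u, w] ∘ Equiv.swap 0 1) = -η ![v, u, w] :=
    η.toAlternatingMap.map_swap ![v, u, w] (by decide)
  have h1 : ![v, u, w] ∘ Equiv.swap 0 1 = ![u, v, w] := by ext i; fin_cases i <;> rfl
  rwa [h1] at h

theorem trilin_swap' (η : V [⋀^Fin 3]→L[ℝ] ℝ) (u v w : V) :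
    trilin η u v w = -trilin η u w v := by
  have h : η (![u, w, v] ∘ Equiv.swap 1 2) = -η ![u, w, v] :=
    η.toAlternatingMap.map_swap ![u, w, v] (by decide)
  have h1 : ![u, w, v] ∘ Equiv.swap 1 2 = ![u, v, w] := by ext i; fin_cases i <;> rfl
  rwa [h1] at h

theorem trilin_cyc (η : V [⋀^Fin 3]→L[ℝ] ℝ) (u v w : V) :
    trilin η u v w = trilin η v w u := by
  rw [trilin_swap, trilin_swap', neg_neg]

/-- The first jet at a point of an integrable Hermitian structure: the metric `g` with derivative
`g'` and the complex structure `I` with derivative `I'`. The last field is the vanishing of the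
Nijenhuis tensor. -/
structure HermitianJet (g : V →L[ℝ] V →L[ℝ] ℝ) (g' : V →L[ℝ] V →L[ℝ] V →L[ℝ] ℝ)
    (I : V →L[ℝ] V) (I' : V →L[ℝ] V →L[ℝ] V) : Prop where
  symm : ∀ v w, g v w = g w v
  symm' : ∀ u v w, g' u v w = g' u w v
  sq : ∀ v, I (I v) = -v
  skew : ∀ v w, g (I v) w = -g v (I w)
  sq' : ∀ u v, I' u (I v) = -I (I' u v)
  skew' : ∀ u v w, g' u (I v) w + g (I' u v) w = -g' u v (I w) - g v (I' u w)
  nijenhuis : ∀ v w, -I (I' w v) + I (I' v w) - I' (I v) w + I' (I w) v = 0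

/-- The Christoffel symbols of the first kind: `g (∇_u v, w)` for constant fields `v`, `w`. -/
def christoffel (g' : V →L[ℝ] V →L[ℝ] V →L[ℝ] ℝ) (u v w : V) : ℝ :=
  1 / 2 * (g' u v w + g' v u w - g' w u v)

/-- `g ((∇_u A) v, w)` for the Levi-Civita connection `∇` and a skew endomorphism field with
first jet `(A, A')`. -/
def covDeriv (g : V →L[ℝ] V →L[ℝ] ℝ) (g' : V →L[ℝ] V →L[ℝ] V →L[ℝ] ℝ)
    (A : V →L[ℝ] V) (A' : V →L[ℝ] V →L[ℝ] V) (u v w : V) : ℝ :=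
  g (A' u v) w + christoffel g' u (A v) w + christoffel g' u v (A w)

section Neg

variable (g : V →L[ℝ] V →L[ℝ] ℝ) (g' : V →L[ℝ] V →L[ℝ] V →L[ℝ] ℝ) (A : V →L[ℝ] V)
  (A' : V →L[ℝ] V →L[ℝ] V) (u v w : V)

theorem covDeriv_neg_right : covDeriv g g' A A' u v (-w) = -covDeriv g g' A A' u v w := by
  simp only [covDeriv, christoffel, map_neg, neg_apply]
  ring

theorem covDeriv_neg_middle : covDeriv g g' A A' u (-v) w = -covDeriv g g' A A' u v w := by
  simp only [covDeriv, christoffel, map_neg, neg_apply]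
  ring

theorem covDeriv_neg_left : covDeriv g g' A A' (-u) v w = -covDeriv g g' A A' u v w := by
  simp only [covDeriv, christoffel, map_neg, neg_apply]
  ring

end Neg

namespace HermitianJet

variable {g : V →L[ℝ] V →L[ℝ] ℝ} {g' : V →L[ℝ] V →L[ℝ] V →L[ℝ] ℝ}
  {I J : V →L[ℝ] V} {I' J' : V →L[ℝ] V →L[ℝ] V}

/-- `∇_u I` is skew with respect to `g`. -/
theorem covDeriv_skew (h : HermitianJet g g' I I') (u v w : V) :
    covDeriv g g' I I' u v w = -covDeriv g g' I I' u w v := by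
  have h1 := h.skew' u v w
  have h2 := h.symm v (I' u w)
  have h3 := h.symm' u (I v) w
  have h4 := h.symm' u (I w) v
  have h5 := h.symm' v u (I w)
  have h6 := h.symm' w u (I v)
  have h7 := h.symm' (I v) u w
  have h8 := h.symm' (I w) u v
  simp only [covDeriv, christoffel]
  linarith

/-- `∇_u I` anticommutes with `I`. -/
theorem covDeriv_apply_left (h : HermitianJet g g' I I') (u v w : V) :
    covDeriv g g' I I' u (I v) w = covDeriv g g' I I' u v (I w) := by
  have h1 := h.skew (I' u v) w
  simp only [covDeriv, christoffel, h.sq, h.sq', map_neg, neg_apply]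
  linarith

/-- Integrability of `I` in terms of `∇`: `∇_{I u} I = I ∇_u I`. -/
theorem covDeriv_apply_dir (h : HermitianJet g g' I I') (u v w : V) :
    covDeriv g g' I I' (I u) v w = -covDeriv g g' I I' u v (I w) := by
  -- `b` is symmetric in its first two arguments and skew in its last two, hence zero.
  set b : V → V → V → ℝ := fun u v w =>
    covDeriv g g' I I' u v (I w) + covDeriv g g' I I' (I u) v w with hb
  have hskew : ∀ u v w, b u v w = -b u w v := by
    intro u v w
    simp only [hb]
    rw [← h.covDeriv_apply_left u v w, h.covDeriv_skew u (I v), h.covDeriv_skew (I u) v w]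
    ring
  have hsymm : ∀ u v w, b u v w = b v u w := by
    intro u v w
    have hN := congrArg (fun x => g x w) (h.nijenhuis u v)
    simp only [map_add, map_sub, map_neg, map_zero, add_apply, sub_apply, neg_apply,
      zero_apply, h.skew] at hN
    have h1 := h.symm' u v (I w)
    have h2 := h.symm' (I w) u v
    have h3 := h.symm' w (I u) v
    have h4 := h.symm' w u (I v)
    simp only [hb, covDeriv, christoffel, h.sq, map_neg, neg_apply]
    have h5 := h.symm' w u v
    linarith [h.symm' (I w) u (I v), h.symm' (I w) (I u) v, h.symm' w (I u) (I v)]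
  have h0 : b u v w = 0 := by
    have e1 := hskew u v w
    have e2 := hsymm u w v
    have e3 := hskew w u v
    have e4 := hsymm w v u
    have e5 := hskew v w u
    have e6 := hsymm v u w
    linarith
  simp only [hb] at h0
  linarith

/-- The exterior derivative of `g (I ·, ·)` is the cyclic sum of `g ((∇ I) ·, ·)`. -/
theorem sum_fderiv_fundamental (h : HermitianJet g g' I I') (u v w : V) :
    (g' u (I v) w + g (I' u v) w) - (g' v (I u) w + g (I' v u) w) +
      (g' w (I u) v + g (I' w u) v) =
    covDeriv g g' I I' u v w + covDeriv g g' I I' v w u + covDeriv g g' I I' w u v := by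
  have h1 := h.skew' v u w
  have h2 := h.symm u (I' v w)
  simp only [covDeriv, christoffel]
  linarith [h.symm' u (I v) w, h.symm' v (I w) u, h.symm' w (I u) v,
    h.symm' u v (I w), h.symm' v w (I u), h.symm' w u (I v), h.symm' (I u) v w,
    h.symm' (I v) u w, h.symm' (I w) u v]

/-- If `H = -dω (I ·, I ·, I ·)`, then `2 g ((∇_u I) v, w) = H (u, I v, w) + H (u, v, I w)`. -/
theorem two_mul_covDeriv (h : HermitianJet g g' I I') {H : V → V → V → ℝ}
    (hH : ∀ u v w, H u v w = -(covDeriv g g' I I' (I u) (I v) (I w) +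
      covDeriv g g' I I' (I v) (I w) (I u) + covDeriv g g' I I' (I w) (I u) (I v))) (u v w : V) :
    2 * covDeriv g g' I I' u v w = H u (I v) w + H u v (I w) := by
  rw [hH, hH]
  simp only [h.sq, covDeriv_neg_right, covDeriv_neg_middle, covDeriv_neg_left,
    h.covDeriv_apply_left, h.covDeriv_apply_dir]
  linarith [h.covDeriv_skew u v w]

/-- `H = -dω (I ·, I ·, I ·)` has type `(2,1) + (1,2)`. -/
theorem type_identity (h : HermitianJet g g' I I') {H : V → V → V → ℝ}
    (hH : ∀ u v w, H u v w = -(covDeriv g g' I I' (I u) (I v) (I w) +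
      covDeriv g g' I I' (I v) (I w) (I u) + covDeriv g g' I I' (I w) (I u) (I v))) (u v w : V) :
    H (I u) (I v) w + H (I u) v (I w) + H u (I v) (I w) = H u v w := by
  have hred : ∀ u v w, covDeriv g g' I I' (I u) (I v) (I w) = covDeriv g g' I I' u v (I w) := by
    intro u v w
    rw [h.covDeriv_apply_dir, h.sq, covDeriv_neg_right, h.covDeriv_apply_left]
    ring
  simp only [hH, hred, h.sq, covDeriv_neg_middle, covDeriv_neg_left,
    h.covDeriv_apply_left, h.covDeriv_apply_dir]
  ring

end HermitianJet

/-- The exterior derivative of `g (A⁻¹ ·, ·)` is the cyclic sum of `g ((∇_{A ·} A) ·, ·)`. -/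
theorem sum_fderiv_inverse_form {g : V →L[ℝ] V →L[ℝ] ℝ} {g' : V →L[ℝ] V →L[ℝ] V →L[ℝ] ℝ}
    {A K : V →L[ℝ] V} {A' K' : V →L[ℝ] V →L[ℝ] V} (symm' : ∀ u v w, g' u v w = g' u w v)
    (hAK : ∀ v, A (K v) = v) (hKA : ∀ v, K (A v) = v)
    (hKA' : ∀ u v, K' u (A v) = -K (A' u v))
    (skew : ∀ v w, g (A v) w = -g v (A w)) (e a c : V)
    (hskew' : ∀ u v w, g' u (K v) w + g (K' u v) w = -(g' u (K w) v + g (K' u w) v)) :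
    (g' (A e) (K (A a)) (A c) + g (K' (A e) (A a)) (A c)) -
      (g' (A a) (K (A e)) (A c) + g (K' (A a) (A e)) (A c)) +
      (g' (A c) (K (A e)) (A a) + g (K' (A c) (A e)) (A a)) =
    covDeriv g g' A A' (A e) a c + covDeriv g g' A A' (A a) c e + covDeriv g g' A A' (A c) e a := by
  rw [hskew' (A a) (A e)]
  have h1 : ∀ X c, g (K X) (A c) = -g X c := by
    intro X c
    have := skew (K X) c
    rw [hAK] at this
    linarith
  simp only [hKA, hKA', map_neg, neg_apply, h1, covDeriv, christoffel]
  linarith [symm' (A e) a (A c), symm' (A a) c (A e), symm' (A c) e (A a),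
    symm' e (A a) (A c), symm' a (A e) (A c), symm' c (A e) (A a),
    symm' (A e) (A a) c, symm' (A a) (A c) e, symm' (A c) (A e) a]

section Pair

variable {g : V →L[ℝ] V →L[ℝ] ℝ} {g' : V →L[ℝ] V →L[ℝ] V →L[ℝ] ℝ}
  {I J : V →L[ℝ] V} {I' J' : V →L[ℝ] V →L[ℝ] V} {H : V →ₗ[ℝ] V →ₗ[ℝ] V →ₗ[ℝ] ℝ}

theorem sum_cyc_pairs (hcyc : ∀ u v w, H u v w = H v w u) (e a c a₁ c₁ e₂ a₂ c₂ : V) :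
    H a₁ c₂ e + H a₁ c e₂ + H c₁ e₂ a + H c₁ e a₂ =
      H e a₁ c₂ + H e₂ a₁ c + H e₂ a c₁ + H e a₂ c₁ := by
  linarith [hcyc e a₁ c₂, hcyc e₂ a₁ c, hcyc c₁ e₂ a, hcyc c₁ e a₂]

/-- The cyclic sum for `A = I + δ J` vanishes, since `A ⊗ B + B ⊗ A = 2 (I ⊗ I - δ² J ⊗ J)` for
`B = I - δ J` and `H` has type `(2,1) + (1,2)` for both `I` and `J`. -/
theorem cyclic_covDeriv_add_smul (hcyc : ∀ u v w, H u v w = H v w u)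
    (hI : ∀ u v w, 2 * covDeriv g g' I I' u v w = H u (I v) w + H u v (I w))
    (hJ : ∀ u v w, 2 * covDeriv g g' J J' u v w = -(H u (J v) w + H u v (J w)))
    (tI : ∀ u v w, H (I u) (I v) w + H (I u) v (I w) + H u (I v) (I w) = H u v w)
    (tJ : ∀ u v w, H (J u) (J v) w + H (J u) v (J w) + H u (J v) (J w) = H u v w)
    {δ : ℝ} (hδ : δ ^ 2 = 1) (e a c : V) :
    covDeriv g g' (I + δ • J) (I' + δ • J') ((I + δ • J) e) a c +
      covDeriv g g' (I + δ • J) (I' + δ • J') ((I + δ • J) a) c e +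
      covDeriv g g' (I + δ • J) (I' + δ • J') ((I + δ • J) c) e a = 0 := by
  have hadd : ∀ u v w, covDeriv g g' (I + δ • J) (I' + δ • J') u v w =
      covDeriv g g' I I' u v w + δ * covDeriv g g' J J' u v w := by
    intro u v w
    simp only [covDeriv, christoffel, add_apply, smul_apply, map_add, map_smul, smul_eq_mul]
    ring
  have key : ∀ u v w, 2 * covDeriv g g' (I + δ • J) (I' + δ • J') u v w =
      H u (I v) w + H u v (I w) - δ * (H u (J v) w + H u v (J w)) := by
    intro u v w
    rw [hadd]
    linear_combination hI u v w + δ * hJ u v w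
  have k1 := key ((I + δ • J) e) a c
  have k2 := key ((I + δ • J) a) c e
  have k3 := key ((I + δ • J) c) e a
  simp only [add_apply, smul_apply, map_add, map_smul, smul_eq_mul,
    LinearMap.add_apply, LinearMap.smul_apply] at k1 k2 k3 ⊢
  have hs := fun A B : V →L[ℝ] V => sum_cyc_pairs hcyc e a c (A a) (A c) (B e) (B a) (B c)
  linear_combination (1 / 2) * (k1 + k2 + k3) +
    (1 / 2) * (hs I I + δ * hs J I - δ * hs I J - δ ^ 2 * hs J J) +
    tI e a c - δ ^ 2 * tJ e a c - H e a c * hδ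

set_option maxHeartbeats 2000000 in
/-- The cyclic sum for `C = [I, J]` vanishes: it is the difference of the type identity of `I`
with two arguments in the image of `J` and of the same identity with `I` and `J` exchanged. -/
theorem cyclic_covDeriv_commutator (hcyc : ∀ u v w, H u v w = H v w u)
    (skewI : ∀ v w, g (I v) w = -g v (I w)) (skewJ : ∀ v w, g (J v) w = -g v (J w))
    (hI : ∀ u v w, 2 * covDeriv g g' I I' u v w = H u (I v) w + H u v (I w))
    (hJ : ∀ u v w, 2 * covDeriv g g' J J' u v w = -(H u (J v) w + H u v (J w)))
    (tI : ∀ u v w, H (I u) (I v) w + H (I u) v (I w) + H u (I v) (I w) = H u v w)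
    (tJ : ∀ u v w, H (J u) (J v) w + H (J u) v (J w) + H u (J v) (J w) = H u v w)
    {C : V →L[ℝ] V} {C' : V →L[ℝ] V →L[ℝ] V} (hC : ∀ v, C v = I (J v) - J (I v))
    (hC' : ∀ u v, C' u v = I' u (J v) + I (J' u v) - J' u (I v) - J (I' u v)) (e a c : V) :
    covDeriv g g' C C' (C e) a c + covDeriv g g' C C' (C a) c e +
      covDeriv g g' C C' (C c) e a = 0 := by
  have key : ∀ u v w, 2 * covDeriv g g' C C' u v w =
      H u (I (J v) + J (I v)) w + H u v (I (J w) + J (I w)) +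
        2 * (H u (J v) (I w) + H u (I v) (J w)) := by
    intro u v w
    have h1 : covDeriv g g' C C' u v w = covDeriv g g' I I' u (J v) w +
        covDeriv g g' I I' u v (J w) - covDeriv g g' J J' u v (I w) -
        covDeriv g g' J J' u (I v) w := by
      simp only [covDeriv, christoffel, hC, hC', map_add, map_sub, add_apply, sub_apply,
        skewI _ w, skewJ _ w]
      ring
    simp only [map_add, LinearMap.add_apply]
    rw [h1]
    linear_combination hI u (J v) w + hI u v (J w) - hJ u v (I w) - hJ u (I v) w
  have k1 := key (C e) a c
  have k2 := key (C a) c e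
  have k3 := key (C c) e a
  simp only [hC, map_add, map_sub, LinearMap.add_apply, LinearMap.sub_apply] at k1 k2 k3 ⊢
  have hs := sum_cyc_pairs hcyc e a c
  have ht : ∀ x y z, H y z x = H x y z := fun x y z => (hcyc x y z).symm
  linear_combination (1 / 2) * (k1 + k2 + k3) +
    (1 / 2) * (hs (I (J a)) (I (J c)) (I (J e)) (I (J a)) (I (J c)) +
      hs (I (J a)) (I (J c)) (J (I e)) (J (I a)) (J (I c)) -
      hs (J (I a)) (J (I c)) (I (J e)) (I (J a)) (I (J c)) -
      hs (J (I a)) (J (I c)) (J (I e)) (J (I a)) (J (I c))) +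
    (ht (I e) (I (J a)) (J c) - ht (I e) (J (I a)) (J c) + ht (J e) (I (J a)) (I c) -
      ht (J e) (J (I a)) (I c)) +
    (hcyc (I (J c)) (J e) (I a) - hcyc (J (I c)) (J e) (I a) + hcyc (I (J c)) (I e) (J a) -
      hcyc (J (I c)) (I e) (J a)) +
    (tI (J e) (J a) c + tI (J e) a (J c) + tI e (J a) (J c)) -
    (tJ (I e) (I a) c + tJ (I e) a (I c) + tJ e (I a) (I c)) + tJ e a c - tI e a c

end Pair

end Jets

/-! ### Tensors in charts -/

section Charts

variable {d : ℕ} {M : Type*} [TopologicalSpace M] [ChartedSpace (EuclideanSpace ℝ (Fin d)) M]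

/-- The derivative of the chart centred at `x₀`. -/
def chartD (x₀ z : M) : TangentSpace (𝓡 d) z →L[ℝ] EuclideanSpace ℝ (Fin d) :=
  mfderiv (𝓡 d) 𝓘(ℝ, EuclideanSpace ℝ (Fin d)) (extChartAt (𝓡 d) x₀) z

/-- The derivative of the inverse of the chart centred at `x₀`. -/
def chartDsymm (x₀ : M) (y : EuclideanSpace ℝ (Fin d)) :
    EuclideanSpace ℝ (Fin d) →L[ℝ] TangentSpace (𝓡 d) ((extChartAt (𝓡 d) x₀).symm y) :=
  mfderiv 𝓘(ℝ, EuclideanSpace ℝ (Fin d)) (𝓡 d) (extChartAt (𝓡 d) x₀).symm y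

theorem inChart_apply {k : ℕ} (α : DForm d M k) (x₀ : M) (y : EuclideanSpace ℝ (Fin d))
    (v : Fin k → EuclideanSpace ℝ (Fin d)) :
    inChart α x₀ y v = α ((extChartAt (𝓡 d) x₀).symm y) (fun i => chartDsymm x₀ y (v i)) := rfl

theorem inChart_apply_two (α : DForm d M 2) (x₀ : M) (y v w : EuclideanSpace ℝ (Fin d)) :
    inChart α x₀ y ![v, w] =
      α ((extChartAt (𝓡 d) x₀).symm y) ![chartDsymm x₀ y v, chartDsymm x₀ y w] := by
  rw [inChart_apply]
  congr 1
  ext i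
  fin_cases i <;> rfl

/-- The chart expression of a field of endomorphisms. -/
def endInChart (A : EndField d M) (x₀ : M) (y : EuclideanSpace ℝ (Fin d)) :
    EuclideanSpace ℝ (Fin d) →L[ℝ] EuclideanSpace ℝ (Fin d) :=
  chartD x₀ ((extChartAt (𝓡 d) x₀).symm y) ∘L A ((extChartAt (𝓡 d) x₀).symm y) ∘L
    chartDsymm x₀ y

variable [IsManifold (𝓡 d) ∞ M]

/-- The chart expression of a Riemannian metric. -/
def metricInChart (g : SmoothMetric d M) (x₀ : M) (y : EuclideanSpace ℝ (Fin d)) :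
    EuclideanSpace ℝ (Fin d) →L[ℝ] EuclideanSpace ℝ (Fin d) →L[ℝ] ℝ :=
  let G : EuclideanSpace ℝ (Fin d) →L[ℝ] EuclideanSpace ℝ (Fin d) →L[ℝ] ℝ :=
    g.inner ((extChartAt (𝓡 d) x₀).symm y)
  let D : EuclideanSpace ℝ (Fin d) →L[ℝ] EuclideanSpace ℝ (Fin d) := chartDsymm x₀ y
  G.bilinearComp D D

theorem metricInChart_apply (g : SmoothMetric d M) (x₀ : M) (y v w : EuclideanSpace ℝ (Fin d)) :
    metricInChart g x₀ y v w =
      g.inner ((extChartAt (𝓡 d) x₀).symm y) (chartDsymm x₀ y v) (chartDsymm x₀ y w) := rfl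

omit [IsManifold (𝓡 d) ∞ M] in
theorem target_mem_nhds {x₀ : M} {y : EuclideanSpace ℝ (Fin d)}
    (hy : y ∈ (extChartAt (𝓡 d) x₀).target) : (extChartAt (𝓡 d) x₀).target ∈ 𝓝 y :=
  (isOpen_extChartAt_target x₀).mem_nhds hy

instance isManifold_one : IsManifold (𝓡 d) 1 M := IsManifold.of_le (n := ∞) (by simp)

omit [IsManifold (𝓡 d) ∞ M] in
theorem chartDsymm_eq_mfderivWithin (x₀ : M) (y : EuclideanSpace ℝ (Fin d)) :
    chartDsymm x₀ y = mfderivWithin 𝓘(ℝ, EuclideanSpace ℝ (Fin d)) (𝓡 d)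
      (extChartAt (𝓡 d) x₀).symm (Set.range (𝓡 d)) y := by
  rw [chartDsymm, modelWithCornersSelf_coe, Set.range_id, mfderivWithin_univ]

theorem chartD_chartDsymm {x₀ : M} {y : EuclideanSpace ℝ (Fin d)}
    (hy : y ∈ (extChartAt (𝓡 d) x₀).target) (v : EuclideanSpace ℝ (Fin d)) :
    chartD x₀ ((extChartAt (𝓡 d) x₀).symm y) (chartDsymm x₀ y v) = v := by
  rw [chartDsymm_eq_mfderivWithin]
  have h := mfderiv_extChartAt_comp_mfderivWithin_extChartAt_symm (I := 𝓡 d) hy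
  exact congrArg (fun l : EuclideanSpace ℝ (Fin d) →L[ℝ] EuclideanSpace ℝ (Fin d) => l v) h

theorem chartDsymm_chartD {x₀ : M} {y : EuclideanSpace ℝ (Fin d)}
    (hy : y ∈ (extChartAt (𝓡 d) x₀).target)
    (v : TangentSpace (𝓡 d) ((extChartAt (𝓡 d) x₀).symm y)) :
    chartDsymm x₀ y (chartD x₀ ((extChartAt (𝓡 d) x₀).symm y) v) = v := by
  rw [chartDsymm_eq_mfderivWithin]
  have h := mfderivWithin_extChartAt_symm_comp_mfderiv_extChartAt (I := 𝓡 d) hy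
  exact congrArg (fun l : TangentSpace (𝓡 d) ((extChartAt (𝓡 d) x₀).symm y) →L[ℝ]
    TangentSpace (𝓡 d) ((extChartAt (𝓡 d) x₀).symm y) => l v) h

theorem contMDiffAt_symm {x₀ : M} {y : EuclideanSpace ℝ (Fin d)}
    (hy : y ∈ (extChartAt (𝓡 d) x₀).target) :
    ContMDiffAt 𝓘(ℝ, EuclideanSpace ℝ (Fin d)) (𝓡 d) ∞ (extChartAt (𝓡 d) x₀).symm y :=
  (contMDiffOn_extChartAt_symm x₀).contMDiffAt (target_mem_nhds hy)

/-- The coordinate vector fields of a chart are smooth. -/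
theorem contMDiffOn_chartDsymm (x₀ : M) (v : EuclideanSpace ℝ (Fin d)) :
    ContMDiffOn 𝓘(ℝ, EuclideanSpace ℝ (Fin d)) ((𝓡 d).prod 𝓘(ℝ, EuclideanSpace ℝ (Fin d))) ∞
      (fun y => (Bundle.TotalSpace.mk ((extChartAt (𝓡 d) x₀).symm y) (chartDsymm x₀ y v) :
        TangentBundle (𝓡 d) M)) (extChartAt (𝓡 d) x₀).target := by
  set e := trivializationAt (EuclideanSpace ℝ (Fin d)) (TangentSpace (𝓡 d) : M → Type _) x₀
  have h1 : ContMDiffOn 𝓘(ℝ, EuclideanSpace ℝ (Fin d))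
      ((𝓡 d).prod 𝓘(ℝ, EuclideanSpace ℝ (Fin d))) ∞
      (fun y => ((extChartAt (𝓡 d) x₀).symm y, v)) (extChartAt (𝓡 d) x₀).target :=
    (contMDiffOn_extChartAt_symm x₀).prodMk contMDiffOn_const
  have hbase : ∀ y ∈ (extChartAt (𝓡 d) x₀).target,
      (extChartAt (𝓡 d) x₀).symm y ∈ (chartAt (EuclideanSpace ℝ (Fin d)) x₀).source := by
    intro y hy
    rw [← extChartAt_source (𝓡 d)]
    exact (extChartAt (𝓡 d) x₀).map_target hy
  have h2 := (e.contMDiffOn_symm (IB := 𝓡 d) (n := ∞)).comp h1 (fun y hy => by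
    rw [Set.mem_preimage, e.mem_target]
    exact hbase y hy)
  refine h2.congr fun y hy => ?_
  simp only [Function.comp_apply]
  have hb : (extChartAt (𝓡 d) x₀).symm y ∈ e.baseSet := hbase y hy
  rw [← e.mk_symm hb]
  congr 1
  have h3 := TangentBundle.symmL_trivializationAt (I := 𝓡 d) (hbase y hy)
  rw [(extChartAt (𝓡 d) x₀).right_inv hy] at h3
  rw [chartDsymm_eq_mfderivWithin, ← h3]
  exact e.symmL_apply hb v

/-- The chart expression of a smooth metric is smooth. -/
theorem contDiffOn_metricInChart (g : SmoothMetric d M) (x₀ : M) :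
    ContDiffOn ℝ ∞ (metricInChart g x₀) (extChartAt (𝓡 d) x₀).target := by
  rw [contDiffOn_clm_apply]
  intro v
  rw [contDiffOn_clm_apply]
  intro w
  rw [← contMDiffOn_iff_contDiffOn]
  have hg : ContMDiffOn 𝓘(ℝ, EuclideanSpace ℝ (Fin d)) ((𝓡 d).prod
      𝓘(ℝ, EuclideanSpace ℝ (Fin d) →L[ℝ] EuclideanSpace ℝ (Fin d) →L[ℝ] ℝ)) ∞
      (fun y => Bundle.TotalSpace.mk' (EuclideanSpace ℝ (Fin d) →L[ℝ] EuclideanSpace ℝ (Fin d) →L[ℝ] ℝ)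
        (E := fun x : M => TangentSpace (𝓡 d) x →L[ℝ] TangentSpace (𝓡 d) x →L[ℝ]
          Bundle.Trivial M ℝ x)
        ((extChartAt (𝓡 d) x₀).symm y) (g.inner ((extChartAt (𝓡 d) x₀).symm y)))
      (extChartAt (𝓡 d) x₀).target :=
    g.contMDiff.comp_contMDiffOn (contMDiffOn_extChartAt_symm x₀)
  have h : ContMDiffOn 𝓘(ℝ, EuclideanSpace ℝ (Fin d)) ((𝓡 d).prod 𝓘(ℝ, ℝ)) ∞
      (fun y => Bundle.TotalSpace.mk' ℝ (E := Bundle.Trivial M ℝ) ((extChartAt (𝓡 d) x₀).symm y)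
        (g.inner ((extChartAt (𝓡 d) x₀).symm y) (chartDsymm x₀ y v) (chartDsymm x₀ y w)))
      (extChartAt (𝓡 d) x₀).target := by
    apply ContMDiffOn.clm_bundle_apply₂ (F₁ := EuclideanSpace ℝ (Fin d))
      (F₂ := EuclideanSpace ℝ (Fin d))
    · exact hg
    · exact contMDiffOn_chartDsymm x₀ v
    · exact contMDiffOn_chartDsymm x₀ w
  intro y hy
  have h2 := h y hy
  rw [Bundle.contMDiffWithinAt_totalSpace] at h2
  exact h2.2

/-- The chart expression of a smooth field of endomorphisms is smooth. -/
theorem contDiffOn_endInChart {A : EndField d M}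
    (hA : ContMDiff (𝓡 d)
      ((𝓡 d).prod 𝓘(ℝ, EuclideanSpace ℝ (Fin d) →L[ℝ] EuclideanSpace ℝ (Fin d))) ∞
      (fun x => Bundle.TotalSpace.mk'
        (EuclideanSpace ℝ (Fin d) →L[ℝ] EuclideanSpace ℝ (Fin d))
        (E := fun x : M => TangentSpace (𝓡 d) x →L[ℝ] TangentSpace (𝓡 d) x) x (A x))) (x₀ : M) :
    ContDiffOn ℝ ∞ (endInChart A x₀) (extChartAt (𝓡 d) x₀).target := by
  rw [contDiffOn_clm_apply]
  intro v
  rw [← contMDiffOn_iff_contDiffOn]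
  set e := trivializationAt (EuclideanSpace ℝ (Fin d)) (TangentSpace (𝓡 d) : M → Type _) x₀
  have hbase : ∀ y ∈ (extChartAt (𝓡 d) x₀).target,
      (extChartAt (𝓡 d) x₀).symm y ∈ (chartAt (EuclideanSpace ℝ (Fin d)) x₀).source := by
    intro y hy
    rw [← extChartAt_source (𝓡 d)]
    exact (extChartAt (𝓡 d) x₀).map_target hy
  have hA' : ContMDiffOn 𝓘(ℝ, EuclideanSpace ℝ (Fin d)) ((𝓡 d).prod
      𝓘(ℝ, EuclideanSpace ℝ (Fin d) →L[ℝ] EuclideanSpace ℝ (Fin d))) ∞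
      (fun y => Bundle.TotalSpace.mk' (EuclideanSpace ℝ (Fin d) →L[ℝ] EuclideanSpace ℝ (Fin d))
        (E := fun x : M => TangentSpace (𝓡 d) x →L[ℝ] TangentSpace (𝓡 d) x)
        ((extChartAt (𝓡 d) x₀).symm y) (A ((extChartAt (𝓡 d) x₀).symm y)))
      (extChartAt (𝓡 d) x₀).target :=
    hA.comp_contMDiffOn (contMDiffOn_extChartAt_symm x₀)
  have h := ContMDiffOn.clm_bundle_apply hA' (contMDiffOn_chartDsymm x₀ v)
  rw [e.contMDiffOn_iff (fun y hy => by
    rw [e.mem_source]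
    exact hbase y hy)] at h
  refine h.2.congr fun y hy => ?_
  have h3 := TangentBundle.continuousLinearMapAt_trivializationAt (I := 𝓡 d) (hbase y hy)
  have hb : (extChartAt (𝓡 d) x₀).symm y ∈ e.baseSet := hbase y hy
  simp only [endInChart, ContinuousLinearMap.comp_apply]
  rw [chartD, ← h3, Bundle.Trivialization.continuousLinearMapAt_apply,
    e.coe_linearMapAt_of_mem hb]

end Charts

/-! ### Closedness of the three symplectic forms -/

section ChartFields

variable {V : Type*} [NormedAddCommGroup V] [NormedSpace ℝ V]

set_option synthInstance.maxHeartbeats 200000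

theorem fderiv_bilin_field {γ : V → V →L[ℝ] V →L[ℝ] ℝ} {a b : V → V} {y : V}
    (hγ : DifferentiableAt ℝ γ y) (ha : DifferentiableAt ℝ a y) (hb : DifferentiableAt ℝ b y)
    (u : V) :
    fderiv ℝ (fun z => γ z (a z) (b z)) y u =
      fderiv ℝ γ y u (a y) (b y) + γ y (fderiv ℝ a y u) (b y) + γ y (a y) (fderiv ℝ b y u) := by
  have h := ((hγ.hasFDerivAt.clm_apply ha.hasFDerivAt).clm_apply hb.hasFDerivAt).fderiv
  rw [h]
  simp
  ring

theorem fderiv_end_field {A : V → V →L[ℝ] V} {a : V → V} {y : V}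
    (hA : DifferentiableAt ℝ A y) (ha : DifferentiableAt ℝ a y) (u : V) :
    fderiv ℝ (fun z => A z (a z)) y u = fderiv ℝ A y u (a y) + A y (fderiv ℝ a y u) := by
  rw [(hA.hasFDerivAt.clm_apply ha.hasFDerivAt).fderiv]
  simp [add_comm]

theorem fderiv_metric_symm {γ : V → V →L[ℝ] V →L[ℝ] ℝ} {y : V} (hγ : DifferentiableAt ℝ γ y)
    (symm : ∀ᶠ z in 𝓝 y, ∀ v w, γ z v w = γ z w v) (u v w : V) :
    fderiv ℝ γ y u v w = fderiv ℝ γ y u w v := by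
  have h : (fun z => γ z v w) =ᶠ[𝓝 y] fun z => γ z w v := symm.mono fun z hz => hz v w
  have h1 := congrArg (fun l : V →L[ℝ] ℝ => l u) h.fderiv_eq
  have e := fun v w => fderiv_bilin_field hγ (differentiableAt_const (c := v))
    (differentiableAt_const (c := w)) u
  simp only [e] at h1
  simpa using h1

/-- A Hermitian structure with vanishing Nijenhuis tensor defines a jet at each point. -/
theorem hermitianJet_of_fields {γ : V → V →L[ℝ] V →L[ℝ] ℝ} {A : V → V →L[ℝ] V} {y : V}
    (hγ : DifferentiableAt ℝ γ y) (hA : DifferentiableAt ℝ A y)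
    (symm : ∀ᶠ z in 𝓝 y, ∀ v w, γ z v w = γ z w v)
    (sq : ∀ᶠ z in 𝓝 y, ∀ v, A z (A z v) = -v)
    (skew : ∀ᶠ z in 𝓝 y, ∀ v w, γ z (A z v) w = -γ z v (A z w))
    (nij : ∀ v w, -A y (fderiv ℝ A y w v) + A y (fderiv ℝ A y v w) - fderiv ℝ A y (A y v) w +
      fderiv ℝ A y (A y w) v = 0) :
    HermitianJet (γ y) (fderiv ℝ γ y) (A y) (fderiv ℝ A y) where
  symm := symm.self_of_nhds
  symm' := fderiv_metric_symm hγ symm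
  sq := sq.self_of_nhds
  skew := skew.self_of_nhds
  sq' u v := by
    have h : (fun z => A z (A z v)) =ᶠ[𝓝 y] fun _ => -v := sq.mono fun z hz => hz v
    have h1 := congrArg (fun l : V →L[ℝ] V => l u) h.fderiv_eq
    have hAv : DifferentiableAt ℝ (fun z => A z v) y := hA.clm_apply (differentiableAt_const v)
    simp only [fderiv_end_field hA hAv, fderiv_end_field hA (differentiableAt_const v)] at h1
    simp only [fderiv_fun_const, Pi.zero_apply, zero_apply, map_zero, add_zero] at h1
    exact eq_neg_of_add_eq_zero_left h1
  skew' u v w := by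
    have h : (fun z => γ z (A z v) w) =ᶠ[𝓝 y] fun z => -γ z v (A z w) :=
      skew.mono fun z hz => hz v w
    have h1 := congrArg (fun l : V →L[ℝ] ℝ => l u) h.fderiv_eq
    have hAv : ∀ v, DifferentiableAt ℝ (fun z => A z v) y := fun v =>
      hA.clm_apply (differentiableAt_const v)
    have hn : fderiv ℝ (fun z => -γ z v (A z w)) y u = -fderiv ℝ (fun z => γ z v (A z w)) y u := by
      rw [fderiv_fun_neg]
      rfl
    simp only [hn, fderiv_bilin_field hγ (hAv v) (differentiableAt_const w),
      fderiv_bilin_field hγ (differentiableAt_const v) (hAv w),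
      fderiv_end_field hA (differentiableAt_const _)] at h1
    simp only [fderiv_fun_const, Pi.zero_apply, zero_apply, map_zero, add_zero] at h1
    linarith
  nijenhuis := nij

/-- The derivative of the 2-form `γ (K ·, ·)` by the product rule. -/
theorem fderiv_form_of_bilin {γ : V → V →L[ℝ] V →L[ℝ] ℝ} {K : V → V →L[ℝ] V}
    {κ : V → V [⋀^Fin 2]→L[ℝ] ℝ} {y : V} (hγ : DifferentiableAt ℝ γ y)
    (hK : DifferentiableAt ℝ K y) (hκ : DifferentiableAt ℝ κ y)
    (h : ∀ᶠ z in 𝓝 y, ∀ v w, κ z ![v, w] = γ z (K z v) w) (u v w : V) :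
    fderiv ℝ κ y u ![v, w] = fderiv ℝ γ y u (K y v) w + γ y (fderiv ℝ K y u v) w := by
  have h0 : (fun z => κ z ![v, w]) =ᶠ[𝓝 y] fun z => γ z (K z v) w := h.mono fun z hz => hz v w
  have hKv : DifferentiableAt ℝ (fun z => K z v) y := hK.clm_apply (differentiableAt_const v)
  rw [← fderiv_alternating_apply hκ, h0.fderiv_eq,
    fderiv_bilin_field hγ hKv (differentiableAt_const w),
    fderiv_end_field hK (differentiableAt_const v)]
  simp

/-- The form `γ (A⁻¹ ·, ·)` is closed if the cyclic sums of `∇A` vanish. -/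
theorem extDeriv_eq_zero_of_inverse {γ : V → V →L[ℝ] V →L[ℝ] ℝ} {A K : V → V →L[ℝ] V}
    {κ : V → V [⋀^Fin 2]→L[ℝ] ℝ} {y : V} (hγ : DifferentiableAt ℝ γ y)
    (hA : DifferentiableAt ℝ A y) (hK : DifferentiableAt ℝ K y) (hκ : DifferentiableAt ℝ κ y)
    (symm : ∀ᶠ z in 𝓝 y, ∀ v w, γ z v w = γ z w v)
    (h : ∀ᶠ z in 𝓝 y, ∀ v w, κ z ![v, w] = γ z (K z v) w)
    (hAK : ∀ᶠ z in 𝓝 y, ∀ v, A z (K z v) = v) (hKA : ∀ᶠ z in 𝓝 y, ∀ v, K z (A z v) = v)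
    (skew : ∀ v w, γ y (A y v) w = -γ y v (A y w))
    (hcyc : ∀ e a c, covDeriv (γ y) (fderiv ℝ γ y) (A y) (fderiv ℝ A y) (A y e) a c +
      covDeriv (γ y) (fderiv ℝ γ y) (A y) (fderiv ℝ A y) (A y a) c e +
      covDeriv (γ y) (fderiv ℝ γ y) (A y) (fderiv ℝ A y) (A y c) e a = 0) :
    extDeriv κ y = 0 := by
  have hd := fderiv_form_of_bilin hγ hK hκ h
  have hAK0 := hAK.self_of_nhds
  have hKA' : ∀ u v, fderiv ℝ K y u (A y v) = -K y (fderiv ℝ A y u v) := by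
    intro u v
    have h0 : (fun z => K z (A z v)) =ᶠ[𝓝 y] fun _ => v := hKA.mono fun z hz => hz v
    have h1 := congrArg (fun l : V →L[ℝ] V => l u) h0.fderiv_eq
    have hAv : DifferentiableAt ℝ (fun z => A z v) y := hA.clm_apply (differentiableAt_const v)
    simp only [fderiv_end_field hK hAv, fderiv_end_field hA (differentiableAt_const v)] at h1
    simp only [fderiv_fun_const, Pi.zero_apply, zero_apply, map_zero, add_zero] at h1
    exact eq_neg_of_add_eq_zero_left h1
  ext v
  have hv : v = ![A y (K y (v 0)), A y (K y (v 1)), A y (K y (v 2))] := by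
    simp only [hAK0]
    ext i
    fin_cases i <;> rfl
  rw [hv, extDeriv_two_apply, hd, hd, hd]
  have h2 := sum_fderiv_inverse_form (fderiv_metric_symm hγ symm) hAK0 hKA.self_of_nhds hKA' skew
    (K y (v 0)) (K y (v 1)) (K y (v 2)) (fun u v w => by
      rw [← hd, ← hd, apply_swap])
  rw [h2]
  exact hcyc _ _ _

end ChartFields

section GKCharts

variable {d : ℕ} {M : Type*} [TopologicalSpace M] [ChartedSpace (EuclideanSpace ℝ (Fin d)) M]
  [IsManifold (𝓡 d) ∞ M]

theorem chartDsymm_endInChart (A : EndField d M) {x₀ : M} {y : EuclideanSpace ℝ (Fin d)}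
    (hy : y ∈ (extChartAt (𝓡 d) x₀).target) (v : EuclideanSpace ℝ (Fin d)) :
    chartDsymm x₀ y (endInChart A x₀ y v) =
      A ((extChartAt (𝓡 d) x₀).symm y) (chartDsymm x₀ y v) :=
  chartDsymm_chartD hy _

theorem chartDsymm_injective {x₀ : M} {y : EuclideanSpace ℝ (Fin d)}
    (hy : y ∈ (extChartAt (𝓡 d) x₀).target) : Function.Injective (chartDsymm x₀ y) :=
  Function.LeftInverse.injective (g := chartD x₀ ((extChartAt (𝓡 d) x₀).symm y))
    (chartD_chartDsymm hy)

theorem chartD_inverse {x₀ : M} {y : EuclideanSpace ℝ (Fin d)}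
    (hy : y ∈ (extChartAt (𝓡 d) x₀).target) :
    (chartD x₀ ((extChartAt (𝓡 d) x₀).symm y)).inverse = chartDsymm x₀ y := by
  refine ContinuousLinearMap.inverse_eq ?_ ?_
  · ext1 v; exact chartD_chartDsymm hy v
  · ext1 v; exact chartDsymm_chartD hy v

theorem chartDsymm_inverse {x₀ : M} {y : EuclideanSpace ℝ (Fin d)}
    (hy : y ∈ (extChartAt (𝓡 d) x₀).target) :
    (chartDsymm x₀ y).inverse = chartD x₀ ((extChartAt (𝓡 d) x₀).symm y) := by
  refine ContinuousLinearMap.inverse_eq ?_ ?_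
  · ext1 v; exact chartDsymm_chartD hy v
  · ext1 v; exact chartD_chartDsymm hy v

/-- The coordinate vector field with constant coefficient `v` in the chart centred at `x₀`. -/
def frame (x₀ : M) (v : EuclideanSpace ℝ (Fin d)) (z : M) : TangentSpace (𝓡 d) z :=
  (chartD x₀ z).inverse v

omit [IsManifold (𝓡 d) ∞ M] in
theorem exists_symm_eq {x₀ z : M} (hz : z ∈ (extChartAt (𝓡 d) x₀).source) :
    ∃ y ∈ (extChartAt (𝓡 d) x₀).target, (extChartAt (𝓡 d) x₀).symm y = z :=
  ⟨_, (extChartAt (𝓡 d) x₀).map_source hz, (extChartAt (𝓡 d) x₀).left_inv hz⟩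

theorem contMDiffOn_frame (x₀ : M) (v : EuclideanSpace ℝ (Fin d)) :
    ContMDiffOn (𝓡 d) ((𝓡 d).prod 𝓘(ℝ, EuclideanSpace ℝ (Fin d))) ∞
      (fun z => (Bundle.TotalSpace.mk z (frame x₀ v z) : TangentBundle (𝓡 d) M))
      (extChartAt (𝓡 d) x₀).source := by
  have h := (contMDiffOn_chartDsymm x₀ v).comp (contMDiffOn_extChartAt (I := 𝓡 d) (x := x₀) (n := ∞))
    (fun z hz => by
      have : z ∈ (extChartAt (𝓡 d) x₀).source := by rwa [extChartAt_source]
      exact (extChartAt (𝓡 d) x₀).map_source this)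
  rw [extChartAt_source]
  refine h.congr fun z hz => ?_
  obtain ⟨y, hy, rfl⟩ := exists_symm_eq (d := d) (x₀ := x₀) (z := z) (by rwa [extChartAt_source])
  rw [frame, chartD_inverse hy]
  exact (congrArg (fun y' => (Bundle.TotalSpace.mk ((extChartAt (𝓡 d) x₀).symm y')
    (chartDsymm x₀ y' v) : TangentBundle (𝓡 d) M)) ((extChartAt (𝓡 d) x₀).right_inv hy)).symm

/-- The chart expression of a vector field. -/
def vecInChart (X : ∀ z : M, TangentSpace (𝓡 d) z) (x₀ : M) (y : EuclideanSpace ℝ (Fin d)) :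
    EuclideanSpace ℝ (Fin d) :=
  chartD x₀ ((extChartAt (𝓡 d) x₀).symm y) (X ((extChartAt (𝓡 d) x₀).symm y))

theorem mlieBracket_eq_lieBracket (X Y : ∀ z : M, TangentSpace (𝓡 d) z) (x : M) :
    VectorField.mlieBracket (𝓡 d) X Y x = (chartD x x).inverse
      (VectorField.lieBracket ℝ (vecInChart X x) (vecInChart Y x) (extChartAt (𝓡 d) x x)) := by
  have hX : ∀ X : ∀ z : M, TangentSpace (𝓡 d) z,
      VectorField.mpullbackWithin 𝓘(ℝ, EuclideanSpace ℝ (Fin d)) (𝓡 d)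
        (extChartAt (𝓡 d) x).symm X (Set.range (𝓡 d)) =ᶠ[𝓝 (extChartAt (𝓡 d) x x)]
      vecInChart X x := by
    intro X
    filter_upwards [target_mem_nhds (mem_extChartAt_target (I := 𝓡 d) x)] with y hy
    rw [VectorField.mpullbackWithin_apply, ← chartDsymm_eq_mfderivWithin]
    exact congrArg (fun l : TangentSpace (𝓡 d) ((extChartAt (𝓡 d) x).symm y) →L[ℝ]
      EuclideanSpace ℝ (Fin d) => l (X ((extChartAt (𝓡 d) x).symm y))) (chartDsymm_inverse hy)
  rw [← VectorField.mlieBracketWithin_univ, VectorField.mlieBracketWithin_apply]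
  have hu : (extChartAt (𝓡 d) x).symm ⁻¹' Set.univ ∩ Set.range (𝓡 d) = Set.univ := by
    rw [Set.preimage_univ, Set.univ_inter, modelWithCornersSelf_coe, Set.range_id]
  have h := Filter.EventuallyEq.lieBracket_vectorField_eq (𝕜 := ℝ)
    (E := EuclideanSpace ℝ (Fin d)) (hX X) (hX Y)
  have key : ∀ s : Set (EuclideanSpace ℝ (Fin d)), s = Set.univ →
      ∀ V W : EuclideanSpace ℝ (Fin d) → EuclideanSpace ℝ (Fin d),
      VectorField.lieBracketWithin ℝ V W s (extChartAt (𝓡 d) x x) =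
        VectorField.lieBracket ℝ V W (extChartAt (𝓡 d) x x) := by
    rintro _ rfl V W
    rw [VectorField.lieBracketWithin_univ]
  exact congrArg (fun w => (chartD x x).inverse w) ((key _ hu _ _).trans h)

theorem vecInChart_frame {x₀ : M} {y : EuclideanSpace ℝ (Fin d)}
    (hy : y ∈ (extChartAt (𝓡 d) x₀).target) (v : EuclideanSpace ℝ (Fin d)) :
    vecInChart (frame x₀ v) x₀ y = v := by
  rw [vecInChart, frame, chartD_inverse hy, chartD_chartDsymm hy]

theorem vecInChart_end_frame (A : EndField d M) {x₀ : M} {y : EuclideanSpace ℝ (Fin d)}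
    (hy : y ∈ (extChartAt (𝓡 d) x₀).target) (v : EuclideanSpace ℝ (Fin d)) :
    vecInChart (fun z => A z (frame x₀ v z)) x₀ y = endInChart A x₀ y v := by
  rw [vecInChart, frame, chartD_inverse hy]
  rfl

theorem end_chartD_inverse (A : EndField d M) {x₀ z : M} {y : EuclideanSpace ℝ (Fin d)}
    (hy : y ∈ (extChartAt (𝓡 d) x₀).target) (hz : (extChartAt (𝓡 d) x₀).symm y = z)
    (v : EuclideanSpace ℝ (Fin d)) :
    A z ((chartD x₀ z).inverse v) = (chartD x₀ z).inverse (endInChart A x₀ y v) := by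
  subst hz
  rw [chartD_inverse hy, chartDsymm_endInChart A hy]

/-- The Nijenhuis condition in the chart centred at `x`, at the point `x`. -/
theorem IsComplexStructure.nijenhuis_inChart {A : EndField d M} (hA : IsComplexStructure A) (x : M)
    (v w : EuclideanSpace ℝ (Fin d)) :
    -endInChart A x (extChartAt (𝓡 d) x x)
        (fderiv ℝ (endInChart A x) (extChartAt (𝓡 d) x x) w v) +
      endInChart A x (extChartAt (𝓡 d) x x)
        (fderiv ℝ (endInChart A x) (extChartAt (𝓡 d) x x) v w) -
      fderiv ℝ (endInChart A x) (extChartAt (𝓡 d) x x)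
        (endInChart A x (extChartAt (𝓡 d) x x) v) w +
      fderiv ℝ (endInChart A x) (extChartAt (𝓡 d) x x)
        (endInChart A x (extChartAt (𝓡 d) x x) w) v = 0 := by
  set y := extChartAt (𝓡 d) x x with hy_def
  have hy : y ∈ (extChartAt (𝓡 d) x).target := mem_extChartAt_target (I := 𝓡 d) x
  have hz : (extChartAt (𝓡 d) x).symm y = x := extChartAt_to_inv (I := 𝓡 d) x
  have hAd : DifferentiableAt ℝ (endInChart A x) y :=
    ((contDiffOn_endInChart hA.smooth x).differentiableOn (by simp)).differentiableAt
      (target_mem_nhds hy)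
  have h := hA.nijenhuis _ (isOpen_extChartAt_source (I := 𝓡 d) (x := x)) (frame x v) (frame x w)
    (contMDiffOn_frame x v) (contMDiffOn_frame x w) x (mem_extChartAt_source (I := 𝓡 d) (x := x))
  have ev : ∀ v, vecInChart (frame x v) x =ᶠ[𝓝 y] fun _ => v := fun v => by
    filter_upwards [target_mem_nhds hy] with z hz using vecInChart_frame hz v
  have eA : ∀ v, vecInChart (fun z => A z (frame x v z)) x =ᶠ[𝓝 y]
      fun z => endInChart A x z v := fun v => by
    filter_upwards [target_mem_nhds hy] with z hz using vecInChart_end_frame A hz v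
  have dA : ∀ u v, fderiv ℝ (fun z => endInChart A x z v) y u =
      fderiv ℝ (endInChart A x) y u v := by
    intro u v
    rw [fderiv_end_field hAd (differentiableAt_const v)]
    simp
  simp only [mlieBracket_eq_lieBracket] at h
  rw [← hy_def, (ev v).lieBracket_vectorField_eq (ev w),
    (eA v).lieBracket_vectorField_eq (ev w), (ev v).lieBracket_vectorField_eq (eA w),
    (eA v).lieBracket_vectorField_eq (eA w)] at h
  simp only [VectorField.lieBracket_eq, dA, fderiv_fun_const, Pi.zero_apply, zero_apply,
    sub_zero, zero_sub, map_zero, zero_add, end_chartD_inverse A hy hz, ← map_add, ← map_sub] at h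
  have hinj : Function.Injective (chartD (d := d) x x).inverse := by
    have : ∀ z, (extChartAt (𝓡 d) x).symm y = z → Function.Injective (chartD (d := d) x z).inverse := by
      rintro z rfl
      rw [chartD_inverse hy]
      exact chartDsymm_injective hy
    exact this x hz
  have h0 := hinj (h.trans (map_zero _).symm)
  rw [map_add, map_neg] at h0
  rw [← h0]
  abel

end GKCharts

section Algebra

variable {V : Type*} [AddCommGroup V] [Module ℝ V] [TopologicalSpace V] {I J K : V →L[ℝ] V} {δ : ℝ}

/-- For `K = [I, J]⁻¹` and `δ = ±1`, the endomorphism `K (δ I - J)` is the inverse of `I + δ J`. -/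
theorem add_smul_inverse_right (sqI : ∀ v, I (I v) = -v) (sqJ : ∀ v, J (J v) = -v)
    (hI : ∀ v, K (I v) = -I (K v)) (hJ : ∀ v, K (J v) = -J (K v))
    (hs : ∀ v, K (I (J v)) - K (J (I v)) = v) (hδ : δ * δ = 1) (v : V) :
    I (K (δ • I v - J v)) + δ • J (K (δ • I v - J v)) = v := by
  have h1 : ∀ u, I (K u) = -K (I u) := fun u => by rw [hI, neg_neg]
  have h2 : ∀ u, J (K u) = -K (J u) := fun u => by rw [hJ, neg_neg]
  have h := hs v
  rw [h1, h2]
  simp only [map_sub, map_smul, sqI, sqJ, map_neg, smul_sub, smul_neg, smul_smul, hδ, one_smul]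
  refine Eq.trans ?_ h
  abel

theorem add_smul_inverse_left (sqI : ∀ v, I (I v) = -v) (sqJ : ∀ v, J (J v) = -v)
    (hs : ∀ v, K (I (J v)) - K (J (I v)) = v) (hδ : δ * δ = 1) (v : V) :
    K (δ • I (I v + δ • J v) - J (I v + δ • J v)) = v := by
  have h := hs v
  simp only [map_sub, map_smul, map_add, sqI, sqJ, map_neg, smul_add, smul_neg, smul_smul, hδ,
    one_smul]
  refine Eq.trans ?_ h
  abel

end Algebra

section GKClosed

variable {d : ℕ} {M : Type*} [TopologicalSpace M] [ChartedSpace (EuclideanSpace ℝ (Fin d)) M]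
  [IsManifold (𝓡 d) ∞ M]

theorem chartD_end (A : EndField d M) (x : M) (v : TangentSpace (𝓡 d) x) :
    chartD x x (A x v) = endInChart A x (extChartAt (𝓡 d) x x) (chartD x x v) := by
  have h : ∀ (y : EuclideanSpace ℝ (Fin d)) (z : M), y ∈ (extChartAt (𝓡 d) x).target →
      (extChartAt (𝓡 d) x).symm y = z → ∀ v : TangentSpace (𝓡 d) z,
      chartD x z (A z v) = endInChart A x y (chartD x z v) := by
    rintro y z hy rfl v
    exact congrArg (fun w => chartD x _ (A _ w)) (chartDsymm_chartD hy v).symm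
  exact h _ _ (mem_extChartAt_target (I := 𝓡 d) x) (extChartAt_to_inv (I := 𝓡 d) x) v

theorem chartD_surjective (x : M) :
    Function.Surjective (chartD x x : TangentSpace (𝓡 d) x → EuclideanSpace ℝ (Fin d)) := by
  have h : ∀ (y : EuclideanSpace ℝ (Fin d)) (z : M), y ∈ (extChartAt (𝓡 d) x).target →
      (extChartAt (𝓡 d) x).symm y = z → Function.Surjective
        (chartD x z : TangentSpace (𝓡 d) z → EuclideanSpace ℝ (Fin d)) := by
    rintro y z hy rfl v
    exact ⟨_, chartD_chartDsymm hy v⟩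
  exact h _ _ (mem_extChartAt_target (I := 𝓡 d) x) (extChartAt_to_inv (I := 𝓡 d) x)

/-- The 2-form `α` is `g (B ·, ·)`. -/
def Represents (g : SmoothMetric d M) (B : EndField d M) (α : DForm d M 2) : Prop :=
  ∀ x v w, α x ![v, w] = g.inner x (B x v) w

variable {g : SmoothMetric d M} {B : EndField d M} {α : DForm d M 2}

theorem Represents.inChart (h : Represents g B α) {x₀ : M} {y : EuclideanSpace ℝ (Fin d)}
    (hy : y ∈ (extChartAt (𝓡 d) x₀).target) (v w : EuclideanSpace ℝ (Fin d)) :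
    inChart α x₀ y ![v, w] = metricInChart g x₀ y (endInChart B x₀ y v) w := by
  rw [inChart_apply_two, h, metricInChart_apply, chartDsymm_endInChart B hy]

theorem Represents.contDiffOn (h : Represents g B α) {x₀ : M}
    (hB : ContDiffOn ℝ ∞ (endInChart B x₀) (extChartAt (𝓡 d) x₀).target) :
    ContDiffOn ℝ ∞ (GenKahler.inChart α x₀) (extChartAt (𝓡 d) x₀).target := by
  intro y hy
  refine ContDiffAt.contDiffWithinAt (contDiffAt_alternating fun v => ?_)
  have hev : (fun z => GenKahler.inChart α x₀ z v) =ᶠ[𝓝 y]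
      fun z => metricInChart g x₀ z (endInChart B x₀ z (v 0)) (v 1) := by
    filter_upwards [target_mem_nhds hy] with z hz
    rw [← h.inChart hz]
    congr 1
    ext i
    fin_cases i <;> rfl
  refine ContDiffAt.congr_of_eventuallyEq ?_ hev
  have hg := (contDiffOn_metricInChart g x₀).contDiffAt (target_mem_nhds hy)
  have hB' := hB.contDiffAt (target_mem_nhds hy)
  exact (hg.clm_apply (hB'.clm_apply contDiffAt_const)).clm_apply contDiffAt_const

namespace GKStructure

variable (S : GKStructure d M)

theorem represents_I : Represents S.g S.I (fundamentalForm S.g S.I S.complexI.sq S.compatI) :=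
  fun _ _ _ => rfl

theorem represents_J : Represents S.g S.J (fundamentalForm S.g S.J S.complexJ.sq S.compatJ) :=
  fun _ _ _ => rfl

theorem represents_Omega : Represents S.g S.commInv S.Omega := fun _ _ _ => rfl

theorem represents_Psi1 : Represents S.g (fun x => -(S.commInv x ∘L S.I x)) S.Psi1 := by
  intro x v w
  change -(S.g.inner x (S.commInv x (S.I x v)) w) = S.g.inner x (-(S.commInv x (S.I x v))) w
  rw [map_neg]
  rfl

theorem represents_Psi2 : Represents S.g (fun x => -(S.commInv x ∘L S.J x)) S.Psi2 := by
  intro x v w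
  change -(S.g.inner x (S.commInv x (S.J x v)) w) = S.g.inner x (-(S.commInv x (S.J x v))) w
  rw [map_neg]
  rfl

theorem endInChart_comm {x₀ : M} {y : EuclideanSpace ℝ (Fin d)}
    (hy : y ∈ (extChartAt (𝓡 d) x₀).target) :
    endInChart S.comm x₀ y = endInChart S.I x₀ y ∘L endInChart S.J x₀ y -
      endInChart S.J x₀ y ∘L endInChart S.I x₀ y := by
  ext1 v
  apply chartDsymm_injective hy
  rw [chartDsymm_endInChart S.comm hy, comm_apply, sub_apply, map_sub,
    ContinuousLinearMap.comp_apply, ContinuousLinearMap.comp_apply, chartDsymm_endInChart _ hy,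
    chartDsymm_endInChart _ hy, chartDsymm_endInChart _ hy, chartDsymm_endInChart _ hy]

theorem endInChart_comm_commInv (hS : S.Nondegenerate) {x₀ : M} {y : EuclideanSpace ℝ (Fin d)}
    (hy : y ∈ (extChartAt (𝓡 d) x₀).target) (v : EuclideanSpace ℝ (Fin d)) :
    endInChart S.comm x₀ y (endInChart S.commInv x₀ y v) = v := by
  apply chartDsymm_injective hy
  rw [chartDsymm_endInChart S.comm hy, chartDsymm_endInChart _ hy, S.comm_commInv _ (hS _)]

theorem endInChart_commInv_comm (hS : S.Nondegenerate) {x₀ : M} {y : EuclideanSpace ℝ (Fin d)}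
    (hy : y ∈ (extChartAt (𝓡 d) x₀).target) (v : EuclideanSpace ℝ (Fin d)) :
    endInChart S.commInv x₀ y (endInChart S.comm x₀ y v) = v := by
  apply chartDsymm_injective hy
  rw [chartDsymm_endInChart _ hy, chartDsymm_endInChart _ hy, S.commInv_comm _ (hS _)]

theorem contDiffOn_comm (x₀ : M) :
    ContDiffOn ℝ ∞ (endInChart S.comm x₀) (extChartAt (𝓡 d) x₀).target := by
  have hI := contDiffOn_endInChart S.complexI.smooth x₀
  have hJ := contDiffOn_endInChart S.complexJ.smooth x₀
  exact ((hI.clm_comp hJ).sub (hJ.clm_comp hI)).congr fun y hy => S.endInChart_comm hy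

theorem contDiffOn_commInv (hS : S.Nondegenerate) (x₀ : M) :
    ContDiffOn ℝ ∞ (endInChart S.commInv x₀) (extChartAt (𝓡 d) x₀).target := by
  intro y hy
  have hinv : ∀ z ∈ (extChartAt (𝓡 d) x₀).target,
      (endInChart S.comm x₀ z).inverse = endInChart S.commInv x₀ z := fun z hz =>
    ContinuousLinearMap.inverse_eq (ContinuousLinearMap.ext (S.endInChart_comm_commInv hS hz))
      (ContinuousLinearMap.ext (S.endInChart_commInv_comm hS hz))
  have hi : (endInChart S.comm x₀ y).IsInvertible :=
    ContinuousLinearMap.IsInvertible.of_inverse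
      (ContinuousLinearMap.ext (S.endInChart_comm_commInv hS hy))
      (ContinuousLinearMap.ext (S.endInChart_commInv_comm hS hy))
  have h := (hi.contDiffAt_map_inverse (n := ∞)).comp y
    ((S.contDiffOn_comm x₀).contDiffAt (target_mem_nhds hy))
  refine (h.congr_of_eventuallyEq ?_).contDiffWithinAt
  filter_upwards [target_mem_nhds hy] with z hz
  exact (hinv z hz).symm

theorem endInChart_neg_commInv_comp (A : EndField d M) {x₀ : M} {y : EuclideanSpace ℝ (Fin d)}
    (hy : y ∈ (extChartAt (𝓡 d) x₀).target) :
    endInChart (fun x => -(S.commInv x ∘L A x)) x₀ y =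
      -(endInChart S.commInv x₀ y ∘L endInChart A x₀ y) := by
  ext1 v
  apply chartDsymm_injective hy
  rw [chartDsymm_endInChart _ hy]
  change -(S.commInv _ (A _ (chartDsymm x₀ y v))) =
    chartDsymm x₀ y (-(endInChart S.commInv x₀ y (endInChart A x₀ y v)))
  rw [map_neg, chartDsymm_endInChart _ hy, chartDsymm_endInChart _ hy]

theorem contDiffOn_Omega (hS : S.Nondegenerate) (x₀ : M) :
    ContDiffOn ℝ ∞ (inChart S.Omega x₀) (extChartAt (𝓡 d) x₀).target :=
  S.represents_Omega.contDiffOn (S.contDiffOn_commInv hS x₀)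

theorem contDiffOn_Psi1 (hS : S.Nondegenerate) (x₀ : M) :
    ContDiffOn ℝ ∞ (inChart S.Psi1 x₀) (extChartAt (𝓡 d) x₀).target :=
  S.represents_Psi1.contDiffOn <|
    ((S.contDiffOn_commInv hS x₀).clm_comp (contDiffOn_endInChart S.complexI.smooth x₀)).neg.congr
      fun _ hy => S.endInChart_neg_commInv_comp S.I hy

theorem contDiffOn_Psi2 (hS : S.Nondegenerate) (x₀ : M) :
    ContDiffOn ℝ ∞ (inChart S.Psi2 x₀) (extChartAt (𝓡 d) x₀).target :=
  S.represents_Psi2.contDiffOn <|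
    ((S.contDiffOn_commInv hS x₀).clm_comp (contDiffOn_endInChart S.complexJ.smooth x₀)).neg.congr
      fun _ hy => S.endInChart_neg_commInv_comp S.J hy

end GKStructure

set_option synthInstance.maxHeartbeats 200000 in
theorem hermitianJet_inChart (g : SmoothMetric d M) {A : EndField d M}
    (hA : IsComplexStructure A)
    (compat : ∀ (x : M) (v w : TangentSpace (𝓡 d) x), g.inner x (A x v) w = -g.inner x v (A x w))
    (x : M) :
    HermitianJet (metricInChart g x (extChartAt (𝓡 d) x x))
      (fderiv ℝ (metricInChart g x) (extChartAt (𝓡 d) x x))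
      (endInChart A x (extChartAt (𝓡 d) x x))
      (fderiv ℝ (endInChart A x) (extChartAt (𝓡 d) x x)) := by
  have hy := mem_extChartAt_target (I := 𝓡 d) x
  refine hermitianJet_of_fields
    (((contDiffOn_metricInChart g x).contDiffAt (target_mem_nhds hy)).differentiableAt (by simp))
    (((contDiffOn_endInChart hA.smooth x).contDiffAt (target_mem_nhds hy)).differentiableAt
      (by simp)) ?_ ?_ ?_ (hA.nijenhuis_inChart x)
  · exact Filter.Eventually.of_forall fun z v w => g.symm _ _ _
  · filter_upwards [target_mem_nhds hy] with z hz v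
    apply chartDsymm_injective hz
    rw [chartDsymm_endInChart _ hz, chartDsymm_endInChart _ hz, hA.sq, map_neg]
  · filter_upwards [target_mem_nhds hy] with z hz v w
    rw [metricInChart_apply, metricInChart_apply, chartDsymm_endInChart _ hz,
      chartDsymm_endInChart _ hz, compat]

set_option synthInstance.maxHeartbeats 200000 in
/-- The exterior derivative of a fundamental form in terms of `∇A`. -/
theorem extDeriv_fundamental (hα : Represents g B α) (hB : IsComplexStructure B)
    (compat : ∀ (x : M) (v w : TangentSpace (𝓡 d) x), g.inner x (B x v) w = -g.inner x v (B x w))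
    (x : M) (u v w : EuclideanSpace ℝ (Fin d)) :
    extDeriv (inChart α x) (extChartAt (𝓡 d) x x) ![u, v, w] =
      covDeriv (metricInChart g x (extChartAt (𝓡 d) x x))
        (fderiv ℝ (metricInChart g x) (extChartAt (𝓡 d) x x))
        (endInChart B x (extChartAt (𝓡 d) x x))
        (fderiv ℝ (endInChart B x) (extChartAt (𝓡 d) x x)) u v w +
      covDeriv (metricInChart g x (extChartAt (𝓡 d) x x))
        (fderiv ℝ (metricInChart g x) (extChartAt (𝓡 d) x x))
        (endInChart B x (extChartAt (𝓡 d) x x))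
        (fderiv ℝ (endInChart B x) (extChartAt (𝓡 d) x x)) v w u +
      covDeriv (metricInChart g x (extChartAt (𝓡 d) x x))
        (fderiv ℝ (metricInChart g x) (extChartAt (𝓡 d) x x))
        (endInChart B x (extChartAt (𝓡 d) x x))
        (fderiv ℝ (endInChart B x) (extChartAt (𝓡 d) x x)) w u v := by
  have hy := mem_extChartAt_target (I := 𝓡 d) x
  have hγ := ((contDiffOn_metricInChart g x).contDiffAt (target_mem_nhds hy)).differentiableAt
    (by simp)
  have hBs := contDiffOn_endInChart hB.smooth x
  have hd := fderiv_form_of_bilin hγ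
    ((hBs.contDiffAt (target_mem_nhds hy)).differentiableAt (by simp))
    (((hα.contDiffOn hBs).contDiffAt (target_mem_nhds hy)).differentiableAt (by simp))
    (by filter_upwards [target_mem_nhds hy] with z hz v w using hα.inChart hz v w)
  rw [extDeriv_two_apply, hd, hd, hd]
  exact (hermitianJet_inChart g hB compat x).sum_fderiv_fundamental u v w

namespace GKStructure

variable (S : GKStructure d M)

set_option synthInstance.maxHeartbeats 200000 in
/-- The chart expression at `x` of the torsion 3-form `d^c_I ω_I = -d^c_J ω_J`; it determines the
covariant derivatives of `I` and `J`. -/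
theorem exists_torsion (x : M) {y : EuclideanSpace ℝ (Fin d)} (hy : y = extChartAt (𝓡 d) x x) :
    ∃ H : EuclideanSpace ℝ (Fin d) →ₗ[ℝ] EuclideanSpace ℝ (Fin d) →ₗ[ℝ]
        EuclideanSpace ℝ (Fin d) →ₗ[ℝ] ℝ,
      (∀ u v w, H u v w = H v w u) ∧
      (∀ u v w, 2 * covDeriv (metricInChart S.g x y) (fderiv ℝ (metricInChart S.g x) y)
        (endInChart S.I x y) (fderiv ℝ (endInChart S.I x) y) u v w =
          H u (endInChart S.I x y v) w + H u v (endInChart S.I x y w)) ∧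
      (∀ u v w, 2 * covDeriv (metricInChart S.g x y) (fderiv ℝ (metricInChart S.g x) y)
        (endInChart S.J x y) (fderiv ℝ (endInChart S.J x) y) u v w =
          -(H u (endInChart S.J x y v) w + H u v (endInChart S.J x y w))) ∧
      (∀ u v w, H (endInChart S.I x y u) (endInChart S.I x y v) w +
        H (endInChart S.I x y u) v (endInChart S.I x y w) +
        H u (endInChart S.I x y v) (endInChart S.I x y w) = H u v w) ∧
      (∀ u v w, H (endInChart S.J x y u) (endInChart S.J x y v) w +
        H (endInChart S.J x y u) v (endInChart S.J x y w) +
        H u (endInChart S.J x y v) (endInChart S.J x y w) = H u v w) := by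
  subst hy
  set y := extChartAt (𝓡 d) x x
  set I' := endInChart S.I x y
  set J' := endInChart S.J x y
  set ωI := fundamentalForm S.g S.I S.complexI.sq S.compatI
  set ωJ := fundamentalForm S.g S.J S.complexJ.sq S.compatJ
  let H := trilin (-(extDeriv (inChart ωI x) y).compContinuousLinearMap I')
  have hHI : ∀ u v w, H u v w = -extDeriv (inChart ωI x) y ![I' u, I' v, I' w] := by
    intro u v w
    change -(extDeriv (inChart ωI x) y) _ = _
    congr 2
    ext i
    fin_cases i <;> rfl
  have hdc : ∀ (A : EndField d M) (α : DForm d M 2) (u v w : TangentSpace (𝓡 d) x),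
      dc A α x ![u, v, w] = -extDeriv (inChart α x) y ![endInChart A x y (chartD x x u),
        endInChart A x y (chartD x x v), endInChart A x y (chartD x x w)] := by
    intro A α u v w
    rw [← chartD_end, ← chartD_end, ← chartD_end]
    change -(extDeriv (inChart α x) y) _ = _
    congr 2
    ext i
    fin_cases i <;> rfl
  have hHJ : ∀ u v w, -H u v w = -extDeriv (inChart ωJ x) y ![J' u, J' v, J' w] := by
    intro u v w
    obtain ⟨u, rfl⟩ := chartD_surjective x u
    obtain ⟨v, rfl⟩ := chartD_surjective x v
    obtain ⟨w, rfl⟩ := chartD_surjective x w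
    have h := congrArg (fun η : DForm d M 3 => η x ![u, v, w]) S.dc_eq
    have h1 : dc S.I ωI x ![u, v, w] = -dc S.J ωJ x ![u, v, w] := h
    rw [hdc, hdc] at h1
    rw [hHI]
    linarith
  have jI := hermitianJet_inChart S.g S.complexI S.inner_I x
  have jJ := hermitianJet_inChart S.g S.complexJ S.inner_J x
  have eI : ∀ u v w, H u v w = -(_ + _ + _) := fun u v w => (hHI u v w).trans
    (congrArg Neg.neg (extDeriv_fundamental S.represents_I S.complexI S.inner_I x _ _ _))
  have eJ : ∀ u v w, -H u v w = -(_ + _ + _) := fun u v w => (hHJ u v w).trans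
    (congrArg Neg.neg (extDeriv_fundamental S.represents_J S.complexJ S.inner_J x _ _ _))
  refine ⟨H, trilin_cyc _, fun u v w => ?_, fun u v w => ?_, fun u v w => ?_, fun u v w => ?_⟩
  · exact jI.two_mul_covDeriv (H := fun u v w => H u v w) eI u v w
  · have h := jJ.two_mul_covDeriv (H := fun u v w => -H u v w) eJ u v w
    rw [neg_add]
    exact h
  · exact jI.type_identity (H := fun u v w => H u v w) eI u v w
  · have h := jJ.type_identity (H := fun u v w => -H u v w) eJ u v w
    have h' := congrArg Neg.neg h
    simp only [neg_add, neg_neg] at h'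
    exact h'

set_option synthInstance.maxHeartbeats 200000 in
theorem metricInChart_skew {A : EndField d M}
    (hA : ∀ (x : M) (v w : TangentSpace (𝓡 d) x), S.g.inner x (A x v) w = -S.g.inner x v (A x w))
    {x₀ : M} {y : EuclideanSpace ℝ (Fin d)} (hy : y ∈ (extChartAt (𝓡 d) x₀).target)
    (v w : EuclideanSpace ℝ (Fin d)) :
    metricInChart S.g x₀ y (endInChart A x₀ y v) w =
      -metricInChart S.g x₀ y v (endInChart A x₀ y w) := by
  rw [metricInChart_apply, metricInChart_apply, chartDsymm_endInChart _ hy,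
    chartDsymm_endInChart _ hy, hA]

set_option synthInstance.maxHeartbeats 200000 in
/-- `Ω` is closed. -/
theorem extDeriv_Omega (hS : S.Nondegenerate) (x : M) :
    extDeriv (inChart S.Omega x) (extChartAt (𝓡 d) x x) = 0 := by
  have hy := mem_extChartAt_target (I := 𝓡 d) x
  have hn := target_mem_nhds hy
  obtain ⟨H, hcyc, hI, hJ, tI, tJ⟩ := S.exists_torsion x rfl
  have dI : DifferentiableAt ℝ (endInChart S.I x) (extChartAt (𝓡 d) x x) :=
    ((contDiffOn_endInChart S.complexI.smooth x).contDiffAt hn).differentiableAt (by simp)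
  have dJ : DifferentiableAt ℝ (endInChart S.J x) (extChartAt (𝓡 d) x x) :=
    ((contDiffOn_endInChart S.complexJ.smooth x).contDiffAt hn).differentiableAt (by simp)
  have dC : DifferentiableAt ℝ (endInChart S.comm x) (extChartAt (𝓡 d) x x) :=
    ((S.contDiffOn_comm x).contDiffAt hn).differentiableAt (by simp)
  refine extDeriv_eq_zero_of_inverse
    (((contDiffOn_metricInChart S.g x).contDiffAt hn).differentiableAt (by simp)) dC
    (((S.contDiffOn_commInv hS x).contDiffAt hn).differentiableAt (by simp))
    (((S.contDiffOn_Omega hS x).contDiffAt hn).differentiableAt (by simp))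
    (Filter.Eventually.of_forall fun z v w => S.g.symm _ _ _)
    (by filter_upwards [hn] with z hz v w using S.represents_Omega.inChart hz v w)
    (by filter_upwards [hn] with z hz v using S.endInChart_comm_commInv hS hz v)
    (by filter_upwards [hn] with z hz v using S.endInChart_commInv_comm hS hz v)
    (S.metricInChart_skew S.inner_comm hy)
    (cyclic_covDeriv_commutator hcyc (S.metricInChart_skew S.inner_I hy)
      (S.metricInChart_skew S.inner_J hy) hI hJ tI tJ (fun v => ?_) (fun u v => ?_))
  · rw [S.endInChart_comm hy]
    rfl
  · have hev : (fun z => endInChart S.comm x z v) =ᶠ[𝓝 (extChartAt (𝓡 d) x x)]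
        (fun z => endInChart S.I x z (endInChart S.J x z v)) -
          fun z => endInChart S.J x z (endInChart S.I x z v) := by
      filter_upwards [hn] with z hz
      rw [S.endInChart_comm hz]
      rfl
    have c := differentiableAt_const (𝕜 := ℝ) (x := extChartAt (𝓡 d) x x) v
    have h1 := congrArg (fun l : EuclideanSpace ℝ (Fin d) →L[ℝ] EuclideanSpace ℝ (Fin d) => l u)
      hev.fderiv_eq
    rw [fderiv_sub (dI.clm_apply (dJ.clm_apply c)) (dJ.clm_apply (dI.clm_apply c))] at h1
    simp only [sub_apply, fderiv_end_field dC c, fderiv_end_field dI (dJ.clm_apply c),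
      fderiv_end_field dJ (dI.clm_apply c), fderiv_end_field dI c, fderiv_end_field dJ c,
      fderiv_fun_const, Pi.zero_apply, zero_apply, map_zero, add_zero] at h1
    rw [h1]
    abel

/-- `Ψ₂ - δ Ψ₁ = g ([I, J]⁻¹ (δ I - J) ·, ·)`; for `δ = ±1` this is `g ((I + δ J)⁻¹ ·, ·)`. -/
theorem represents_Psi2_sub (δ : ℝ) : Represents S.g
    (fun x => S.commInv x ∘L (δ • S.I x - S.J x)) (fun x => S.Psi2 x - δ • S.Psi1 x) := by
  intro x v w
  change -(S.g.inner x (S.commInv x (S.J x v)) w) - δ * -(S.g.inner x (S.commInv x (S.I x v)) w) =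
    S.g.inner x (S.commInv x (δ • S.I x v - S.J x v)) w
  rw [map_sub, map_smul, map_sub, map_smul, sub_apply, smul_apply, smul_eq_mul]
  ring

theorem endInChart_add_smul (δ : ℝ) {x : M} {z : EuclideanSpace ℝ (Fin d)}
    (hz : z ∈ (extChartAt (𝓡 d) x).target) :
    endInChart (fun x => S.I x + δ • S.J x) x z =
      endInChart S.I x z + δ • endInChart S.J x z := by
  ext1 v
  apply chartDsymm_injective hz
  rw [chartDsymm_endInChart _ hz]
  change S.I _ (chartDsymm x z v) + δ • S.J _ (chartDsymm x z v) =
    chartDsymm x z (endInChart S.I x z v + δ • endInChart S.J x z v)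
  rw [map_add, map_smul, chartDsymm_endInChart _ hz, chartDsymm_endInChart _ hz]

theorem contDiffOn_commInv_comp_sub (hS : S.Nondegenerate) (δ : ℝ) (x : M) :
    ContDiffOn ℝ ∞ (endInChart (fun x => S.commInv x ∘L (δ • S.I x - S.J x)) x)
      (extChartAt (𝓡 d) x).target := by
  have dI := contDiffOn_endInChart S.complexI.smooth x
  have dJ := contDiffOn_endInChart S.complexJ.smooth x
  refine ((S.contDiffOn_commInv hS x).clm_comp ((dI.const_smul δ).sub dJ)).congr fun z hz => ?_
  ext1 v
  apply chartDsymm_injective hz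
  rw [chartDsymm_endInChart _ hz]
  change S.commInv _ (δ • S.I _ (chartDsymm x z v) - S.J _ (chartDsymm x z v)) =
    chartDsymm x z (endInChart S.commInv x z
      (δ • endInChart S.I x z v - endInChart S.J x z v))
  rw [chartDsymm_endInChart _ hz, map_sub (chartDsymm x z), map_smul (chartDsymm x z),
    chartDsymm_endInChart _ hz, chartDsymm_endInChart _ hz]

set_option maxHeartbeats 1000000 in
set_option synthInstance.maxHeartbeats 200000 in
/-- `Ψ₂ - Ψ₁` and `Ψ₂ + Ψ₁` are closed. -/
theorem extDeriv_Psi2_sub (hS : S.Nondegenerate) {δ : ℝ} (hδ : δ ^ 2 = 1) (x : M) :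
    extDeriv (inChart (fun x => S.Psi2 x - δ • S.Psi1 x) x) (extChartAt (𝓡 d) x x) = 0 := by
  have hy := mem_extChartAt_target (I := 𝓡 d) x
  have hn := target_mem_nhds hy
  have hδ' : δ * δ = 1 := by rw [← sq, hδ]
  obtain ⟨H, hcyc, hI, hJ, tI, tJ⟩ := S.exists_torsion x rfl
  have dI := contDiffOn_endInChart S.complexI.smooth x
  have dJ := contDiffOn_endInChart S.complexJ.smooth x
  have hA := fun z (hz : z ∈ (extChartAt (𝓡 d) x).target) => S.endInChart_add_smul δ hz
  have dK := S.contDiffOn_commInv_comp_sub hS δ x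
  have dA : ContDiffOn ℝ ∞ (fun z => endInChart S.I x z + δ • endInChart S.J x z)
      (extChartAt (𝓡 d) x).target := dI.add (dJ.const_smul δ)
  have hs : ∀ (z : M) (v : TangentSpace (𝓡 d) z),
      S.commInv z (S.I z (S.J z v)) - S.commInv z (S.J z (S.I z v)) = v := by
    intro z v
    rw [← map_sub, ← comm_apply, S.commInv_comm z (hS z)]
  have dI' := ((dI.contDiffAt hn).differentiableAt (by simp))
  have dJ' := ((dJ.contDiffAt hn).differentiableAt (by simp))
  have hfd : fderiv ℝ (fun z => endInChart S.I x z + δ • endInChart S.J x z)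
      (extChartAt (𝓡 d) x x) = fderiv ℝ (endInChart S.I x) (extChartAt (𝓡 d) x x) +
        δ • fderiv ℝ (endInChart S.J x) (extChartAt (𝓡 d) x x) :=
    (dI'.hasFDerivAt.add (dJ'.hasFDerivAt.const_smul δ)).fderiv
  refine extDeriv_eq_zero_of_inverse
    (A := fun z => endInChart S.I x z + δ • endInChart S.J x z)
    (((contDiffOn_metricInChart S.g x).contDiffAt hn).differentiableAt (by simp))
    ((dA.contDiffAt hn).differentiableAt (by simp))
    ((dK.contDiffAt hn).differentiableAt (by simp))
    ((((S.represents_Psi2_sub δ).contDiffOn dK).contDiffAt hn).differentiableAt (by simp))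
    (Filter.Eventually.of_forall fun z v w => S.g.symm _ _ _)
    (by filter_upwards [hn] with z hz v w using (S.represents_Psi2_sub δ).inChart hz v w)
    ?_ ?_ ?_ ?_
  · filter_upwards [hn] with z hz v
    rw [← hA z hz]
    apply chartDsymm_injective hz
    rw [chartDsymm_endInChart _ hz, chartDsymm_endInChart _ hz]
    exact add_smul_inverse_right (S.complexI.sq _) (S.complexJ.sq _) (S.commInv_I _)
      (S.commInv_J _) (hs _) hδ' (chartDsymm x z v)
  · filter_upwards [hn] with z hz v
    rw [← hA z hz]
    apply chartDsymm_injective hz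
    rw [chartDsymm_endInChart _ hz, chartDsymm_endInChart _ hz]
    exact add_smul_inverse_left (S.complexI.sq _) (S.complexJ.sq _) (hs _) hδ' (chartDsymm x z v)
  · intro v w
    rw [← hA _ hy]
    refine S.metricInChart_skew (A := fun x => S.I x + δ • S.J x) (fun z v w => ?_) hy v w
    change S.g.inner z (S.I z v + δ • S.J z v) w = -S.g.inner z v (S.I z w + δ • S.J z w)
    rw [map_add, map_smul, map_add, map_smul, add_apply, smul_apply, S.inner_I, S.inner_J,
      smul_eq_mul, smul_eq_mul]
    ring
  · rw [hfd]
    exact cyclic_covDeriv_add_smul hcyc hI hJ tI tJ hδ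

set_option synthInstance.maxHeartbeats 200000 in
/-- `Ψ₁` and `Ψ₂` are closed. -/
theorem extDeriv_Psi (hS : S.Nondegenerate) (x : M) :
    extDeriv (inChart S.Psi1 x) (extChartAt (𝓡 d) x x) = 0 ∧
      extDeriv (inChart S.Psi2 x) (extChartAt (𝓡 d) x x) = 0 := by
  have hn := target_mem_nhds (mem_extChartAt_target (I := 𝓡 d) x)
  have d1 := ((S.contDiffOn_Psi1 hS x).contDiffAt hn).differentiableAt (by simp)
  have d2 := ((S.contDiffOn_Psi2 hS x).contDiffAt hn).differentiableAt (by simp)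
  have key : ∀ δ : ℝ, extDeriv (inChart (fun x => S.Psi2 x - δ • S.Psi1 x) x)
      (extChartAt (𝓡 d) x x) = extDeriv (inChart S.Psi2 x) (extChartAt (𝓡 d) x x) -
        δ • extDeriv (inChart S.Psi1 x) (extChartAt (𝓡 d) x x) := by
    intro δ
    have h : inChart (fun x => S.Psi2 x - δ • S.Psi1 x) x =
      fun y => inChart S.Psi2 x y - δ • inChart S.Psi1 x y := rfl
    rw [h]
    simp only [extDeriv]
    have hfd : fderiv ℝ (fun y => inChart S.Psi2 x y - δ • inChart S.Psi1 x y)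
        (extChartAt (𝓡 d) x x) = fderiv ℝ (inChart S.Psi2 x) (extChartAt (𝓡 d) x x) -
          δ • fderiv ℝ (inChart S.Psi1 x) (extChartAt (𝓡 d) x x) :=
      (d2.hasFDerivAt.sub (d1.hasFDerivAt.const_smul δ)).fderiv
    rw [hfd]
    simp only [← ContinuousAlternatingMap.alternatizeUncurryFinCLM_apply]
    rw [map_sub, map_smul]
  have k1 := (key 1).symm.trans (S.extDeriv_Psi2_sub hS (by norm_num) x)
  have k2 := (key (-1)).symm.trans (S.extDeriv_Psi2_sub hS (by norm_num) x)
  rw [one_smul, sub_eq_zero] at k1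
  rw [neg_smul, one_smul, sub_neg_eq_add, k1, ← two_smul ℝ, smul_eq_zero] at k2
  have h1 := k2.resolve_left two_ne_zero
  exact ⟨h1, k1.trans h1⟩

end GKStructure

end GKClosed

/-! ### Pull-backs of forms -/

section Along

variable {d : ℕ} {M : Type*} [TopologicalSpace M] [ChartedSpace (EuclideanSpace ℝ (Fin d)) M]

/-- The form `α` is smooth in every chart. -/
def SmoothForm {k : ℕ} (α : DForm d M k) : Prop :=
  ∀ x₀ : M, ContDiffOn ℝ ∞ (inChart α x₀) (extChartAt (𝓡 d) x₀).target

/-- The form `α` is closed. -/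
def ClosedForm {k : ℕ} (α : DForm d M k) : Prop :=
  ∀ x : M, extDeriv (inChart α x) (extChartAt (𝓡 d) x x) = 0

variable {D : Type*} [NormedAddCommGroup D] [NormedSpace ℝ D]

/-- The pull-back `f^* α` of a form under a map from a normed space. -/
def formAlong {k : ℕ} (f : D → M) (α : DForm d M k) (p : D) : D [⋀^Fin k]→L[ℝ] ℝ :=
  (α (f p)).compContinuousLinearMap (mfderiv 𝓘(ℝ, D) (𝓡 d) f p)

variable [IsManifold (𝓡 d) ∞ M] {k : ℕ} {α : DForm d M k} {f : D → M} {p : D}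

theorem inChart_chartD (α : DForm d M k) {x₁ z : M} (hz : z ∈ (extChartAt (𝓡 d) x₁).source)
    (u : Fin k → TangentSpace (𝓡 d) z) :
    inChart α x₁ (extChartAt (𝓡 d) x₁ z) (fun i => chartD x₁ z (u i)) = α z u := by
  have h : ∀ (y : EuclideanSpace ℝ (Fin d)) (z : M), y ∈ (extChartAt (𝓡 d) x₁).target →
      (extChartAt (𝓡 d) x₁).symm y = z → ∀ u : Fin k → TangentSpace (𝓡 d) z,
      inChart α x₁ y (fun i => chartD x₁ z (u i)) = α z u := by
    rintro y z hy rfl u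
    rw [inChart_apply]
    exact congrArg (α _) (funext fun i => chartDsymm_chartD hy (u i))
  exact h _ _ ((extChartAt (𝓡 d) x₁).map_source hz) ((extChartAt (𝓡 d) x₁).left_inv hz) u

theorem mdifferentiableAt_chart {x₁ z : M} (hz : z ∈ (extChartAt (𝓡 d) x₁).source) :
    MDifferentiableAt (𝓡 d) 𝓘(ℝ, EuclideanSpace ℝ (Fin d)) (extChartAt (𝓡 d) x₁) z :=
  mdifferentiableAt_extChartAt (by rwa [← extChartAt_source (𝓡 d)])

theorem fderiv_chart_comp (hf : MDifferentiableAt 𝓘(ℝ, D) (𝓡 d) f p) {x₁ : M}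
    (hx : f p ∈ (extChartAt (𝓡 d) x₁).source) (v : D) :
    fderiv ℝ (fun q => extChartAt (𝓡 d) x₁ (f q)) p v =
      chartD x₁ (f p) (mfderiv 𝓘(ℝ, D) (𝓡 d) f p v) := by
  have h := mfderiv_comp p (mdifferentiableAt_chart hx) hf
  have h2 := congrArg (fun l : D →L[ℝ] EuclideanSpace ℝ (Fin d) => l v)
    ((mfderiv_eq_fderiv (𝕜 := ℝ) (f := fun q => extChartAt (𝓡 d) x₁ (f q)) (x := p)).symm.trans h)
  exact h2

theorem formAlong_eq (α : DForm d M k) (hf : MDifferentiableAt 𝓘(ℝ, D) (𝓡 d) f p) {x₁ : M}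
    (hx : f p ∈ (extChartAt (𝓡 d) x₁).source) :
    formAlong f α p = (inChart α x₁ (extChartAt (𝓡 d) x₁ (f p))).compContinuousLinearMap
      (fderiv ℝ (fun q => extChartAt (𝓡 d) x₁ (f q)) p) := by
  ext v
  refine (inChart_chartD α hx _).symm.trans ?_
  refine congrArg (inChart α x₁ _) (funext fun i => ?_)
  exact (fderiv_chart_comp hf hx (v i)).symm

theorem contDiffAt_chart_comp (hf : ContMDiffAt 𝓘(ℝ, D) (𝓡 d) ∞ f p) {x₁ : M}
    (hx : f p ∈ (extChartAt (𝓡 d) x₁).source) :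
    ContDiffAt ℝ ∞ (fun q => extChartAt (𝓡 d) x₁ (f q)) p := by
  rw [← contMDiffAt_iff_contDiffAt]
  exact (contMDiffAt_extChartAt' (by rwa [← extChartAt_source (𝓡 d)])).comp p hf

theorem eventually_formAlong_eq (α : DForm d M k) (hf : ContMDiffAt 𝓘(ℝ, D) (𝓡 d) ∞ f p) {x₁ : M}
    (hx : f p ∈ (extChartAt (𝓡 d) x₁).source) :
    formAlong f α =ᶠ[𝓝 p] fun q => (inChart α x₁ (extChartAt (𝓡 d) x₁ (f q))).compContinuousLinearMap
      (fderiv ℝ (fun q => extChartAt (𝓡 d) x₁ (f q)) q) := by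
  have h1 : ContMDiffAt 𝓘(ℝ, D) (𝓡 d) 1 f p := hf.of_le (by simp)
  filter_upwards [(contMDiffAt_iff_contMDiffAt_nhds (by simp)).mp h1,
    hf.continuousAt.preimage_mem_nhds ((isOpen_extChartAt_source (I := 𝓡 d) x₁).mem_nhds hx)]
    with q hq1 hq2
  exact formAlong_eq α (hq1.mdifferentiableAt one_ne_zero) hq2

theorem contDiffAt_formAlong [FiniteDimensional ℝ D] (hα : SmoothForm α)
    (hf : ContMDiffAt 𝓘(ℝ, D) (𝓡 d) ∞ f p) : ContDiffAt ℝ ∞ (formAlong f α) p := by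
  have hx := mem_extChartAt_source (I := 𝓡 d) (f p)
  refine ContDiffAt.congr_of_eventuallyEq ?_ (eventually_formAlong_eq α hf hx)
  have h1 := contDiffAt_chart_comp hf hx
  refine contDiffAt_compContinuousLinearMap ?_ (h1.fderiv_right (m := ∞) (by simp))
  exact ((hα (f p)).contDiffAt
    (target_mem_nhds (mem_extChartAt_target (I := 𝓡 d) (f p)))).comp p h1

theorem extDeriv_formAlong (hα : SmoothForm α) (hc : ClosedForm α)
    (hf : ContMDiffAt 𝓘(ℝ, D) (𝓡 d) ∞ f p) : extDeriv (formAlong f α) p = 0 := by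
  have hx := mem_extChartAt_source (I := 𝓡 d) (f p)
  have h1 := contDiffAt_chart_comp hf hx
  have h2 := (((hα (f p)).contDiffAt
    (target_mem_nhds (mem_extChartAt_target (I := 𝓡 d) (f p))))).differentiableAt (by simp)
  have h3 := extDeriv_pullback (f := fun q => extChartAt (𝓡 d) (f p) (f q)) h2 h1
    (by simpa using WithTop.coe_le_coe.mpr (le_top : (2 : ℕ∞) ≤ ⊤))
  rw [(eventually_formAlong_eq α hf hx).extDeriv_eq, h3, hc]
  rfl

omit [IsManifold (𝓡 d) ∞ M] in
theorem inChart_eq_formAlong (α : DForm d M k) (x₀ : M) :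
    inChart α x₀ = formAlong (extChartAt (𝓡 d) x₀).symm α := rfl

theorem ClosedForm.extDeriv_inChart (hα : SmoothForm α) (hc : ClosedForm α) {x₀ : M}
    {y : EuclideanSpace ℝ (Fin d)} (hy : y ∈ (extChartAt (𝓡 d) x₀).target) :
    extDeriv (inChart α x₀) y = 0 :=
  extDeriv_formAlong hα hc (contMDiffAt_symm hy)

end Along

section Flow

variable {d : ℕ} {M : Type*} [TopologicalSpace M] [ChartedSpace (EuclideanSpace ℝ (Fin d)) M]
  [IsManifold (𝓡 d) ∞ M] {X : ∀ x : M, TangentSpace (𝓡 d) x} {φ : ℝ → M → M}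

/-- The flow in the chart centred at `x₀`, as a map on `ℝ × ℝ^d`. -/
def flowMap (φ : ℝ → M → M) (x₀ : M) (p : ℝ × EuclideanSpace ℝ (Fin d)) : M :=
  φ p.1 ((extChartAt (𝓡 d) x₀).symm p.2)

namespace IsFlow

omit [IsManifold (𝓡 d) ∞ M] in
theorem contMDiff (hφ : IsFlow X φ) (t : ℝ) : ContMDiff (𝓡 d) (𝓡 d) ∞ (φ t) :=
  hφ.smooth.comp (contMDiff_const.prodMk contMDiff_id)

theorem contMDiffAt_flowMap (hφ : IsFlow X φ) {x₀ : M} {t : ℝ} {y : EuclideanSpace ℝ (Fin d)}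
    (hy : y ∈ (extChartAt (𝓡 d) x₀).target) :
    ContMDiffAt 𝓘(ℝ, ℝ × EuclideanSpace ℝ (Fin d)) (𝓡 d) ∞ (flowMap φ x₀) (t, y) := by
  have h1 : ContMDiffAt 𝓘(ℝ, ℝ × EuclideanSpace ℝ (Fin d)) 𝓘(ℝ, ℝ) ∞
      (fun p : ℝ × EuclideanSpace ℝ (Fin d) => p.1) (t, y) := contDiff_fst.contMDiff.contMDiffAt
  have h2 : ContMDiffAt 𝓘(ℝ, ℝ × EuclideanSpace ℝ (Fin d)) 𝓘(ℝ, EuclideanSpace ℝ (Fin d)) ∞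
      (fun p : ℝ × EuclideanSpace ℝ (Fin d) => p.2) (t, y) := contDiff_snd.contMDiff.contMDiffAt
  have h3 := h1.prodMk (ContMDiffAt.comp (t, y) (contMDiffAt_symm hy) h2)
  exact (hφ.smooth.contMDiffAt).comp (t, y) h3

theorem mfderiv_flowMap_snd (hφ : IsFlow X φ) {x₀ : M} {t : ℝ} {y : EuclideanSpace ℝ (Fin d)}
    (hy : y ∈ (extChartAt (𝓡 d) x₀).target) (w : EuclideanSpace ℝ (Fin d)) :
    mfderiv 𝓘(ℝ, ℝ × EuclideanSpace ℝ (Fin d)) (𝓡 d) (flowMap φ x₀) (t, y) (0, w) =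
      mfderiv (𝓡 d) (𝓡 d) (φ t) ((extChartAt (𝓡 d) x₀).symm y) (chartDsymm x₀ y w) := by
  have h1 := ((hφ.contMDiffAt_flowMap (t := t) hy).mdifferentiableAt (by simp)).hasMFDerivAt
  have h2 : HasMFDerivAt 𝓘(ℝ, EuclideanSpace ℝ (Fin d)) 𝓘(ℝ, ℝ × EuclideanSpace ℝ (Fin d))
      (fun z => (t, z)) y _ :=
    ((hasFDerivAt_const t y).prodMk (hasFDerivAt_id y)).hasMFDerivAt
  have h3 := HasMFDerivAt.comp y h1 h2
  have h4 := HasMFDerivAt.comp y (((hφ.contMDiff t).contMDiffAt.mdifferentiableAt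
    (by simp)).hasMFDerivAt) ((contMDiffAt_symm hy).mdifferentiableAt (by simp)).hasMFDerivAt
  have h5 := hasMFDerivAt_unique h3 h4
  exact congrArg (fun l : EuclideanSpace ℝ (Fin d) →L[ℝ]
    TangentSpace (𝓡 d) (φ t ((extChartAt (𝓡 d) x₀).symm y)) => l w) h5

theorem mfderiv_flowMap_fst (hφ : IsFlow X φ) {x₀ : M} {t : ℝ} {y : EuclideanSpace ℝ (Fin d)}
    (hy : y ∈ (extChartAt (𝓡 d) x₀).target) :
    mfderiv 𝓘(ℝ, ℝ × EuclideanSpace ℝ (Fin d)) (𝓡 d) (flowMap φ x₀) (t, y)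
        ((1 : ℝ), (0 : EuclideanSpace ℝ (Fin d))) =
      X (φ t ((extChartAt (𝓡 d) x₀).symm y)) := by
  have h1 := ((hφ.contMDiffAt_flowMap (t := t) hy).mdifferentiableAt (by simp)).hasMFDerivAt
  have h2 : HasMFDerivAt 𝓘(ℝ, ℝ) 𝓘(ℝ, ℝ × EuclideanSpace ℝ (Fin d))
      (fun s => (s, y)) t _ :=
    ((hasFDerivAt_id t).prodMk (hasFDerivAt_const y t)).hasMFDerivAt
  have h3 := HasMFDerivAt.comp t h1 h2
  have h5 := hasMFDerivAt_unique h3 (hφ.integralCurve ((extChartAt (𝓡 d) x₀).symm y) t)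
  have h6 := congrArg (fun l : ℝ →L[ℝ]
    TangentSpace (𝓡 d) (φ t ((extChartAt (𝓡 d) x₀).symm y)) => l 1) h5
  refine h6.trans ?_
  exact one_smul ℝ (X (φ t ((extChartAt (𝓡 d) x₀).symm y)))

theorem inChart_pullback (hφ : IsFlow X φ) {k : ℕ} (α : DForm d M k) (t : ℝ) {x₀ : M}
    {y : EuclideanSpace ℝ (Fin d)} (hy : y ∈ (extChartAt (𝓡 d) x₀).target) :
    inChart (pullback (φ t) α) x₀ y = (formAlong (flowMap φ x₀) α (t, y)).compContinuousLinearMap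
      (ContinuousLinearMap.inr ℝ ℝ (EuclideanSpace ℝ (Fin d))) := by
  ext v
  refine congrArg (α (φ t ((extChartAt (𝓡 d) x₀).symm y))) (funext fun i => ?_)
  exact (hφ.mfderiv_flowMap_snd hy (v i)).symm

theorem inChart_pullback_eq_formAlong (hφ : IsFlow X φ) {k : ℕ} (α : DForm d M k) (t : ℝ) {x₀ : M}
    {y : EuclideanSpace ℝ (Fin d)} (hy : y ∈ (extChartAt (𝓡 d) x₀).target) :
    inChart (pullback (φ t) α) x₀ y =
      formAlong (fun z => φ t ((extChartAt (𝓡 d) x₀).symm z)) α y := by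
  ext v
  have h4 := HasMFDerivAt.comp y (((hφ.contMDiff t).contMDiffAt.mdifferentiableAt
    (by simp)).hasMFDerivAt) ((contMDiffAt_symm hy).mdifferentiableAt (by simp)).hasMFDerivAt
  refine congrArg (α (φ t ((extChartAt (𝓡 d) x₀).symm y))) (funext fun i => ?_)
  exact congrArg (fun l : EuclideanSpace ℝ (Fin d) →L[ℝ]
    TangentSpace (𝓡 d) (φ t ((extChartAt (𝓡 d) x₀).symm y)) => l (v i)) h4.mfderiv.symm

theorem contMDiffAt_comp_symm (hφ : IsFlow X φ) (t : ℝ) {x₀ : M}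
    {y : EuclideanSpace ℝ (Fin d)} (hy : y ∈ (extChartAt (𝓡 d) x₀).target) :
    ContMDiffAt 𝓘(ℝ, EuclideanSpace ℝ (Fin d)) (𝓡 d) ∞
      (fun z => φ t ((extChartAt (𝓡 d) x₀).symm z)) y :=
  ((hφ.contMDiff t).contMDiffAt).comp y (contMDiffAt_symm hy)

/-- The chart expression of `φ_t^* α` is smooth in `(t, y)`. -/
theorem contDiffOn_pullback (hφ : IsFlow X φ) {k : ℕ} {α : DForm d M k} (hα : SmoothForm α)
    (x₀ : M) :
    ContDiffOn ℝ ∞ (fun p : ℝ × EuclideanSpace ℝ (Fin d) => inChart (pullback (φ p.1) α) x₀ p.2)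
      (Set.univ ×ˢ (extChartAt (𝓡 d) x₀).target) := by
  rintro ⟨t, y⟩ ⟨-, hy⟩
  have h1 : ContDiffAt ℝ ∞ (fun p => (formAlong (flowMap φ x₀) α p).compContinuousLinearMap
      (ContinuousLinearMap.inr ℝ ℝ (EuclideanSpace ℝ (Fin d)))) (t, y) :=
    contDiffAt_compContinuousLinearMap (contDiffAt_formAlong hα (hφ.contMDiffAt_flowMap hy))
      contDiffAt_const
  refine h1.contDiffWithinAt.congr (fun p hp => hφ.inChart_pullback α p.1 hp.2)
    (hφ.inChart_pullback α t hy)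

theorem smoothForm_pullback (hφ : IsFlow X φ) {k : ℕ} {α : DForm d M k} (hα : SmoothForm α)
    (t : ℝ) : SmoothForm (pullback (φ t) α) := fun x₀ =>
  (hφ.contDiffOn_pullback hα x₀).comp (contDiff_prodMk_right t).contDiffOn
    fun _ hy => ⟨Set.mem_univ _, hy⟩

theorem extDeriv_pullback (hφ : IsFlow X φ) {k : ℕ} {α : DForm d M k} (hα : SmoothForm α)
    (hc : ClosedForm α) (t : ℝ) {x₀ : M}
    {y : EuclideanSpace ℝ (Fin d)} (hy : y ∈ (extChartAt (𝓡 d) x₀).target) :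
    extDeriv (inChart (pullback (φ t) α) x₀) y = 0 := by
  have hev : inChart (pullback (φ t) α) x₀ =ᶠ[𝓝 y]
      formAlong (fun z => φ t ((extChartAt (𝓡 d) x₀).symm z)) α := by
    filter_upwards [target_mem_nhds hy] with z hz using hφ.inChart_pullback_eq_formAlong α t hz
  rw [hev.extDeriv_eq]
  exact extDeriv_formAlong hα hc (hφ.contMDiffAt_comp_symm t hy)

/-- The homotopy formula `∂_t φ_t^* α = d (φ_t^* (ι_X α))` for a closed 2-form `α`. -/
theorem deriv_pullback (hφ : IsFlow X φ) {α : DForm d M 2} (hα : SmoothForm α)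
    (hc : ClosedForm α) (t : ℝ) {x₀ : M} {y : EuclideanSpace ℝ (Fin d)}
    (hy : y ∈ (extChartAt (𝓡 d) x₀).target)
    {β : EuclideanSpace ℝ (Fin d) → EuclideanSpace ℝ (Fin d) → ℝ}
    (hβ : ∀ z ∈ (extChartAt (𝓡 d) x₀).target, ∀ w, β z w =
      α (φ t ((extChartAt (𝓡 d) x₀).symm z)) ![X (φ t ((extChartAt (𝓡 d) x₀).symm z)),
        mfderiv (𝓡 d) (𝓡 d) (φ t) ((extChartAt (𝓡 d) x₀).symm z) (chartDsymm x₀ z w)])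
    (v w : EuclideanSpace ℝ (Fin d)) :
    deriv (fun s => inChart (pullback (φ s) α) x₀ y ![v, w]) t =
      fderiv ℝ (fun z => β z w) y v - fderiv ℝ (fun z => β z v) y w := by
  have hf := hφ.contMDiffAt_flowMap (t := t) hy
  have h := fderiv_time_of_closed ((contDiffAt_formAlong hα hf).differentiableAt (by simp))
    (extDeriv_formAlong hα hc hf) v w
  have e1 : (fun s => inChart (pullback (φ s) α) x₀ y ![v, w]) =
      fun s => formAlong (flowMap φ x₀) α (s, y) ![(0, v), (0, w)] := by
    ext s
    rw [hφ.inChart_pullback α s hy, ContinuousAlternatingMap.compContinuousLinearMap_apply]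
    congr 1
    exact funext fun i => by fin_cases i <;> rfl
  have e2 : ∀ w, (fun z => β z w) =ᶠ[𝓝 y]
      fun z => formAlong (flowMap φ x₀) α (t, z) ![(1, 0), (0, w)] := by
    intro w
    filter_upwards [target_mem_nhds hy] with z hz
    rw [hβ z hz]
    refine congrArg (α (φ t ((extChartAt (𝓡 d) x₀).symm z))) (funext fun i => ?_)
    fin_cases i
    · exact (hφ.mfderiv_flowMap_fst hz).symm
    · exact (hφ.mfderiv_flowMap_snd hz w).symm
  rw [e1, h, (e2 w).fderiv_eq, (e2 v).fderiv_eq]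

end IsFlow

end Flow

/-! ### The Hamiltonian flow -/

section HamiltonianFlow

variable {d : ℕ} {M : Type*} [TopologicalSpace M] [ChartedSpace (EuclideanSpace ℝ (Fin d)) M]

theorem fderiv_comp_eq_mvfderiv {D : Type*} [NormedAddCommGroup D] [NormedSpace ℝ D] {h : M → ℝ}
    {f : D → M} {p : D} (hh : MDifferentiableAt (𝓡 d) 𝓘(ℝ, ℝ) h (f p))
    (hf : MDifferentiableAt 𝓘(ℝ, D) (𝓡 d) f p) (v : D) :
    fderiv ℝ (fun q => h (f q)) p v = mvfderiv (𝓡 d) h (f p) (mfderiv 𝓘(ℝ, D) (𝓡 d) f p v) := by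
  have h1 := mvfderiv_comp p hh hf
  have h2 := congrArg (fun l : D →L[ℝ] ℝ => l v)
    ((mfderiv_eq_fderiv (𝕜 := ℝ) (f := fun q => h (f q)) (x := p)).symm.trans h1)
  exact h2

variable [IsManifold (𝓡 d) ∞ M]

theorem eq_of_inChart_eq {k : ℕ} {α β : DForm d M k} (x : M)
    (h : inChart α x (extChartAt (𝓡 d) x x) = inChart β x (extChartAt (𝓡 d) x x)) :
    α x = β x := by
  ext u
  rw [← inChart_chartD α (mem_extChartAt_source (I := 𝓡 d) x),
    ← inChart_chartD β (mem_extChartAt_source (I := 𝓡 d) x), h]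

variable {X : ∀ x : M, TangentSpace (𝓡 d) x} {φ : ℝ → M → M} {Ω : DForm d M 2} {h : M → ℝ}

omit [IsManifold (𝓡 d) ∞ M] in
theorem IsFlow.pullback_zero (hφ : IsFlow X φ) {k : ℕ} (α : DForm d M k) :
    pullback (φ 0) α = α := by
  have h0 : φ 0 = id := funext hφ.zero
  rw [h0]
  funext x
  ext v
  simp [pullback, mfderiv_id]

/-- A Hamiltonian flow preserves the symplectic form. -/
theorem IsFlow.pullback_eq (hφ : IsFlow X φ) (hX : IsHamiltonianField Ω h X)
    (hh : ContMDiff (𝓡 d) 𝓘(ℝ, ℝ) ∞ h) (hΩ : SmoothForm Ω) (hc : ClosedForm Ω) (t : ℝ) :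
    pullback (φ t) Ω = Ω := by
  funext x
  refine eq_of_inChart_eq x (ext_two fun v w => ?_)
  have hy := mem_extChartAt_target (I := 𝓡 d) x
  set y := extChartAt (𝓡 d) x x
  have hd : ∀ s, deriv (fun s => inChart (pullback (φ s) Ω) x y ![v, w]) s = 0 := by
    intro s
    have hs := fun z (hz : z ∈ (extChartAt (𝓡 d) x).target) => hφ.contMDiffAt_comp_symm s hz
    set u : EuclideanSpace ℝ (Fin d) → ℝ := fun z => h (φ s ((extChartAt (𝓡 d) x).symm z)) with hu
    have hus : ContDiffAt ℝ ∞ u y := by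
      rw [← contMDiffAt_iff_contDiffAt]
      exact hh.contMDiffAt.comp y (hs y hy)
    -- `ι_X Ω = -dh` is exact, so `d (φ_s^* (ι_X Ω)) = -d d (h ∘ φ_s)` vanishes by the symmetry
    -- of second derivatives.
    rw [hφ.deriv_pullback hΩ hc s hy (β := fun z w => -fderiv ℝ u z w) (fun z hz w => ?_)]
    · have hdd : DifferentiableAt ℝ (fderiv ℝ u) y :=
        (hus.fderiv_right (m := 1) (by
          exact WithTop.coe_le_coe.mpr (le_top : (2 : ℕ∞) ≤ ⊤))).differentiableAt (by simp)
      have hsymm : IsSymmSndFDerivAt ℝ u y := hus.isSymmSndFDerivAt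
        (by simpa using WithTop.coe_le_coe.mpr (le_top : (2 : ℕ∞) ≤ ⊤))
      have e : ∀ a b, fderiv ℝ (fun z => -fderiv ℝ u z a) y b = -fderiv ℝ (fderiv ℝ u) y b a := by
        intro a b
        rw [fderiv_fun_neg, neg_apply,
          (hdd.hasFDerivAt.clm_apply (hasFDerivAt_const a y)).fderiv]
        simp
      rw [e, e, hsymm.eq v w, sub_self]
    · rw [hX, hu, fderiv_comp_eq_mvfderiv (h := h)
        (hh.contMDiffAt.mdifferentiableAt (by simp)) ((hs z hz).mdifferentiableAt (by simp))]
      have h4 := HasMFDerivAt.comp z (((hφ.contMDiff s).contMDiffAt.mdifferentiableAt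
        (by simp)).hasMFDerivAt) ((contMDiffAt_symm hz).mdifferentiableAt (by simp)).hasMFDerivAt
      have h5 := h4.mfderiv
      exact congrArg (fun l : EuclideanSpace ℝ (Fin d) →L[ℝ]
        TangentSpace (𝓡 d) (φ s ((extChartAt (𝓡 d) x).symm z)) => -mvfderiv (𝓡 d) h _ (l w)) h5
  have hdiff : Differentiable ℝ (fun s => inChart (pullback (φ s) Ω) x y ![v, w]) := by
    intro s
    have h1 := (hφ.contDiffOn_pullback hΩ x).contDiffAt (x := (s, y))
      ((isOpen_univ.prod (isOpen_extChartAt_target (I := 𝓡 d) x)).mem_nhds ⟨Set.mem_univ _, hy⟩)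
    have h2 : ContDiffAt ℝ ∞ (fun s => inChart (pullback (φ s) Ω) x y) s :=
      h1.comp s (contDiffAt_id.prodMk contDiffAt_const)
    exact ((contDiff_alternating_apply ![v, w]).contDiffAt.comp s h2).differentiableAt (by simp)
  have := is_const_of_deriv_eq_zero hdiff hd t 0
  rw [this, hφ.pullback_zero]

omit [IsManifold (𝓡 d) ∞ M] in
/-- A Hamiltonian is constant along its flow. -/
theorem IsFlow.hamiltonian_eq (hφ : IsFlow X φ) (hX : IsHamiltonianField Ω h X)
    (hh : ContMDiff (𝓡 d) 𝓘(ℝ, ℝ) ∞ h) (t : ℝ) (x : M) : h (φ t x) = h x := by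
  have hd : ∀ s, HasDerivAt (fun s => h (φ s x)) 0 s := by
    intro s
    have h1 := (hh.contMDiffAt (x := φ s x)).mdifferentiableAt (by simp)
    have h2 := hφ.integralCurve x s
    have h3 : DifferentiableAt ℝ (fun s => h (φ s x)) s :=
      (HasMFDerivAt.comp s h1.hasMFDerivAt h2).mdifferentiableAt.differentiableAt
    have h4 : fderiv ℝ (fun s => h (φ s x)) s 1 = mvfderiv (𝓡 d) h (φ s x) (X (φ s x)) := by
      rw [fderiv_comp_eq_mvfderiv (h := h) (f := fun s => φ s x) h1 h2.mdifferentiableAt, h2.mfderiv]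
      refine congrArg (mvfderiv (𝓡 d) h (φ s x)) ?_
      exact one_smul ℝ (X (φ s x))
    have h5 : mvfderiv (𝓡 d) h (φ s x) (X (φ s x)) = 0 := by
      have h6 := hX (φ s x) (X (φ s x))
      have h7 : Ω (φ s x) ![X (φ s x), X (φ s x)] = 0 := by
        apply (Ω (φ s x)).map_eq_zero_of_eq _ (i := 0) (j := 1) rfl (by decide)
      linarith
    have h6 := h3.hasDerivAt
    rwa [← fderiv_apply_one_eq_deriv, h4, h5] at h6
  have := is_const_of_deriv_eq_zero (fun s => (hd s).differentiableAt) (fun s => (hd s).deriv) t 0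
  rw [this, hφ.zero]

namespace GKStructure

variable (S : GKStructure d M)

theorem nondeg_Omega (hS : S.Nondegenerate) (x : M) : Nondeg (S.Omega x) := by
  intro v hv
  by_contra hne
  have h1 : S.commInv x v ≠ 0 := fun h0 => hne (by rw [← S.comm_commInv x (hS x) v, h0, map_zero])
  have h2 := S.g.pos x _ h1
  have h3 := hv (S.commInv x v)
  rw [Omega_apply] at h3
  exact absurd h3 h2.ne'

theorem Omega_I (x : M) (v w : TangentSpace (𝓡 d) x) :
    S.Omega x ![S.I x v, w] = S.Omega x ![v, S.I x w] := by
  rw [Omega_apply, Omega_apply]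
  change S.g.inner x (S.commInv x (S.I x v)) w = S.g.inner x (S.commInv x v) (S.I x w)
  rw [S.commInv_I, map_neg, neg_apply, S.inner_I, neg_neg]

theorem Omega_J (x : M) (v w : TangentSpace (𝓡 d) x) :
    S.Omega x ![S.J x v, w] = S.Omega x ![v, S.J x w] := by
  rw [Omega_apply, Omega_apply]
  change S.g.inner x (S.commInv x (S.J x v)) w = S.g.inner x (S.commInv x v) (S.J x w)
  rw [S.commInv_J, map_neg, neg_apply, S.inner_J, neg_neg]

theorem Omega_self_I (x : M) (v : TangentSpace (𝓡 d) x) : S.Omega x ![v, S.I x v] = 0 := by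
  have h1 := S.Omega_I x v v
  have h2 := apply_swap (S.Omega x) v (S.I x v)
  linarith

theorem Psi1_self_I (x : M) (v : TangentSpace (𝓡 d) x) : S.Psi1 x ![v, S.I x v] = 0 := by
  rw [Psi1_apply]
  exact neg_eq_zero.mpr (apply_self (S.Omega x) (S.I x v))

variable {S}

omit [IsManifold (𝓡 d) ∞ M] in
theorem pullback_apply_two {k : M → M} (α : DForm d M 2) (x : M) (v w : TangentSpace (𝓡 d) x) :
    pullback k α x ![v, w] = α (k x) ![mfderiv (𝓡 d) (𝓡 d) k x v, mfderiv (𝓡 d) (𝓡 d) k x w] := by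
  refine congrArg (α (k x)) (funext fun i => ?_)
  fin_cases i <;> rfl

/-- The complex structure `φ_t^* J`: as `φ_t` preserves `Ω`, its derivative is invertible, and
`φ_t^* Ψ₂ = -Ω (φ_t^* J ·, ·)`. Moreover `φ_t^* (ι_X Ψ₂) = dh ∘ φ_t^* J`. -/
theorem exists_pullback_J (hS : S.Nondegenerate) (hφ : IsFlow X φ)
    (hX : IsHamiltonianField S.Omega h X) (hh : ContMDiff (𝓡 d) 𝓘(ℝ, ℝ) ∞ h) (t : ℝ) (x : M)
    (hΩ : pullback (φ t) S.Omega = S.Omega) (v : TangentSpace (𝓡 d) x) :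
    ∃ u : TangentSpace (𝓡 d) x,
      (∀ w, pullback (φ t) S.Psi2 x ![v, w] = -S.Omega x ![u, w]) ∧
      S.Psi2 (φ t x) ![X (φ t x), mfderiv (𝓡 d) (𝓡 d) (φ t) x v] = mvfderiv (𝓡 d) h x u := by
  set A := mfderiv (𝓡 d) (𝓡 d) (φ t) x with hA
  have hpres : ∀ v w, S.Omega x ![v, w] = S.Omega (φ t x) ![A v, A w] := by
    intro v w
    rw [hA, ← pullback_apply_two, hΩ]
  have hinj : Function.Injective A := by
    rw [injective_iff_map_eq_zero]
    intro v hv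
    refine S.nondeg_Omega hS x v fun w => ?_
    refine (hpres v w).trans ?_
    rw [hv]
    exact (S.Omega (φ t x)).map_coord_zero 0 rfl
  have hfin : ∀ z : M, FiniteDimensional ℝ (TangentSpace (𝓡 d) z) := fun _ =>
    inferInstanceAs (FiniteDimensional ℝ (EuclideanSpace ℝ (Fin d)))
  have := hfin x
  have := hfin (φ t x)
  have hrank : Module.finrank ℝ (TangentSpace (𝓡 d) x) =
      Module.finrank ℝ (TangentSpace (𝓡 d) (φ t x)) := rfl
  have hsurj : Function.Surjective A :=
    (LinearMap.injective_iff_surjective_of_finrank_eq_finrank (f := A.toLinearMap) hrank).mp hinj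
  obtain ⟨u, hu⟩ := hsurj (S.J (φ t x) (A v))
  refine ⟨u, fun w => ?_, ?_⟩
  · rw [pullback_apply_two, Psi2_apply, hpres, ← hA, hu]
    rfl
  · have h1 : mvfderiv (𝓡 d) h x u = mvfderiv (𝓡 d) h (φ t x) (A u) := by
      have h2 := mvfderiv_comp_apply (f := φ t) (g := h) x
        (hh.contMDiffAt.mdifferentiableAt (by simp))
        ((hφ.contMDiff t).contMDiffAt.mdifferentiableAt (by simp)) u
      rw [← h2]
      have h3 : h ∘ φ t = h := funext fun z => hφ.hamiltonian_eq hX hh t z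
      rw [h3]
    rw [h1, hu, Psi2_apply]
    change -S.Omega (φ t x) ![S.J (φ t x) (X (φ t x)), A v] = _
    rw [Omega_J, hX, neg_neg]

end GKStructure

end HamiltonianFlow

/-! ### Integration of top-degree forms and the theorem of Stokes -/

theorem real_sign_mul (a b : ℝ) : Real.sign (a * b) = Real.sign a * Real.sign b := by
  rcases lt_trichotomy a 0 with ha | rfl | ha <;> rcases lt_trichotomy b 0 with hb | rfl | hb <;>
    simp [*, Real.sign_of_neg, Real.sign_of_pos, mul_pos_of_neg_of_neg, mul_neg_of_neg_of_pos,
      mul_neg_of_pos_of_neg]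

theorem real_sign_mul_self (a : ℝ) : Real.sign a * a = |a| := by
  rcases lt_trichotomy a 0 with ha | rfl | ha
  · rw [Real.sign_of_neg ha, abs_of_neg ha, neg_one_mul]
  · simp
  · rw [Real.sign_of_pos ha, abs_of_pos ha, one_mul]

section Integration

variable {d : ℕ} {M : Type*} [TopologicalSpace M] [ChartedSpace (EuclideanSpace ℝ (Fin d)) M]

/-- The orientation defined by `θ` is locally constant in charts. -/
def LocallyOriented (θ : DForm d M d) : Prop :=
  ∀ x₀ : M, ∀ y ∈ (extChartAt (𝓡 d) x₀).target,
    ∀ᶠ z in 𝓝 y, Real.sign (coeff θ x₀ z) = Real.sign (coeff θ x₀ y)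

/-- The top-degree form `κ` is continuous in charts. -/
def ContForm (κ : DForm d M d) : Prop :=
  ∀ x₀ : M, ContinuousOn (coeff κ x₀) (extChartAt (𝓡 d) x₀).target

/-- The integral of `κ` over the domain of the chart centred at `x₀`. -/
def chartIntegral (θ κ : DForm d M d) (x₀ : M) : ℝ :=
  ∫ y in (extChartAt (𝓡 d) x₀).target, Real.sign (coeff θ x₀ y) * coeff κ x₀ y

variable {θ κ : DForm d M d} {x₀ x₁ : M} {K : Set M}

theorem coeff_smul (f : M → ℝ) (κ : DForm d M d) (x₀ : M) (y : EuclideanSpace ℝ (Fin d)) :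
    coeff (fun x => f x • κ x) x₀ y = f ((extChartAt (𝓡 d) x₀).symm y) * coeff κ x₀ y := rfl

theorem coeff_eq_zero {y : EuclideanSpace ℝ (Fin d)} (h : κ ((extChartAt (𝓡 d) x₀).symm y) = 0) :
    coeff κ x₀ y = 0 := by
  rw [coeff, inChart, h]
  rfl

theorem LocallyOriented.continuousOn (hθ : LocallyOriented θ) (x₀ : M) :
    ContinuousOn (fun y => Real.sign (coeff θ x₀ y)) (extChartAt (𝓡 d) x₀).target := by
  intro y hy
  refine ContinuousAt.continuousWithinAt ?_
  exact (continuousAt_const (y := Real.sign (coeff θ x₀ y))).congr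
    ((hθ x₀ y hy).mono fun z hz => hz.symm)

theorem isCompact_chart_image [CompactSpace M] (hK : IsClosed K)
    (hs : K ⊆ (extChartAt (𝓡 d) x₀).source) : IsCompact (extChartAt (𝓡 d) x₀ '' K) :=
  hK.isCompact.image_of_continuousOn ((continuousOn_extChartAt x₀).mono hs)

theorem chart_image_subset (hs : K ⊆ (extChartAt (𝓡 d) x₀).source) :
    extChartAt (𝓡 d) x₀ '' K ⊆ (extChartAt (𝓡 d) x₀).target := by
  rintro _ ⟨z, hz, rfl⟩
  exact (extChartAt (𝓡 d) x₀).map_source (hs hz)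

theorem symm_notMem {y : EuclideanSpace ℝ (Fin d)} (hy : y ∈ (extChartAt (𝓡 d) x₀).target)
    (hyK : y ∉ extChartAt (𝓡 d) x₀ '' K) : (extChartAt (𝓡 d) x₀).symm y ∉ K := fun h =>
  hyK ⟨_, h, (extChartAt (𝓡 d) x₀).right_inv hy⟩

theorem measurableSet_target (x₀ : M) : MeasurableSet (extChartAt (𝓡 d) x₀).target :=
  (isOpen_extChartAt_target x₀).measurableSet

/-- A function on a chart which is continuous and vanishes off the image of a compact set is
integrable. -/
theorem integrableOn_target [CompactSpace M] {f : EuclideanSpace ℝ (Fin d) → ℝ}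
    (hf : ContinuousOn f (extChartAt (𝓡 d) x₀).target) (hK : IsClosed K)
    (hs : K ⊆ (extChartAt (𝓡 d) x₀).source)
    (h0 : ∀ y ∈ (extChartAt (𝓡 d) x₀).target, y ∉ extChartAt (𝓡 d) x₀ '' K → f y = 0) :
    IntegrableOn f (extChartAt (𝓡 d) x₀).target :=
  ((hf.mono (chart_image_subset hs)).integrableOn_compact
    (isCompact_chart_image hK hs)).of_forall_sdiff_eq_zero (measurableSet_target x₀)
      fun y hy => h0 y hy.1 hy.2

theorem integrableOn_chart [CompactSpace M] (hθ : LocallyOriented θ) (hκ : ContForm κ)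
    (hK : IsClosed K) (hs : K ⊆ (extChartAt (𝓡 d) x₀).source) (h0 : ∀ z ∉ K, κ z = 0) :
    IntegrableOn (fun y => Real.sign (coeff θ x₀ y) * coeff κ x₀ y)
      (extChartAt (𝓡 d) x₀).target :=
  integrableOn_target ((hθ.continuousOn x₀).mul (hκ x₀)) hK hs fun y hy hyK => by
    rw [coeff_eq_zero (h0 _ (symm_notMem hy hyK)), mul_zero]

variable [IsManifold (𝓡 d) ∞ M]

/-- The transformation rule of the coefficient of a top-degree form. -/
theorem coeff_transition (κ : DForm d M d) {y : EuclideanSpace ℝ (Fin d)}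
    (hy : y ∈ (extChartAt (𝓡 d) x₀).target)
    (hx : (extChartAt (𝓡 d) x₀).symm y ∈ (extChartAt (𝓡 d) x₁).source) :
    coeff κ x₀ y = (fderiv ℝ (fun z => extChartAt (𝓡 d) x₁ ((extChartAt (𝓡 d) x₀).symm z)) y).det *
      coeff κ x₁ (extChartAt (𝓡 d) x₁ ((extChartAt (𝓡 d) x₀).symm y)) := by
  have h := formAlong_eq κ ((contMDiffAt_symm hy).mdifferentiableAt (by simp)) hx
  rw [coeff, inChart_eq_formAlong, h]
  exact compContinuousLinearMap_eq_det_smul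
    (inChart κ x₁ (extChartAt (𝓡 d) x₁ ((extChartAt (𝓡 d) x₀).symm y)))
    (fderiv ℝ (fun z => extChartAt (𝓡 d) x₁ ((extChartAt (𝓡 d) x₀).symm z)) y)
    (fun i => EuclideanSpace.basisFun (Fin d) ℝ i)

/-- Integrals over two chart domains agree for a form supported in their intersection. -/
theorem chartIntegral_eq (θ : DForm d M d) (h0 : ∀ z ∉ K, κ z = 0)
    (hs₀ : K ⊆ (extChartAt (𝓡 d) x₀).source) (hs₁ : K ⊆ (extChartAt (𝓡 d) x₁).source) :
    chartIntegral θ κ x₀ = chartIntegral θ κ x₁ := by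
  have hopen : ∀ a b : M, IsOpen ((extChartAt (𝓡 d) a).target ∩
      (extChartAt (𝓡 d) a).symm ⁻¹' (extChartAt (𝓡 d) b).source) := fun a b =>
    (continuousOn_extChartAt_symm a).isOpen_inter_preimage (isOpen_extChartAt_target a)
      (isOpen_extChartAt_source b)
  have hred : ∀ a b : M, K ⊆ (extChartAt (𝓡 d) b).source → chartIntegral θ κ a =
      ∫ y in (extChartAt (𝓡 d) a).target ∩
        (extChartAt (𝓡 d) a).symm ⁻¹' (extChartAt (𝓡 d) b).source,
        Real.sign (coeff θ a y) * coeff κ a y := by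
    intro a b hb
    refine (setIntegral_eq_of_subset_of_forall_sdiff_eq_zero (measurableSet_target a)
      Set.inter_subset_left fun y hy => ?_)
    rw [coeff_eq_zero (h0 _ fun hK => hy.2 ⟨hy.1, hb hK⟩), mul_zero]
  rw [hred x₀ x₁ hs₁, hred x₁ x₀ hs₀]
  set U₀ := (extChartAt (𝓡 d) x₀).target ∩
    (extChartAt (𝓡 d) x₀).symm ⁻¹' (extChartAt (𝓡 d) x₁).source
  set ψ : EuclideanSpace ℝ (Fin d) → EuclideanSpace ℝ (Fin d) :=
    fun z => extChartAt (𝓡 d) x₁ ((extChartAt (𝓡 d) x₀).symm z) with hψ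
  have himg : ψ '' U₀ = (extChartAt (𝓡 d) x₁).target ∩
      (extChartAt (𝓡 d) x₁).symm ⁻¹' (extChartAt (𝓡 d) x₀).source := by
    ext y
    constructor
    · rintro ⟨z, ⟨hz0, hz1⟩, rfl⟩
      refine ⟨(extChartAt (𝓡 d) x₁).map_source hz1, ?_⟩
      rw [Set.mem_preimage, hψ, (extChartAt (𝓡 d) x₁).left_inv hz1]
      exact (extChartAt (𝓡 d) x₀).map_target hz0
    · rintro ⟨hy1, hy0⟩
      refine ⟨extChartAt (𝓡 d) x₀ ((extChartAt (𝓡 d) x₁).symm y),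
        ⟨(extChartAt (𝓡 d) x₀).map_source hy0, ?_⟩, ?_⟩
      · rw [Set.mem_preimage, (extChartAt (𝓡 d) x₀).left_inv hy0]
        exact (extChartAt (𝓡 d) x₁).map_target hy1
      · rw [hψ]
        simp only
        rw [(extChartAt (𝓡 d) x₀).left_inv hy0, (extChartAt (𝓡 d) x₁).right_inv hy1]
  have hinj : Set.InjOn ψ U₀ := by
    rintro a ⟨ha0, ha1⟩ b ⟨hb0, hb1⟩ hab
    exact (extChartAt (𝓡 d) x₀).symm.injOn ha0 hb0 ((extChartAt (𝓡 d) x₁).injOn ha1 hb1 hab)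
  have hder : ∀ y ∈ U₀, HasFDerivWithinAt ψ (fderiv ℝ ψ y) U₀ y := fun y hy =>
    ((contDiffAt_chart_comp (contMDiffAt_symm hy.1) hy.2).differentiableAt
      (by simp)).hasFDerivAt.hasFDerivWithinAt
  rw [← himg, integral_image_eq_integral_abs_det_fderiv_smul volume (hopen x₀ x₁).measurableSet
    hder hinj]
  refine setIntegral_congr_fun (hopen x₀ x₁).measurableSet fun y hy => ?_
  simp only [smul_eq_mul]
  rw [coeff_transition θ hy.1 hy.2, coeff_transition κ hy.1 hy.2, real_sign_mul]
  have hdet : |(fderiv ℝ ψ y).det| = Real.sign (fderiv ℝ ψ y).det * (fderiv ℝ ψ y).det :=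
    (real_sign_mul_self _).symm
  rw [hdet]
  ring

variable [T2Space M] [CompactSpace M]

theorem finite_chartPartition_support :
    {x₀ : M | (Function.support (chartPartition (d := d) (M := M) x₀)).Nonempty}.Finite :=
  (chartPartition (d := d) (M := M)).locallyFinite.finite_nonempty_of_compact

variable (d M) in
/-- The finitely many centres of charts at which the partition of unity is not zero. -/
def chartCentres : Finset M := (finite_chartPartition_support (d := d) (M := M)).toFinset

theorem chartPartition_eq_zero (hx : x₀ ∉ chartCentres d M) (z : M) :
    chartPartition (d := d) (M := M) x₀ z = 0 := by
  by_contra h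
  exact hx ((Set.Finite.mem_toFinset _).mpr ⟨z, h⟩)

theorem sum_chartPartition (z : M) :
    ∑ x₀ ∈ chartCentres d M, chartPartition (d := d) (M := M) x₀ z = 1 := by
  rw [← (chartPartition (d := d) (M := M)).sum_eq_one (Set.mem_univ z)]
  refine (finsum_eq_sum_of_support_subset _ fun x₀ hx => ?_).symm
  by_contra h
  exact hx (chartPartition_eq_zero h z)

theorem tsupport_chartPartition_subset (x₀ : M) :
    tsupport (chartPartition (d := d) (M := M) x₀) ⊆ (extChartAt (𝓡 d) x₀).source := by
  rw [extChartAt_source]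
  exact chartPartition_isSubordinate x₀

/-- The integral of a form is a finite sum, as the partition of unity is locally finite and `M` is
compact. -/
theorem finsum_chart_eq_sum {F : M → EuclideanSpace ℝ (Fin d) → ℝ} :
    ∑ᶠ x₀ : M, ∫ y in (extChartAt (𝓡 d) x₀).target,
      chartPartition (d := d) x₀ ((extChartAt (𝓡 d) x₀).symm y) * F x₀ y =
    ∑ x₀ ∈ chartCentres d M, ∫ y in (extChartAt (𝓡 d) x₀).target,
      chartPartition (d := d) x₀ ((extChartAt (𝓡 d) x₀).symm y) * F x₀ y := by
  refine finsum_eq_sum_of_support_subset _ fun x₀ hx => ?_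
  by_contra h
  refine hx ?_
  simp only [chartPartition_eq_zero (d := d) h, zero_mul, integral_zero]

theorem integral_eq_sum (θ κ : DForm d M d) : integral θ κ =
    ∑ x₀ ∈ chartCentres d M,
      chartIntegral θ (fun x => chartPartition (d := d) x₀ x • κ x) x₀ := by
  rw [integral, finsum_chart_eq_sum]
  refine Finset.sum_congr rfl fun x₀ _ => integral_congr_ae (Filter.Eventually.of_forall fun y => ?_)
  simp only [coeff_smul]
  ring

omit [IsManifold (𝓡 d) ∞ M] [T2Space M] [CompactSpace M] in
theorem ContForm.smul {f : M → ℝ} (hf : Continuous f) (hκ : ContForm κ) :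
    ContForm (fun x => f x • κ x) := fun x₀ =>
  (hf.comp_continuousOn (continuousOn_extChartAt_symm x₀)).mul (hκ x₀)

theorem continuous_chartPartition (x₀ : M) :
    Continuous (chartPartition (d := d) (M := M) x₀) :=
  (chartPartition (d := d) (M := M) x₀).contMDiff.continuous

theorem smul_chartPartition_eq_zero (κ : DForm d M d) (z : M)
    (hz : z ∉ tsupport (chartPartition (d := d) (M := M) x₀)) :
    chartPartition (d := d) x₀ z • κ z = 0 := by
  rw [image_eq_zero_of_notMem_tsupport hz, zero_smul]

/-- The integral over one chart of a form supported there, by the partition of unity. -/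
theorem chartIntegral_eq_sum (hθ : LocallyOriented θ) (hκ : ContForm κ) (hK : IsClosed K)
    (hs : K ⊆ (extChartAt (𝓡 d) x₀).source) (h0 : ∀ z ∉ K, κ z = 0) :
    chartIntegral θ κ x₀ = ∑ x₁ ∈ chartCentres d M,
      chartIntegral θ (fun x => chartPartition (d := d) x₁ x • κ x) x₁ := by
  have h0' : ∀ x₁ : M, ∀ z ∉ K, chartPartition (d := d) x₁ z • κ z = 0 := fun x₁ z hz => by
    rw [h0 z hz, smul_zero]
  have h1 : ∀ x₁ ∈ chartCentres d M,
      chartIntegral θ (fun x => chartPartition (d := d) x₁ x • κ x) x₁ =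
      chartIntegral θ (fun x => chartPartition (d := d) x₁ x • κ x) x₀ := by
    intro x₁ _
    refine chartIntegral_eq (K := K ∩ tsupport (chartPartition (d := d) (M := M) x₁)) θ ?_
      (Set.inter_subset_right.trans (tsupport_chartPartition_subset x₁))
      (Set.inter_subset_left.trans hs)
    intro z hz
    by_cases hzK : z ∈ K
    · exact smul_chartPartition_eq_zero κ z fun h => hz ⟨hzK, h⟩
    · exact h0' x₁ z hzK
  rw [Finset.sum_congr rfl h1]
  unfold chartIntegral
  rw [← integral_finsetSum _ fun x₁ _ => integrableOn_chart hθ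
    (hκ.smul (continuous_chartPartition x₁)) hK hs (h0' x₁)]
  refine integral_congr_ae (Filter.Eventually.of_forall fun y => ?_)
  simp only [coeff_smul]
  rw [← Finset.mul_sum, ← Finset.sum_mul, sum_chartPartition, one_mul]

/-- If forms `κ i`, each supported in the `i`-th chart domain, have sum zero, then so do their
integrals: both sides may be computed with the same partition of unity. -/
theorem sum_chartIntegral_eq_zero (hθ : LocallyOriented θ) {κ : M → DForm d M d} {K : M → Set M}
    (hκ : ∀ i, ContForm (κ i)) (hK : ∀ i, IsClosed (K i))
    (hs : ∀ i, K i ⊆ (extChartAt (𝓡 d) i).source) (h0 : ∀ i, ∀ z ∉ K i, κ i z = 0)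
    (hsum : ∀ z, ∑ i ∈ chartCentres d M, κ i z = 0) :
    ∑ i ∈ chartCentres d M, chartIntegral θ (κ i) i = 0 := by
  rw [Finset.sum_congr rfl fun i _ => chartIntegral_eq_sum hθ (hκ i) (hK i) (hs i) (h0 i),
    Finset.sum_comm]
  refine Finset.sum_eq_zero fun x₁ _ => ?_
  unfold chartIntegral
  rw [← integral_finsetSum _ fun i _ => integrableOn_chart hθ
    ((hκ i).smul (continuous_chartPartition x₁)) (isClosed_tsupport _)
    (tsupport_chartPartition_subset x₁) (smul_chartPartition_eq_zero (κ i))]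
  refine (integral_congr_ae (Filter.Eventually.of_forall fun y => ?_)).trans (integral_zero _ _)
  simp only [coeff_smul]
  rw [← Finset.mul_sum, ← Finset.mul_sum]
  have h1 : ∑ i ∈ chartCentres d M, coeff (κ i) x₁ y =
      coeff (fun z => ∑ i ∈ chartCentres d M, κ i z) x₁ y := by
    simp only [coeff, inChart_apply, ContinuousAlternatingMap.sum_apply]
  have h2 : coeff (fun z => ∑ i ∈ chartCentres d M, κ i z) x₁ y = 0 := coeff_eq_zero (hsum _)
  rw [h1, h2, mul_zero, mul_zero]

end Integration

section Stokes

variable {d : ℕ} {M : Type*} [TopologicalSpace M] [ChartedSpace (EuclideanSpace ℝ (Fin d)) M]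

/-- The derivative `df (Z)` of a function along a vector field. -/
def lieD (Z : ∀ z : M, TangentSpace (𝓡 d) z) (f : M → ℝ) (z : M) : ℝ :=
  mvfderiv (𝓡 d) f z (Z z)

variable {θ η : DForm d M d} {Z : ∀ z : M, TangentSpace (𝓡 d) z} {f h : M → ℝ} {x₀ : M}
  {y : EuclideanSpace ℝ (Fin d)}

theorem lieD_eq_zero_of_notMem_tsupport {z : M} (hz : z ∉ tsupport f) : lieD Z f z = 0 := by
  have h1 : f =ᶠ[𝓝 z] fun _ => 0 := notMem_tsupport_iff_eventuallyEq.mp hz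
  rw [lieD, mvfderiv, h1.mfderiv_eq, mfderiv_const]
  rfl

variable [IsManifold (𝓡 d) ∞ M]

theorem lieD_symm (hf : ContMDiff (𝓡 d) 𝓘(ℝ, ℝ) ∞ f)
    (hy : y ∈ (extChartAt (𝓡 d) x₀).target) :
    lieD Z f ((extChartAt (𝓡 d) x₀).symm y) =
      fderiv ℝ (fun z => f ((extChartAt (𝓡 d) x₀).symm z)) y (vecInChart Z x₀ y) := by
  rw [fderiv_comp_eq_mvfderiv (h := f) (hf.contMDiffAt.mdifferentiableAt (by simp))
    ((contMDiffAt_symm hy).mdifferentiableAt (by simp))]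
  exact congrArg (mvfderiv (𝓡 d) f _) (chartDsymm_chartD hy _).symm

theorem contDiffOn_comp_symm (hf : ContMDiff (𝓡 d) 𝓘(ℝ, ℝ) ∞ f) (x₀ : M) :
    ContDiffOn ℝ ∞ (fun z => f ((extChartAt (𝓡 d) x₀).symm z)) (extChartAt (𝓡 d) x₀).target := by
  rw [← contMDiffOn_iff_contDiffOn]
  exact hf.comp_contMDiffOn (contMDiffOn_extChartAt_symm x₀)

theorem contForm_lieD (hf : ContMDiff (𝓡 d) 𝓘(ℝ, ℝ) ∞ f) (hη : ContForm η)
    (hZ : ∀ x₀, ContDiffOn ℝ 1 (vecInChart Z x₀) (extChartAt (𝓡 d) x₀).target) :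
    ContForm (fun z => lieD Z f z • η z) := by
  intro x₀
  have h1 : ContinuousOn (fun y => fderiv ℝ (fun z => f ((extChartAt (𝓡 d) x₀).symm z)) y
      (vecInChart Z x₀ y)) (extChartAt (𝓡 d) x₀).target :=
    ((contDiffOn_comp_symm hf x₀).continuousOn_fderiv_of_isOpen
      (isOpen_extChartAt_target x₀) (by simp)).clm_apply (hZ x₀).continuousOn
  refine (h1.mul (hη x₀)).congr fun y hy => ?_
  rw [coeff_smul, lieD_symm hf hy]
  rfl

omit [IsManifold (𝓡 d) ∞ M] in
/-- The divergence theorem on a chart for a vector field supported in a compact set, with a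
locally constant weight. -/
theorem setIntegral_divergence_eq_zero [CompactSpace M]
    {W : EuclideanSpace ℝ (Fin d) → EuclideanSpace ℝ (Fin d)} {s : EuclideanSpace ℝ (Fin d) → ℝ}
    (hW : ContDiffOn ℝ 1 W (extChartAt (𝓡 d) x₀).target)
    (hs : ∀ y ∈ (extChartAt (𝓡 d) x₀).target, ∀ᶠ z in 𝓝 y, s z = s y)
    {K : Set M} (hK : IsClosed K) (hKs : K ⊆ (extChartAt (𝓡 d) x₀).source)
    (h0 : ∀ y ∈ (extChartAt (𝓡 d) x₀).target, y ∉ extChartAt (𝓡 d) x₀ '' K → W y = 0) :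
    ∫ y in (extChartAt (𝓡 d) x₀).target, s y * divergence W y = 0 := by
  have hopen := isOpen_extChartAt_target (I := 𝓡 d) x₀
  have hc := isCompact_chart_image hK hKs
  set V : EuclideanSpace ℝ (Fin d) → EuclideanSpace ℝ (Fin d) :=
    (extChartAt (𝓡 d) x₀).target.indicator fun y => s y • W y with hV
  have hV0 : ∀ y ∉ extChartAt (𝓡 d) x₀ '' K, V y = 0 := by
    intro y hy
    by_cases hyt : y ∈ (extChartAt (𝓡 d) x₀).target
    · rw [hV, Set.indicator_of_mem hyt, h0 y hyt hy, smul_zero]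
    · rw [hV, Set.indicator_of_notMem hyt]
  have hev : ∀ y ∈ (extChartAt (𝓡 d) x₀).target, V =ᶠ[𝓝 y] fun z => s y • W z := by
    intro y hy
    filter_upwards [hopen.mem_nhds hy, hs y hy] with z hz hsz
    rw [hV, Set.indicator_of_mem hz, hsz]
  have htsupp : tsupport V ⊆ extChartAt (𝓡 d) x₀ '' K :=
    closure_minimal (fun y hy => by_contra fun h => hy (hV0 y h)) hc.isClosed
  have hoff : ∀ y ∉ (extChartAt (𝓡 d) x₀).target, V =ᶠ[𝓝 y] fun _ => 0 := fun y hyt =>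
    notMem_tsupport_iff_eventuallyEq.mp fun hy => hyt (chart_image_subset hKs (htsupp hy))
  have hVs : ContDiff ℝ 1 V := contDiff_iff_contDiffAt.mpr fun y => by
    by_cases hyt : y ∈ (extChartAt (𝓡 d) x₀).target
    · refine ContDiffAt.congr_of_eventuallyEq ?_ (hev y hyt)
      exact (hW.contDiffAt (hopen.mem_nhds hyt)).const_smul (s y)
    · exact contDiffAt_const.congr_of_eventuallyEq (hoff y hyt)
  have hdiv : ∀ y, divergence V y = (extChartAt (𝓡 d) x₀).target.indicator
      (fun y => s y * divergence W y) y := by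
    intro y
    by_cases hyt : y ∈ (extChartAt (𝓡 d) x₀).target
    · have hWd := (hW.contDiffAt (hopen.mem_nhds hyt)).differentiableAt one_ne_zero
      rw [Set.indicator_of_mem hyt, divergence_congr (hev y hyt),
        divergence_smul (differentiableAt_const _) hWd]
      simp
    · rw [Set.indicator_of_notMem hyt, divergence_congr (hoff y hyt), divergence]
      simp
  have hzero := integral_divergence_eq_zero hVs (HasCompactSupport.of_support_subset_isCompact hc
    ((subset_tsupport V).trans htsupp))
  simp only [hdiv] at hzero
  rwa [integral_indicator hopen.measurableSet] at hzero

variable [T2Space M] [CompactSpace M]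

/-- Integration by parts: if `c` is the coefficient of `η`, then
`∫ h div (c Z) = -∫ dh (Z) η`. -/
theorem sum_integral_divergence (hθ : LocallyOriented θ)
    (hη : ∀ x₀, ContDiffOn ℝ 1 (coeff η x₀) (extChartAt (𝓡 d) x₀).target)
    (hZ : ∀ x₀, ContDiffOn ℝ 1 (vecInChart Z x₀) (extChartAt (𝓡 d) x₀).target)
    (hh : ContMDiff (𝓡 d) 𝓘(ℝ, ℝ) ∞ h) :
    ∑ x₀ ∈ chartCentres d M, ∫ y in (extChartAt (𝓡 d) x₀).target,
      chartPartition (d := d) x₀ ((extChartAt (𝓡 d) x₀).symm y) *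
        (Real.sign (coeff θ x₀ y) * (h ((extChartAt (𝓡 d) x₀).symm y) *
          divergence (fun z => coeff η x₀ z • vecInChart Z x₀ z) y)) =
      -integral θ (fun x => lieD Z h x • η x) := by
  have hηc : ContForm η := fun x₀ => (hη x₀).continuousOn
  set r : M → M → ℝ := fun x₀ => chartPartition (d := d) (M := M) x₀ with hr
  have hrs : ∀ x₀, ContMDiff (𝓡 d) 𝓘(ℝ, ℝ) ∞ (r x₀) := fun x₀ =>
    (chartPartition (d := d) (M := M) x₀).contMDiff
  have hκ₁ := contForm_lieD hh hηc hZ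
  have hκ₂ : ∀ x₀, ContForm (fun z => h z • lieD Z (r x₀) z • η z) := fun x₀ =>
    (contForm_lieD (hrs x₀) hηc hZ).smul hh.continuous
  have hz₁ : ∀ x₀, ∀ z ∉ tsupport (r x₀), r x₀ z • lieD Z h z • η z = 0 := fun x₀ z hz =>
    smul_chartPartition_eq_zero (fun z => lieD Z h z • η z) z hz
  have hz₂ : ∀ x₀, ∀ z ∉ tsupport (r x₀), h z • lieD Z (r x₀) z • η z = 0 := fun x₀ z hz => by
    rw [lieD_eq_zero_of_notMem_tsupport hz, zero_smul, smul_zero]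
  have hchart : ∀ x₀ ∈ chartCentres d M, ∫ y in (extChartAt (𝓡 d) x₀).target,
      r x₀ ((extChartAt (𝓡 d) x₀).symm y) *
        (Real.sign (coeff θ x₀ y) * (h ((extChartAt (𝓡 d) x₀).symm y) *
          divergence (fun z => coeff η x₀ z • vecInChart Z x₀ z) y)) =
      -(chartIntegral θ (fun z => r x₀ z • lieD Z h z • η z) x₀ +
        chartIntegral θ (fun z => h z • lieD Z (r x₀) z • η z) x₀) := by
    intro x₀ _
    have hsub := tsupport_chartPartition_subset (d := d) (M := M) x₀
    have hopen := isOpen_extChartAt_target (I := 𝓡 d) x₀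
    set b : EuclideanSpace ℝ (Fin d) → ℝ := fun z =>
      r x₀ ((extChartAt (𝓡 d) x₀).symm z) * h ((extChartAt (𝓡 d) x₀).symm z)
    set W₀ : EuclideanSpace ℝ (Fin d) → EuclideanSpace ℝ (Fin d) :=
      fun z => coeff η x₀ z • vecInChart Z x₀ z
    have hb := (contDiffOn_comp_symm (hrs x₀) x₀).mul (contDiffOn_comp_symm hh x₀)
    have hW₀ : ContDiffOn ℝ 1 W₀ (extChartAt (𝓡 d) x₀).target := (hη x₀).smul (hZ x₀)
    have hstokes := setIntegral_divergence_eq_zero (x₀ := x₀) (W := fun z => b z • W₀ z)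
      (s := fun y => Real.sign (coeff θ x₀ y)) ((hb.of_le (by simp)).smul hW₀) (hθ x₀)
      (isClosed_tsupport (r x₀)) hsub (fun y hy hyK => by
        have h1 : r x₀ ((extChartAt (𝓡 d) x₀).symm y) = 0 :=
          image_eq_zero_of_notMem_tsupport (symm_notMem hy hyK)
        simp only [b, h1, zero_mul, zero_smul])
    have hi₁ := integrableOn_chart hθ (hκ₁.smul (continuous_chartPartition x₀))
      (isClosed_tsupport (r x₀)) hsub (hz₁ x₀)
    have hi₂ := integrableOn_chart hθ (hκ₂ x₀) (isClosed_tsupport (r x₀)) hsub (hz₂ x₀)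
    have hi₀ : IntegrableOn (fun y => r x₀ ((extChartAt (𝓡 d) x₀).symm y) *
        (Real.sign (coeff θ x₀ y) * (h ((extChartAt (𝓡 d) x₀).symm y) * divergence W₀ y)))
        (extChartAt (𝓡 d) x₀).target := by
      refine integrableOn_target ?_ (isClosed_tsupport (r x₀)) hsub fun y hy hyK => ?_
      · have hdiv : ContinuousOn (divergence W₀) (extChartAt (𝓡 d) x₀).target := by
          have h1 := hW₀.continuousOn_fderiv_of_isOpen hopen (by simp)
          exact (LinearMap.continuous_of_finiteDimensional
            ((LinearMap.trace ℝ (EuclideanSpace ℝ (Fin d))) ∘ₗ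
              (ContinuousLinearMap.coeLM ℝ))).comp_continuousOn h1
        exact (contDiffOn_comp_symm (hrs x₀) x₀).continuousOn.mul ((hθ.continuousOn x₀).mul
          ((contDiffOn_comp_symm hh x₀).continuousOn.mul hdiv))
      · have h1 : r x₀ ((extChartAt (𝓡 d) x₀).symm y) = 0 :=
          image_eq_zero_of_notMem_tsupport (symm_notMem hy hyK)
        rw [h1, zero_mul]
    have hsum : ∫ y in (extChartAt (𝓡 d) x₀).target, Real.sign (coeff θ x₀ y) *
        divergence (fun z => b z • W₀ z) y =
        (∫ y in (extChartAt (𝓡 d) x₀).target, r x₀ ((extChartAt (𝓡 d) x₀).symm y) *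
          (Real.sign (coeff θ x₀ y) * (h ((extChartAt (𝓡 d) x₀).symm y) * divergence W₀ y))) +
        (chartIntegral θ (fun z => r x₀ z • lieD Z h z • η z) x₀ +
          chartIntegral θ (fun z => h z • lieD Z (r x₀) z • η z) x₀) := by
      unfold chartIntegral
      rw [← integral_add hi₁ hi₂]
      refine Eq.trans ?_ (integral_add hi₀ (hi₁.add hi₂))
      refine setIntegral_congr_fun (measurableSet_target x₀) fun y hy => ?_
      have d1 := ((contDiffOn_comp_symm (hrs x₀) x₀).contDiffAt
        (hopen.mem_nhds hy)).differentiableAt (by simp)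
      have d2 := ((contDiffOn_comp_symm hh x₀).contDiffAt
        (hopen.mem_nhds hy)).differentiableAt (by simp)
      have hbf := (d1.hasFDerivAt.mul d2.hasFDerivAt).fderiv
      have hbv : fderiv ℝ b y (W₀ y) = coeff η x₀ y *
          (r x₀ ((extChartAt (𝓡 d) x₀).symm y) * lieD Z h ((extChartAt (𝓡 d) x₀).symm y) +
            h ((extChartAt (𝓡 d) x₀).symm y) *
              lieD Z (r x₀) ((extChartAt (𝓡 d) x₀).symm y)) := by
        rw [lieD_symm hh hy, lieD_symm (hrs x₀) hy]
        have h3 := congrArg (fun l : EuclideanSpace ℝ (Fin d) →L[ℝ] ℝ => l (W₀ y)) hbf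
        refine h3.trans ?_
        simp only [W₀, add_apply, smul_apply, smul_eq_mul, map_smul]
      rw [divergence_smul ((hb.contDiffAt (hopen.mem_nhds hy)).differentiableAt (by simp))
        ((hW₀.contDiffAt (hopen.mem_nhds hy)).differentiableAt one_ne_zero), hbv]
      simp only [coeff_smul, hr]
      ring
    rw [hstokes] at hsum
    linarith
  have hzero : ∑ x₀ ∈ chartCentres d M,
      chartIntegral θ (fun z => h z • lieD Z (r x₀) z • η z) x₀ = 0 := by
    refine sum_chartIntegral_eq_zero hθ hκ₂ (fun x₀ => isClosed_tsupport (r x₀))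
      (fun x₀ => tsupport_chartPartition_subset x₀) hz₂ fun z => ?_
    rw [← Finset.smul_sum, ← Finset.sum_smul]
    have h1 : ∑ x₀ ∈ chartCentres d M, lieD Z (r x₀) z = 0 := by
      have key : ∀ y ∈ (extChartAt (𝓡 d) z).target,
          ∑ x₀ ∈ chartCentres d M, lieD Z (r x₀) ((extChartAt (𝓡 d) z).symm y) = 0 := by
        intro y hy
        have hD := HasFDerivAt.fun_sum (u := chartCentres d M) fun x₀ _ =>
          (((contDiffOn_comp_symm (hrs x₀) z).contDiffAt
            (target_mem_nhds hy)).differentiableAt (by simp)).hasFDerivAt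
        have h3 : (fun y => ∑ x₀ ∈ chartCentres d M, r x₀ ((extChartAt (𝓡 d) z).symm y)) =
            fun _ => 1 := funext fun y => sum_chartPartition _
        rw [h3] at hD
        have h4 := hD.unique (hasFDerivAt_const (1 : ℝ) y)
        have h5 := congrArg (fun l : EuclideanSpace ℝ (Fin d) →L[ℝ] ℝ => l (vecInChart Z z y)) h4
        simp only [sum_apply, zero_apply] at h5
        rw [← h5]
        exact Finset.sum_congr rfl fun x₀ _ => lieD_symm (hrs x₀) hy
      have h2 := key _ (mem_extChartAt_target (I := 𝓡 d) z)
      rwa [extChartAt_to_inv] at h2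
    rw [h1, zero_smul, smul_zero]
  rw [Finset.sum_congr rfl hchart, Finset.sum_neg_distrib, Finset.sum_add_distrib, hzero, add_zero,
    integral_eq_sum]

end Stokes

/-! ### Differentiation under the integral sign -/

section Derivative

variable {d : ℕ} {M : Type*} [TopologicalSpace M] [ChartedSpace (EuclideanSpace ℝ (Fin d)) M]
  [IsManifold (𝓡 d) ∞ M] [T2Space M] [CompactSpace M]
  {θ : DForm d M d} {η : ℝ → DForm d M d}

/-- Differentiation of an integral with respect to a parameter. -/
theorem hasDerivAt_integral (hθ : LocallyOriented θ)
    (hη : ∀ x₀ : M, ContDiffOn ℝ 1 (fun p : ℝ × EuclideanSpace ℝ (Fin d) => coeff (η p.1) x₀ p.2)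
      (Set.univ ×ˢ (extChartAt (𝓡 d) x₀).target)) {f : M → ℝ} (hf : Continuous f) (t : ℝ) :
    HasDerivAt (fun s => integral θ (fun x => f x • η s x))
      (∑ x₀ ∈ chartCentres d M, ∫ y in (extChartAt (𝓡 d) x₀).target,
        chartPartition (d := d) x₀ ((extChartAt (𝓡 d) x₀).symm y) *
          (Real.sign (coeff θ x₀ y) * (f ((extChartAt (𝓡 d) x₀).symm y) *
            deriv (fun s => coeff (η s) x₀ y) t))) t := by
  have h1 : (fun s => integral θ (fun x => f x • η s x)) = fun s =>
      ∑ x₀ ∈ chartCentres d M, ∫ y in (extChartAt (𝓡 d) x₀).target,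
        chartPartition (d := d) x₀ ((extChartAt (𝓡 d) x₀).symm y) *
          (Real.sign (coeff θ x₀ y) * (f ((extChartAt (𝓡 d) x₀).symm y) * coeff (η s) x₀ y)) := by
    funext s
    rw [integral, finsum_chart_eq_sum]
    simp only [coeff_smul]
  rw [h1]
  refine HasDerivAt.fun_sum fun x₀ _ => ?_
  have hopen := isOpen_extChartAt_target (I := 𝓡 d) x₀
  have hsub := tsupport_chartPartition_subset (d := d) (M := M) x₀
  have hcl := isClosed_tsupport (chartPartition (d := d) (M := M) x₀)
  have hK := isCompact_chart_image hcl hsub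
  set K := extChartAt (𝓡 d) x₀ '' tsupport (chartPartition (d := d) (M := M) x₀)
  set r : EuclideanSpace ℝ (Fin d) → ℝ := fun y =>
    chartPartition (d := d) x₀ ((extChartAt (𝓡 d) x₀).symm y) with hr
  set c : ℝ × EuclideanSpace ℝ (Fin d) → ℝ := fun p => coeff (η p.1) x₀ p.2
  have hcd : ∀ s : ℝ, ∀ y ∈ (extChartAt (𝓡 d) x₀).target, HasDerivAt (fun s => c (s, y))
      (fderiv ℝ c (s, y) (1, 0)) s := fun s y hy => by
    have h2 := ((hη x₀).contDiffAt (x := (s, y)) ((isOpen_univ.prod hopen).mem_nhds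
      ⟨Set.mem_univ _, hy⟩)).differentiableAt one_ne_zero
    exact h2.hasFDerivAt.comp_hasDerivAt s ((hasDerivAt_id s).prodMk (hasDerivAt_const s y))
  have hc' : ContinuousOn (fun p => fderiv ℝ c p (1, 0))
      (Set.univ ×ˢ (extChartAt (𝓡 d) x₀).target) :=
    ((hη x₀).continuousOn_fderiv_of_isOpen (isOpen_univ.prod hopen) le_rfl).clm_apply
      continuousOn_const
  have hrc : ContinuousOn r (extChartAt (𝓡 d) x₀).target :=
    (continuous_chartPartition x₀).comp_continuousOn (continuousOn_extChartAt_symm x₀)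
  have hfc : ContinuousOn (fun y => f ((extChartAt (𝓡 d) x₀).symm y))
      (extChartAt (𝓡 d) x₀).target := hf.comp_continuousOn (continuousOn_extChartAt_symm x₀)
  have hr0 : ∀ y ∈ (extChartAt (𝓡 d) x₀).target, y ∉ K → r y = 0 := fun y hy hyK =>
    image_eq_zero_of_notMem_tsupport (f := chartPartition (d := d) (M := M) x₀)
      (symm_notMem hy hyK)
  have hslice : ∀ s : ℝ, ContinuousOn (fun y => c (s, y)) (extChartAt (𝓡 d) x₀).target :=
    fun s => (hη x₀).continuousOn.comp (by fun_prop) fun y hy => ⟨Set.mem_univ _, hy⟩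
  -- The derivative of the integrand is bounded on a compact neighbourhood of `{t} × K`.
  obtain ⟨B, hB⟩ := (isCompact_Icc.prod hK).exists_bound_of_continuousOn
    (f := fun p : ℝ × EuclideanSpace ℝ (Fin d) =>
      r p.2 * (f ((extChartAt (𝓡 d) x₀).symm p.2) * fderiv ℝ c p (1, 0)))
    (s := Set.Icc (t - 1) (t + 1) ×ˢ K) (by
      have hKt := chart_image_subset hsub
      have hm : Set.MapsTo Prod.snd (Set.Icc (t - 1) (t + 1) ×ˢ K)
        (extChartAt (𝓡 d) x₀).target := fun p hp => hKt hp.2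
      exact (hrc.comp continuousOn_snd hm).mul ((hfc.comp continuousOn_snd hm).mul
        (hc'.mono fun p hp => ⟨Set.mem_univ _, hKt hp.2⟩)))
  have hsign : ∀ a : ℝ, |Real.sign a| ≤ 1 := fun a => by
    rcases Real.sign_apply_eq a with h | h | h <;> rw [h] <;> norm_num
  have hmeas : ∀ s, ContinuousOn (fun y => r y * (Real.sign (coeff θ x₀ y) *
      (f ((extChartAt (𝓡 d) x₀).symm y) * c (s, y)))) (extChartAt (𝓡 d) x₀).target := fun s =>
    hrc.mul ((hθ.continuousOn x₀).mul (hfc.mul (hslice s)))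
  have hmeas' : ContinuousOn (fun y => r y * (Real.sign (coeff θ x₀ y) *
      (f ((extChartAt (𝓡 d) x₀).symm y) * fderiv ℝ c (t, y) (1, 0))))
      (extChartAt (𝓡 d) x₀).target :=
    hrc.mul ((hθ.continuousOn x₀).mul (hfc.mul
      (hc'.comp (by fun_prop) fun y hy => ⟨Set.mem_univ _, hy⟩)))
  have hmain := (hasDerivAt_integral_of_dominated_loc_of_deriv_le
    (μ := volume.restrict (extChartAt (𝓡 d) x₀).target) (s := Metric.ball t 1) (x₀ := t)
    (F := fun s y => r y * (Real.sign (coeff θ x₀ y) *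
      (f ((extChartAt (𝓡 d) x₀).symm y) * c (s, y))))
    (F' := fun s y => r y * (Real.sign (coeff θ x₀ y) *
      (f ((extChartAt (𝓡 d) x₀).symm y) * fderiv ℝ c (s, y) (1, 0))))
    (bound := K.indicator fun _ => B) (Metric.ball_mem_nhds t one_pos)
    (Filter.Eventually.of_forall fun s =>
      (hmeas s).aestronglyMeasurable hopen.measurableSet)
    (integrableOn_target (hmeas t) hcl hsub fun y hy hyK => by rw [hr0 y hy hyK, zero_mul])
    (hmeas'.aestronglyMeasurable hopen.measurableSet)
    (ae_restrict_of_forall_mem hopen.measurableSet fun y hy s hs => ?_)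
    (((integrableOn_const (hK.measure_lt_top.ne)).integrable_indicator
      hK.measurableSet).mono_measure Measure.restrict_le_self)
    (ae_restrict_of_forall_mem hopen.measurableSet fun y hy s hs => ?_)).2
  · have he : ∀ y ∈ (extChartAt (𝓡 d) x₀).target, deriv (fun s => coeff (η s) x₀ y) t =
        fderiv ℝ c (t, y) (1, 0) := fun y hy => (hcd t y hy).deriv
    rw [setIntegral_congr_fun hopen.measurableSet fun y hy => by
      rw [he y hy]]
    exact hmain
  · by_cases hyK : y ∈ K
    · rw [Set.indicator_of_mem hyK]
      have hs' : s ∈ Set.Icc (t - 1) (t + 1) := by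
        rw [Real.ball_eq_Ioo] at hs
        exact ⟨hs.1.le, hs.2.le⟩
      have h2 := hB (s, y) ⟨hs', hyK⟩
      rw [Real.norm_eq_abs] at h2 ⊢
      refine le_trans ?_ h2
      rw [show ∀ a b c : ℝ, a * (b * c) = b * (a * c) from fun a b c => by ring, abs_mul]
      exact mul_le_of_le_one_left (abs_nonneg _) (hsign _)
    · rw [hr0 y hy hyK, zero_mul, norm_zero, Set.indicator_of_notMem hyK]
  · exact (((hcd s y hy).const_mul _).const_mul _).const_mul _

/-- If the time derivative of the coefficient of `η` is the divergence of `c Z`, then the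
derivative of `∫ h η` is `-∫ dh (Z) η`. -/
theorem hasDerivAt_integral_of_divergence (hθ : LocallyOriented θ)
    (hη : ∀ x₀ : M, ContDiffOn ℝ 1 (fun p : ℝ × EuclideanSpace ℝ (Fin d) => coeff (η p.1) x₀ p.2)
      (Set.univ ×ˢ (extChartAt (𝓡 d) x₀).target)) {h : M → ℝ}
    (hh : ContMDiff (𝓡 d) 𝓘(ℝ, ℝ) ∞ h) {t : ℝ} {Z : ∀ z : M, TangentSpace (𝓡 d) z}
    (hZ : ∀ x₀, ContDiffOn ℝ 1 (vecInChart Z x₀) (extChartAt (𝓡 d) x₀).target)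
    (hdiv : ∀ x₀ : M, ∀ y ∈ (extChartAt (𝓡 d) x₀).target, deriv (fun s => coeff (η s) x₀ y) t =
      divergence (fun z => coeff (η t) x₀ z • vecInChart Z x₀ z) y) :
    HasDerivAt (fun s => integral θ (fun x => h x • η s x))
      (-integral θ (fun x => lieD Z h x • η t x)) t := by
  have h1 := hasDerivAt_integral hθ hη hh.continuous t
  have hη' : ∀ x₀, ContDiffOn ℝ 1 (coeff (η t) x₀) (extChartAt (𝓡 d) x₀).target := fun x₀ =>
    (hη x₀).comp (contDiff_prodMk_right t).contDiffOn fun y hy => ⟨Set.mem_univ _, hy⟩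
  rw [← sum_integral_divergence hθ hη' hZ hh]
  refine h1.congr_deriv (Finset.sum_congr rfl fun x₀ _ =>
    setIntegral_congr_fun (measurableSet_target x₀) fun y hy => ?_)
  simp only [hdiv x₀ y hy]

theorem integral_nonneg_of_sign {κ : DForm d M d}
    (h : ∀ x₀ : M, ∀ y ∈ (extChartAt (𝓡 d) x₀).target,
      0 ≤ Real.sign (coeff θ x₀ y) * coeff κ x₀ y) : 0 ≤ integral θ κ := by
  refine finsum_nonneg fun x₀ => setIntegral_nonneg (measurableSet_target x₀) fun y hy => ?_
  exact mul_nonneg ((chartPartition (d := d)).nonneg x₀ _) (h x₀ y hy)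

end Derivative

/-! ### The forms `F₊` and `F₋` along the Hamiltonian flow -/

section Contract

variable {V : Type*} [AddCommGroup V] [Module ℝ V] [TopologicalSpace V] [FiniteDimensional ℝ V]

theorem Nondeg.exists_contract {α : V [⋀^Fin 2]→L[ℝ] ℝ} (h : Nondeg α) (β : V →ₗ[ℝ] ℝ) :
    ∃ z, ∀ w, α ![z, w] = β w := by
  have hadd : ∀ v v' w, α ![v + v', w] = α ![v, w] + α ![v', w] := fun v v' w =>
    α.toMultilinearMap.cons_add ![w] v v'
  have hsmul : ∀ (c : ℝ) v w, α ![c • v, w] = c * α ![v, w] := fun c v w =>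
    α.toMultilinearMap.cons_smul ![w] c v
  let f : V →ₗ[ℝ] Module.Dual ℝ V := LinearMap.mk₂ ℝ (fun v w => α ![v, w]) hadd hsmul
    (fun v w w' => by
      rw [apply_swap α v, apply_swap α v w, apply_swap α v w', hadd]
      ring)
    (fun c v w => by
      rw [apply_swap α v, apply_swap α v w, hsmul, smul_eq_mul]
      ring)
  have hinj : Function.Injective f := by
    rw [injective_iff_map_eq_zero]
    exact fun v hv => h v fun w => congrArg (fun l : Module.Dual ℝ V => l w) hv
  obtain ⟨z, hz⟩ := (LinearMap.injective_iff_surjective_of_finrank_eq_finrank (f := f)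
    Subspace.dual_finrank_eq.symm).mp hinj β
  exact ⟨z, fun w => congrArg (fun l : Module.Dual ℝ V => l w) hz⟩

end Contract

section SmoothContract

variable {V : Type*} [NormedAddCommGroup V] [NormedSpace ℝ V] [FiniteDimensional ℝ V]

set_option synthInstance.maxHeartbeats 200000

theorem contDiffAt_contract_time {Θ : ℝ × V → (ℝ × V) [⋀^Fin 2]→L[ℝ] ℝ} {t : ℝ} {y : V}
    (h : ContDiffAt ℝ ∞ Θ (t, y)) :
    ContDiffAt ℝ ∞ (fun z => bilin (Θ (t, z)) ((1 : ℝ), 0) ∘L ContinuousLinearMap.inr ℝ ℝ V) y := by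
  have h1 : ContDiffAt ℝ ∞ (fun z => Θ (t, z)) y :=
    h.comp y (contDiffAt_const.prodMk contDiffAt_id)
  have h2 : ContDiff ℝ ∞ (fun α : (ℝ × V) [⋀^Fin 2]→L[ℝ] ℝ =>
      bilin α ((1 : ℝ), 0) ∘L ContinuousLinearMap.inr ℝ ℝ V) := by
    rw [contDiff_clm_apply_iff]
    intro w
    simp only [ContinuousLinearMap.comp_apply, bilin_apply]
    exact contDiff_alternating_apply _
  exact ContDiffAt.comp y (g := fun α : (ℝ × V) [⋀^Fin 2]→L[ℝ] ℝ =>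
    bilin α ((1 : ℝ), 0) ∘L ContinuousLinearMap.inr ℝ ℝ V) (f := fun z => Θ (t, z))
    h2.contDiffAt h1

theorem contDiffAt_inverse_bilin {ζ : V → V [⋀^Fin 2]→L[ℝ] ℝ} {y : V}
    (h : ContDiffAt ℝ ∞ ζ y) (hi : (bilin (ζ y)).IsInvertible) :
    ContDiffAt ℝ ∞ (fun z => (bilin (ζ z)).inverse) y := by
  have : CompleteSpace V := FiniteDimensional.complete ℝ V
  have h1 : ContDiffAt ℝ ∞ (fun z => bilin (ζ z)) y :=
    ContDiffAt.comp y (g := fun α : V [⋀^Fin 2]→L[ℝ] ℝ => bilin α) (f := ζ)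
      contDiff_bilin.contDiffAt h
  exact ContDiffAt.comp y (g := ContinuousLinearMap.inverse) (f := fun z => bilin (ζ z))
    (hi.contDiffAt_map_inverse (n := ∞)) h1

/-- A vector field `Z` with `ζ (Z, ·) = c Θ (∂_t, ·)`, with `ζ` nondegenerate, is smooth. -/
theorem contDiffAt_of_contract {Θ : ℝ × V → (ℝ × V) [⋀^Fin 2]→L[ℝ] ℝ}
    {ζ : V → V [⋀^Fin 2]→L[ℝ] ℝ} {Z : V → V} {t c : ℝ} {y : V} (hΘ : ContDiffAt ℝ ∞ Θ (t, y))
    (hζ : ContDiffAt ℝ ∞ ζ y) (hi : ∀ᶠ z in 𝓝 y, (bilin (ζ z)).IsInvertible)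
    (hZ : ∀ᶠ z in 𝓝 y, ∀ w, ζ z ![Z z, w] = c * Θ (t, z) ![((1 : ℝ), 0), (0, w)]) :
    ContDiffAt ℝ ∞ Z y := by
  have h1 := (contDiffAt_inverse_bilin hζ hi.self_of_nhds).clm_apply
    ((contDiffAt_contract_time hΘ).const_smul c)
  refine h1.congr_of_eventuallyEq ?_
  filter_upwards [hi, hZ] with z hz h2
  have h3 : bilin (ζ z) (Z z) =
      c • (bilin (Θ (t, z)) ((1 : ℝ), 0) ∘L ContinuousLinearMap.inr ℝ ℝ V) := by
    ext1 w
    rw [bilin_apply, h2]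
    change _ = c * bilin (Θ (t, z)) ((1 : ℝ), 0) (0, w)
    rw [bilin_apply]
  obtain ⟨e, he⟩ := hz
  rw [← h3, ← he, ContinuousLinearMap.inverse_equiv]
  simp

end SmoothContract

section Charts

variable {d : ℕ} {M : Type*} [TopologicalSpace M] [ChartedSpace (EuclideanSpace ℝ (Fin d)) M]
  [IsManifold (𝓡 d) ∞ M]

theorem nondeg_inChart {α : DForm d M 2} {x₀ : M} {y : EuclideanSpace ℝ (Fin d)}
    (hy : y ∈ (extChartAt (𝓡 d) x₀).target) (h : Nondeg (α ((extChartAt (𝓡 d) x₀).symm y))) :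
    Nondeg (inChart α x₀ y) := by
  intro v hv
  apply chartDsymm_injective hy
  rw [map_zero]
  refine h _ fun w => ?_
  have h1 := hv (chartD x₀ _ w)
  rw [inChart_apply_two] at h1
  exact (congrArg (fun u => α ((extChartAt (𝓡 d) x₀).symm y) ![chartDsymm x₀ y v, u])
    (chartDsymm_chartD hy w)).symm.trans h1

instance finiteDimensional_tangentSpace (x : M) : FiniteDimensional ℝ (TangentSpace (𝓡 d) x) :=
  inferInstanceAs (FiniteDimensional ℝ (EuclideanSpace ℝ (Fin d)))

/-- The form `2 (ε Ψ₁ - Ψ₂)`; it is `F₊` for `ε = 1` and `F₋` for `ε = -1`. -/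
def signedForm (ε : ℝ) (Ψ₁ Ψ₂ : DForm d M 2) : DForm d M 2 := fun x =>
  (2 : ℝ) • (ε • Ψ₁ x - Ψ₂ x)

omit [IsManifold (𝓡 d) ∞ M] in
theorem inChart_signedForm (ε : ℝ) (Ψ₁ Ψ₂ : DForm d M 2) (x₀ : M)
    (y : EuclideanSpace ℝ (Fin d)) :
    inChart (signedForm ε Ψ₁ Ψ₂) x₀ y = (2 : ℝ) • (ε • inChart Ψ₁ x₀ y - inChart Ψ₂ x₀ y) := rfl

end Charts

section Tamed

variable {d : ℕ} {M : Type*} [TopologicalSpace M] [ChartedSpace (EuclideanSpace ℝ (Fin d)) M]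
  [IsManifold (𝓡 d) ∞ M] {S : GKStructure d M} {X : ∀ x : M, TangentSpace (𝓡 d) x}
  {φ : ℝ → M → M} {h : M → ℝ} {ε t : ℝ}

omit [IsManifold (𝓡 d) ∞ M] in
/-- On pairs `(v, A v)` a 2-form agrees with its `(1,1)`-part. -/
theorem pos_of_part11 {A : EndField d M}
    (sq : ∀ (x : M) (v : TangentSpace (𝓡 d) x), A x (A x v) = -v)
    {β : DForm d M 2} (hpos : PositiveForm A (part11 A (-β))) (x : M)
    (v : TangentSpace (𝓡 d) x) (hv : v ≠ 0) : β x ![v, A x v] < 0 := by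
  have h1 := hpos x v hv
  have h2 : part11 A (-β) x ![v, A x v] =
      1 / 2 * (-β x ![v, A x v] + -β x ![A x v, A x (A x v)]) := by
    have h3 : A x ∘ ![v, A x v] = ![A x v, A x (A x v)] := by
      ext i
      fin_cases i <;> rfl
    rw [← h3]
    rfl
  have h4 : β x ![A x v, -v] = -β x ![A x v, v] := by
    have h5 := (β x).map_update_neg ![A x v, v] 1 v
    have e : ∀ u, Function.update ![A x v, v] 1 u = ![A x v, u] := fun u => by
      ext i
      fin_cases i <;> simp
    rwa [e, e] at h5
  rw [h2, sq, h4, apply_swap (β x) (A x v)] at h1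
  linarith

/-- Taming: `F (v, I v) > 0`. -/
theorem signedForm_pos (ht : ∀ (x : M) (v : TangentSpace (𝓡 d) x), v ≠ 0 →
      pullback (φ t) S.Psi2 x ![v, S.I x v] < 0) (x : M)
    (v : TangentSpace (𝓡 d) x) (hv : v ≠ 0) :
    0 < signedForm ε S.Psi1 (pullback (φ t) S.Psi2) x ![v, S.I x v] := by
  have h1 : signedForm ε S.Psi1 (pullback (φ t) S.Psi2) x ![v, S.I x v] =
    2 * (ε * S.Psi1 x ![v, S.I x v] - pullback (φ t) S.Psi2 x ![v, S.I x v]) := rfl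
  rw [h1, S.Psi1_self_I]
  linarith [ht x v hv]

theorem nondeg_signedForm (ht : ∀ (x : M) (v : TangentSpace (𝓡 d) x), v ≠ 0 →
      pullback (φ t) S.Psi2 x ![v, S.I x v] < 0) (x : M) :
    Nondeg (signedForm ε S.Psi1 (pullback (φ t) S.Psi2) x) := by
  intro v hv
  by_contra hne
  exact (signedForm_pos ht x v hne).ne' (hv _)

theorem contDiffOn_signedForm (hS : S.Nondegenerate) (hφ : IsFlow X φ) (ε : ℝ) (x₀ : M) :
    ContDiffOn ℝ ∞ (fun p : ℝ × EuclideanSpace ℝ (Fin d) =>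
      inChart (signedForm ε S.Psi1 (pullback (φ p.1) S.Psi2)) x₀ p.2)
      (Set.univ ×ˢ (extChartAt (𝓡 d) x₀).target) := by
  simp only [inChart_signedForm]
  exact ((((S.contDiffOn_Psi1 hS x₀).comp contDiff_snd.contDiffOn fun p hp => hp.2).const_smul
    ε).sub (hφ.contDiffOn_pullback (S.contDiffOn_Psi2 hS) x₀)).const_smul 2

theorem smoothForm_signedForm (hS : S.Nondegenerate) (hφ : IsFlow X φ) (ε t : ℝ) :
    SmoothForm (signedForm ε S.Psi1 (pullback (φ t) S.Psi2)) := by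
  intro x₀
  rw [funext (inChart_signedForm ε S.Psi1 (pullback (φ t) S.Psi2) x₀)]
  exact (((S.contDiffOn_Psi1 hS x₀).const_smul ε).sub
    (hφ.smoothForm_pullback (S.contDiffOn_Psi2 hS) t x₀)).const_smul (2 : ℝ)

theorem extDeriv_signedForm (hS : S.Nondegenerate) (hφ : IsFlow X φ) (ε t : ℝ) {x₀ : M}
    {y : EuclideanSpace ℝ (Fin d)} (hy : y ∈ (extChartAt (𝓡 d) x₀).target) :
    extDeriv (inChart (signedForm ε S.Psi1 (pullback (φ t) S.Psi2)) x₀) y = 0 := by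
  have h1 := ClosedForm.extDeriv_inChart (S.contDiffOn_Psi1 hS) (fun x => (S.extDeriv_Psi hS x).1) hy
  have h2 := hφ.extDeriv_pullback (S.contDiffOn_Psi2 hS) (fun x => (S.extDeriv_Psi hS x).2) t hy
  have d1 := ((S.contDiffOn_Psi1 hS x₀).contDiffAt (target_mem_nhds hy)).differentiableAt (by simp)
  have d2 := ((hφ.smoothForm_pullback (S.contDiffOn_Psi2 hS) t x₀).contDiffAt
    (target_mem_nhds hy)).differentiableAt (by simp)
  have hfd : fderiv ℝ (inChart (signedForm ε S.Psi1 (pullback (φ t) S.Psi2)) x₀) y =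
      (2 : ℝ) • (ε • fderiv ℝ (inChart S.Psi1 x₀) y -
        fderiv ℝ (inChart (pullback (φ t) S.Psi2) x₀) y) :=
    (((d1.hasFDerivAt.const_smul ε).sub d2.hasFDerivAt).const_smul (2 : ℝ)).fderiv
  simp only [extDeriv] at h1 h2 ⊢
  rw [hfd]
  simp only [← ContinuousAlternatingMap.alternatizeUncurryFinCLM_apply] at h1 h2 ⊢
  rw [map_smul, map_sub, map_smul, h1, h2, smul_zero, sub_zero, smul_zero]

/-- The vector field `Z` with `F (Z, ·) = -2 φ_t^* (ι_X Ψ₂)`, for which `∂_t F = d (ι_Z F)`. -/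
theorem exists_moser_field (ht : ∀ (x : M) (v : TangentSpace (𝓡 d) x), v ≠ 0 →
      pullback (φ t) S.Psi2 x ![v, S.I x v] < 0) (X : ∀ x : M, TangentSpace (𝓡 d) x) (ε : ℝ) :
    ∃ Z : ∀ x : M, TangentSpace (𝓡 d) x, ∀ x w,
      signedForm ε S.Psi1 (pullback (φ t) S.Psi2) x ![Z x, w] =
        -2 * S.Psi2 (φ t x) ![X (φ t x), mfderiv (𝓡 d) (𝓡 d) (φ t) x w] := by
  refine Classical.axiom_of_choice (r := fun x (z : TangentSpace (𝓡 d) x) => ∀ w,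
      signedForm ε S.Psi1 (pullback (φ t) S.Psi2) x ![z, w] =
        -2 * S.Psi2 (φ t x) ![X (φ t x), mfderiv (𝓡 d) (𝓡 d) (φ t) x w]) fun x => ?_
  have h1 := (nondeg_signedForm (ε := ε) ht x).exists_contract
    ((-2 : ℝ) • (-(S.g.inner (φ t x) (S.commInv (φ t x) (S.J (φ t x) (X (φ t x)))) ∘L
      mfderiv (𝓡 d) (𝓡 d) (φ t) x))).toLinearMap
  exact h1

theorem IsFlow.formAlong_flowMap_apply (hφ : IsFlow X φ) (α : DForm d M 2) {x₀ : M}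
    {z : EuclideanSpace ℝ (Fin d)} (hz : z ∈ (extChartAt (𝓡 d) x₀).target)
    (w : EuclideanSpace ℝ (Fin d)) :
    formAlong (flowMap φ x₀) α (t, z) ![((1 : ℝ), 0), (0, w)] =
      α (φ t ((extChartAt (𝓡 d) x₀).symm z)) ![X (φ t ((extChartAt (𝓡 d) x₀).symm z)),
        mfderiv (𝓡 d) (𝓡 d) (φ t) ((extChartAt (𝓡 d) x₀).symm z) (chartDsymm x₀ z w)] := by
  refine congrArg (α (φ t ((extChartAt (𝓡 d) x₀).symm z))) (funext fun i => ?_)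
  fin_cases i
  · exact hφ.mfderiv_flowMap_fst hz
  · exact hφ.mfderiv_flowMap_snd hz w

theorem moser_field_inChart (hφ : IsFlow X φ) {Z : ∀ x : M, TangentSpace (𝓡 d) x}
    (hZ : ∀ x w, signedForm ε S.Psi1 (pullback (φ t) S.Psi2) x ![Z x, w] =
        -2 * S.Psi2 (φ t x) ![X (φ t x), mfderiv (𝓡 d) (𝓡 d) (φ t) x w]) {x₀ : M}
    {z : EuclideanSpace ℝ (Fin d)} (hz : z ∈ (extChartAt (𝓡 d) x₀).target)
    (w : EuclideanSpace ℝ (Fin d)) :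
    inChart (signedForm ε S.Psi1 (pullback (φ t) S.Psi2)) x₀ z ![vecInChart Z x₀ z, w] =
      -2 * formAlong (flowMap φ x₀) S.Psi2 (t, z) ![((1 : ℝ), 0), (0, w)] := by
  have h2 : inChart (signedForm ε S.Psi1 (pullback (φ t) S.Psi2)) x₀ z ![vecInChart Z x₀ z, w] =
      signedForm ε S.Psi1 (pullback (φ t) S.Psi2) _
        ![Z ((extChartAt (𝓡 d) x₀).symm z), chartDsymm x₀ z w] := by
    refine (inChart_apply_two _ _ _ _ _).trans ?_
    exact congrArg (fun u => signedForm ε S.Psi1 (pullback (φ t) S.Psi2)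
      ((extChartAt (𝓡 d) x₀).symm z) ![u, chartDsymm x₀ z w]) (chartDsymm_chartD hz _)
  rw [h2, hZ, hφ.formAlong_flowMap_apply S.Psi2 hz w]

theorem contDiffOn_moser_field (hS : S.Nondegenerate) (hφ : IsFlow X φ)
    (ht : ∀ (x : M) (v : TangentSpace (𝓡 d) x), v ≠ 0 →
      pullback (φ t) S.Psi2 x ![v, S.I x v] < 0) {Z : ∀ x : M, TangentSpace (𝓡 d) x}
    (hZ : ∀ x w, signedForm ε S.Psi1 (pullback (φ t) S.Psi2) x ![Z x, w] =
        -2 * S.Psi2 (φ t x) ![X (φ t x), mfderiv (𝓡 d) (𝓡 d) (φ t) x w]) (x₀ : M) :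
    ContDiffOn ℝ ∞ (vecInChart Z x₀) (extChartAt (𝓡 d) x₀).target := by
  intro y hy
  set ζ : EuclideanSpace ℝ (Fin d) → EuclideanSpace ℝ (Fin d) [⋀^Fin 2]→L[ℝ] ℝ :=
    inChart (signedForm ε S.Psi1 (pullback (φ t) S.Psi2)) x₀
  have hnd : ∀ z ∈ (extChartAt (𝓡 d) x₀).target, (bilin (ζ z)).IsInvertible := fun z hz =>
    (nondeg_inChart hz (nondeg_signedForm ht _)).isInvertible_bilin
  have hζ : ContDiffAt ℝ ∞ ζ y :=
    (smoothForm_signedForm hS hφ ε t x₀).contDiffAt (target_mem_nhds hy)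
  have hΘ : ContDiffAt ℝ ∞ (formAlong (flowMap φ x₀) S.Psi2) (t, y) :=
    contDiffAt_formAlong (S.contDiffOn_Psi2 hS) (hφ.contMDiffAt_flowMap hy)
  have hi : ∀ᶠ z in 𝓝 y, (bilin (ζ z)).IsInvertible := by
    filter_upwards [target_mem_nhds hy] with z hz using hnd z hz
  have hZ' : ∀ᶠ z in 𝓝 y, ∀ w, ζ z ![vecInChart Z x₀ z, w] =
      -2 * formAlong (flowMap φ x₀) S.Psi2 (t, z) ![((1 : ℝ), 0), (0, w)] := by
    filter_upwards [target_mem_nhds hy] with z hz w using moser_field_inChart hφ hZ hz w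
  exact (contDiffAt_of_contract (Θ := formAlong (flowMap φ x₀) S.Psi2) (ζ := ζ)
    (Z := vecInChart Z x₀) (t := t) (c := -2) hΘ hζ hi hZ').contDiffWithinAt

/-- The sign of `dh (Z)`: with `F (ξ, ·) = dh` it equals `-4 ε φ_t^* Ψ₂ (ξ, I ξ)`. -/
theorem lieD_moser_field (hS : S.Nondegenerate) (hφ : IsFlow X φ)
    (hX : IsHamiltonianField S.Omega h X) (hh : ContMDiff (𝓡 d) 𝓘(ℝ, ℝ) ∞ h)
    (ht : ∀ (x : M) (v : TangentSpace (𝓡 d) x), v ≠ 0 →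
      pullback (φ t) S.Psi2 x ![v, S.I x v] < 0) {Z : ∀ x : M, TangentSpace (𝓡 d) x}
    (hZ : ∀ x w, signedForm ε S.Psi1 (pullback (φ t) S.Psi2) x ![Z x, w] =
        -2 * S.Psi2 (φ t x) ![X (φ t x), mfderiv (𝓡 d) (𝓡 d) (φ t) x w]) (x : M) :
    0 ≤ ε * lieD Z h x := by
  have hΩ := hφ.pullback_eq hX hh (S.contDiffOn_Omega hS) (S.extDeriv_Omega hS) t
  obtain ⟨ξ, hξ⟩ := (nondeg_signedForm (ε := ε) ht x).exists_contract
    (mvfderiv (𝓡 d) h x).toLinearMap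
  have hξ' : ∀ w, signedForm ε S.Psi1 (pullback (φ t) S.Psi2) x ![ξ, w] =
    mvfderiv (𝓡 d) h x w := hξ
  obtain ⟨u, hu1, hu2⟩ := S.exists_pullback_J hS hφ hX hh t x hΩ ξ
  have h1 : lieD Z h x = 2 * mvfderiv (𝓡 d) h x u := by
    rw [lieD, ← hξ', apply_swap, hZ, hu2]
    ring
  have h2 : mvfderiv (𝓡 d) h x u =
      2 * (ε * S.Psi1 x ![ξ, u] - pullback (φ t) S.Psi2 x ![ξ, u]) := (hξ' u).symm
  have h3 : pullback (φ t) S.Psi2 x ![ξ, u] = 0 := by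
    rw [hu1, apply_self, neg_zero]
  have h4 : S.Psi1 x ![ξ, u] = -pullback (φ t) S.Psi2 x ![ξ, S.I x ξ] := by
    rw [hu1, S.Psi1_apply]
    change -S.Omega x ![S.I x ξ, u] = _
    rw [apply_swap (S.Omega x) (S.I x ξ)]
  have h5 : pullback (φ t) S.Psi2 x ![ξ, S.I x ξ] ≤ 0 := by
    by_cases h0 : ξ = 0
    · rw [h0]
      exact ((pullback (φ t) S.Psi2 x).map_coord_zero 0 rfl).le
    · exact (ht x ξ h0).le
  rw [h1, h2, h3, h4]
  nlinarith [mul_nonneg (mul_self_nonneg ε) (neg_nonneg.mpr h5)]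

end Tamed

/-! ### The derivative of the functional -/

section Volume

variable {n : ℕ} {M : Type*} [TopologicalSpace M]
  [ChartedSpace (EuclideanSpace ℝ (Fin (4 * n))) M]

theorem coeff_topPow (F : DForm (4 * n) M 2) (x₀ : M) (y : EuclideanSpace ℝ (Fin (4 * n))) :
    coeff (fun x => topPow n (F x)) x₀ y =
      topPow n (inChart F x₀ y) (fun i => EuclideanSpace.basisFun (Fin (4 * n)) ℝ i) :=
  (congrArg (fun η : EuclideanSpace ℝ (Fin (4 * n)) [⋀^Fin (4 * n)]→L[ℝ] ℝ =>
    η (fun i => EuclideanSpace.basisFun (Fin (4 * n)) ℝ i))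
    (topPow_compContinuousLinearMap n (F ((extChartAt (𝓡 (4 * n)) x₀).symm y)) _)).symm

theorem SmoothForm.contForm_topPow {F : DForm (4 * n) M 2} (hF : SmoothForm F) :
    ContForm fun x => topPow n (F x) := by
  intro x₀
  rw [funext (coeff_topPow F x₀)]
  exact (contDiff_topPow_apply n _).continuous.comp_continuousOn (hF x₀).continuousOn

/-- The volume form of a nondegenerate 2-form is locally of constant sign. -/
theorem locallyOriented_topPow [IsManifold (𝓡 (4 * n)) ∞ M] {F : DForm (4 * n) M 2}
    (hF : SmoothForm F) (hnd : ∀ x, Nondeg (F x)) : LocallyOriented fun x => topPow n (F x) := by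
  intro x₀ y hy
  obtain ⟨r, hr, hball⟩ := Metric.isOpen_iff.mp (isOpen_extChartAt_target (I := 𝓡 (4 * n)) x₀) y hy
  filter_upwards [Metric.ball_mem_nhds y hr] with z hz
  rw [coeff_topPow, coeff_topPow]
  let c : ℝ → EuclideanSpace ℝ (Fin (4 * n)) := fun s => z + s • (y - z)
  have hc : ContDiff ℝ ∞ c := contDiff_const.add (contDiff_id.smul contDiff_const)
  have hseg : ∀ s ∈ Set.Icc (0 : ℝ) 1, c s ∈ Metric.ball y r := fun s hs =>
    (convex_ball y r).add_smul_sub_mem hz (Metric.mem_ball_self hr) hs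
  have h := sign_topPow_eq_of_path n (α := fun s => inChart F x₀ (c s))
    (Metric.isOpen_ball.preimage hc.continuous) hseg
    (((hF x₀).of_le (by simp)).comp (hc.of_le (by simp)).contDiffOn fun s hs => hball hs)
    (fun s hs => nondeg_inChart (hball (hseg s hs)) (hnd _))
    (fun i => EuclideanSpace.basisFun (Fin (4 * n)) ℝ i)
  simpa [c] using h

/-- Two 2-forms which are joined by a segment of nondegenerate forms define the same
orientation. -/
theorem sign_coeff_topPow_eq [IsManifold (𝓡 (4 * n)) ∞ M] {F G : DForm (4 * n) M 2}
    (hnd : ∀ s ∈ Set.Icc (0 : ℝ) 1, ∀ x, Nondeg ((1 - s) • F x + s • G x)) {x₀ : M}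
    {y : EuclideanSpace ℝ (Fin (4 * n))} (hy : y ∈ (extChartAt (𝓡 (4 * n)) x₀).target) :
    Real.sign (coeff (fun x => topPow n (F x)) x₀ y) =
      Real.sign (coeff (fun x => topPow n (G x)) x₀ y) := by
  rw [coeff_topPow, coeff_topPow]
  have h := sign_topPow_eq_of_path n
    (α := fun s : ℝ => (1 - s) • inChart F x₀ y + s • inChart G x₀ y) isOpen_univ
    (Set.subset_univ _) (((contDiff_const.sub contDiff_id).smul contDiff_const).add
      (contDiff_id.smul contDiff_const)).contDiffOn
    (fun s hs => nondeg_inChart (α := fun x => (1 - s) • F x + s • G x) hy (hnd s hs _))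
    (fun i => EuclideanSpace.basisFun (Fin (4 * n)) ℝ i)
  simpa using h

end Volume

section Linear

variable {d : ℕ} {M : Type*} [TopologicalSpace M] [ChartedSpace (EuclideanSpace ℝ (Fin d)) M]
  [IsManifold (𝓡 d) ∞ M] [T2Space M] [CompactSpace M] {θ κ₁ κ₂ : DForm d M d}

theorem integral_linear (hθ : LocallyOriented θ) (h₁ : ContForm κ₁) (h₂ : ContForm κ₂)
    (a b : ℝ) : integral θ (fun x => a • κ₁ x + b • κ₂ x) =
      a * integral θ κ₁ + b * integral θ κ₂ := by
  simp only [integral_eq_sum, Finset.mul_sum, ← Finset.sum_add_distrib, chartIntegral]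
  refine Finset.sum_congr rfl fun x₀ _ => ?_
  have hint : ∀ κ : DForm d M d, ContForm κ → IntegrableOn (fun y => Real.sign (coeff θ x₀ y) *
      coeff (fun x => chartPartition (d := d) x₀ x • κ x) x₀ y)
      (extChartAt (𝓡 d) x₀).target := fun κ hκ =>
    integrableOn_chart hθ (hκ.smul (continuous_chartPartition x₀))
      (isClosed_tsupport _) (tsupport_chartPartition_subset x₀)
      fun z hz => smul_chartPartition_eq_zero κ z hz
  rw [← integral_const_mul, ← integral_const_mul,
    ← integral_add ((hint κ₁ h₁).const_mul a) ((hint κ₂ h₂).const_mul b)]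
  refine setIntegral_congr_fun (measurableSet_target x₀) fun y _ => ?_
  have h : coeff (fun x => a • κ₁ x + b • κ₂ x) x₀ y = a * coeff κ₁ x₀ y + b * coeff κ₂ x₀ y := rfl
  simp only [coeff_smul]
  rw [h]
  ring

theorem mul_integral (ε : ℝ) (θ κ : DForm d M d) :
    ε * integral θ κ = integral θ (fun x => ε • κ x) := by
  simp only [integral_eq_sum, Finset.mul_sum, chartIntegral]
  refine Finset.sum_congr rfl fun x₀ _ => ?_
  rw [← integral_const_mul]
  refine integral_congr_ae (Filter.Eventually.of_forall fun y => ?_)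
  simp only [coeff_smul]
  ring

end Linear

section Variation

variable {n : ℕ} {M : Type*} [TopologicalSpace M]
  [ChartedSpace (EuclideanSpace ℝ (Fin (4 * n))) M] [IsManifold (𝓡 (4 * n)) ∞ M]
  {S : GKStructure (4 * n) M} {X : ∀ x : M, TangentSpace (𝓡 (4 * n)) x}
  {φ : ℝ → M → M} {h : M → ℝ} {ε t : ℝ}

theorem contDiffOn_coeff_signedForm (hS : S.Nondegenerate) (hφ : IsFlow X φ) (ε : ℝ) (x₀ : M) :
    ContDiffOn ℝ 1 (fun p : ℝ × EuclideanSpace ℝ (Fin (4 * n)) =>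
      coeff (fun x => topPow n (signedForm ε S.Psi1 (pullback (φ p.1) S.Psi2) x)) x₀ p.2)
      (Set.univ ×ˢ (extChartAt (𝓡 (4 * n)) x₀).target) := by
  simp only [coeff_topPow]
  exact ((contDiff_topPow_apply n _).of_le (by simp)).comp_contDiffOn
    ((contDiffOn_signedForm hS hφ ε x₀).of_le (by simp))

/-- In a chart, `∂_t F = d (ι_Z F)`. -/
theorem deriv_signedForm (hS : S.Nondegenerate) (hφ : IsFlow X φ)
    {Z : ∀ x : M, TangentSpace (𝓡 (4 * n)) x}
    (hZ : ∀ x w, signedForm ε S.Psi1 (pullback (φ t) S.Psi2) x ![Z x, w] =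
        -2 * S.Psi2 (φ t x) ![X (φ t x), mfderiv (𝓡 (4 * n)) (𝓡 (4 * n)) (φ t) x w]) {x₀ : M}
    {y : EuclideanSpace ℝ (Fin (4 * n))} (hy : y ∈ (extChartAt (𝓡 (4 * n)) x₀).target)
    (v w : EuclideanSpace ℝ (Fin (4 * n))) :
    deriv (fun s => inChart (signedForm ε S.Psi1 (pullback (φ s) S.Psi2)) x₀ y ![v, w]) t =
      fderiv ℝ (fun z => inChart (signedForm ε S.Psi1 (pullback (φ t) S.Psi2)) x₀ z
        ![vecInChart Z x₀ z, w]) y v -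
      fderiv ℝ (fun z => inChart (signedForm ε S.Psi1 (pullback (φ t) S.Psi2)) x₀ z
        ![vecInChart Z x₀ z, v]) y w := by
  have h1 := hφ.deriv_pullback (S.contDiffOn_Psi2 hS) (fun x => (S.extDeriv_Psi hS x).2) t hy
    (β := fun z w => (-1 / 2 : ℝ) • inChart (signedForm ε S.Psi1 (pullback (φ t) S.Psi2)) x₀ z
      ![vecInChart Z x₀ z, w]) (fun z hz w => by
        rw [moser_field_inChart hφ hZ hz w, hφ.formAlong_flowMap_apply S.Psi2 hz w, smul_eq_mul]
        ring) v w
  have h2 : (fun s => inChart (signedForm ε S.Psi1 (pullback (φ s) S.Psi2)) x₀ y ![v, w]) =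
      fun s => 2 * (ε * inChart S.Psi1 x₀ y ![v, w] -
        inChart (pullback (φ s) S.Psi2) x₀ y ![v, w]) := rfl
  have h3 : ∀ (f : EuclideanSpace ℝ (Fin (4 * n)) → ℝ) u,
      fderiv ℝ (fun z => (-1 / 2 : ℝ) • f z) y u = -1 / 2 * fderiv ℝ f y u := fun f u =>
    congrArg (fun l : EuclideanSpace ℝ (Fin (4 * n)) → EuclideanSpace ℝ (Fin (4 * n)) →L[ℝ] ℝ =>
      l y u) (fderiv_const_smul_field (𝕜 := ℝ) (f := f) (-1 / 2 : ℝ))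
  rw [h3, h3] at h1
  rw [h2, deriv_const_mul_field, deriv_const_sub, h1]
  ring

/-- In a chart, `∂_t F^{2n} = d (ι_Z F^{2n})`, written as the divergence of the coefficient of
`F^{2n}` times `Z`. -/
theorem deriv_coeff_signedForm (hS : S.Nondegenerate) (hφ : IsFlow X φ)
    (ht : ∀ (x : M) (v : TangentSpace (𝓡 (4 * n)) x), v ≠ 0 →
      pullback (φ t) S.Psi2 x ![v, S.I x v] < 0) {Z : ∀ x : M, TangentSpace (𝓡 (4 * n)) x}
    (hZ : ∀ x w, signedForm ε S.Psi1 (pullback (φ t) S.Psi2) x ![Z x, w] =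
        -2 * S.Psi2 (φ t x) ![X (φ t x), mfderiv (𝓡 (4 * n)) (𝓡 (4 * n)) (φ t) x w]) {x₀ : M}
    {y : EuclideanSpace ℝ (Fin (4 * n))} (hy : y ∈ (extChartAt (𝓡 (4 * n)) x₀).target) :
    deriv (fun s =>
      coeff (fun x => topPow n (signedForm ε S.Psi1 (pullback (φ s) S.Psi2) x)) x₀ y) t =
    divergence (fun z => coeff (fun x => topPow n (signedForm ε S.Psi1 (pullback (φ t) S.Psi2) x))
      x₀ z • vecInChart Z x₀ z) y := by
  simp only [coeff_topPow]
  set α : ℝ → EuclideanSpace ℝ (Fin (4 * n)) [⋀^Fin 2]→L[ℝ] ℝ := fun s =>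
    inChart (signedForm ε S.Psi1 (pullback (φ s) S.Psi2)) x₀ y with hαdef
  have hα : DifferentiableAt ℝ α t := by
    have h1 : DifferentiableAt ℝ (fun p : ℝ × EuclideanSpace ℝ (Fin (4 * n)) =>
        inChart (signedForm ε S.Psi1 (pullback (φ p.1) S.Psi2)) x₀ p.2) (t, y) :=
      ((contDiffOn_signedForm hS hφ ε x₀).contDiffAt (prod_mem_nhds Filter.univ_mem
        (target_mem_nhds hy))).differentiableAt (by simp)
    exact h1.comp (f := fun s : ℝ => (s, y)) t
      (differentiableAt_id.prodMk (differentiableAt_const y))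
  have hγ : ∀ v w, deriv α t ![v, w] = deriv (fun s => α s ![v, w]) t := fun v w =>
    ((ContinuousAlternatingMap.apply ℝ (EuclideanSpace ℝ (Fin (4 * n))) ℝ
      ![v, w]).hasFDerivAt.comp_hasDerivAt t hα.hasDerivAt).deriv.symm
  have h2 := (((contDiff_topPow_apply n
    (fun i => EuclideanSpace.basisFun (Fin (4 * n)) ℝ i)).differentiable (by simp)
      (α t)).hasFDerivAt.comp_hasDerivAt t hα.hasDerivAt).deriv
  refine h2.trans (fderiv_topPow_eq_divergence n
    (((smoothForm_signedForm hS hφ ε t x₀).contDiffAt (target_mem_nhds hy)).differentiableAt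
      (by simp))
    (((contDiffOn_moser_field hS hφ ht hZ x₀).contDiffAt (target_mem_nhds hy)).differentiableAt
      (by simp)) (extDeriv_signedForm hS hφ ε t hy) (fun v w => ?_) _)
  rw [hγ]
  exact deriv_signedForm hS hφ hZ hy v w

/-- The forms `F±` induce the orientation of `Ω`: along the segment joining them, the pairing of
`v` with `I v` is positive, except at `Ω` itself. -/
theorem sign_coeff_signedForm (hS : S.Nondegenerate)
    (ht : ∀ (x : M) (v : TangentSpace (𝓡 (4 * n)) x), v ≠ 0 →
      pullback (φ t) S.Psi2 x ![v, S.I x v] < 0) (ε : ℝ) {x₀ : M}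
    {y : EuclideanSpace ℝ (Fin (4 * n))} (hy : y ∈ (extChartAt (𝓡 (4 * n)) x₀).target) :
    Real.sign (coeff (fun x => topPow n (S.Omega x)) x₀ y) = Real.sign (coeff
      (fun x => topPow n (signedForm ε S.Psi1 (pullback (φ t) S.Psi2) x)) x₀ y) := by
  refine sign_coeff_topPow_eq (fun s hs x => ?_) hy
  rcases hs.1.eq_or_lt with rfl | hs0
  · rw [sub_zero, one_smul, zero_smul, add_zero]
    exact S.nondeg_Omega hS x
  · intro v hv
    by_contra hne
    have h1 : (1 - s) * S.Omega x ![v, S.I x v] +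
      s * signedForm ε S.Psi1 (pullback (φ t) S.Psi2) x ![v, S.I x v] = 0 := hv _
    rw [S.Omega_self_I, mul_zero, zero_add] at h1
    exact (mul_pos hs0 (signedForm_pos ht x v hne)).ne' h1

variable [T2Space M] [CompactSpace M]

/-- The derivative of `∫ h F±^{2n}` along the flow is nonpositive for `F₊` and nonnegative
for `F₋`. -/
theorem exists_hasDerivAt_integral_signedForm (hS : S.Nondegenerate) (hφ : IsFlow X φ)
    (hX : IsHamiltonianField S.Omega h X) (hh : ContMDiff (𝓡 (4 * n)) 𝓘(ℝ, ℝ) ∞ h)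
    (ht : ∀ (x : M) (v : TangentSpace (𝓡 (4 * n)) x), v ≠ 0 →
      pullback (φ t) S.Psi2 x ![v, S.I x v] < 0) (ε : ℝ) :
    ∃ c : ℝ, ε * c ≤ 0 ∧ HasDerivAt (fun s => integral (fun x => topPow n (S.Omega x))
      (fun x => h x • topPow n (signedForm ε S.Psi1 (pullback (φ s) S.Psi2) x))) c t := by
  obtain ⟨Z, hZ⟩ := exists_moser_field ht X ε
  refine ⟨_, ?_, hasDerivAt_integral_of_divergence
    (η := fun s x => topPow n (signedForm ε S.Psi1 (pullback (φ s) S.Psi2) x))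
    (locallyOriented_topPow (S.contDiffOn_Omega hS) (S.nondeg_Omega hS))
    (contDiffOn_coeff_signedForm hS hφ ε) hh
    (fun x₀ => (contDiffOn_moser_field hS hφ ht hZ x₀).of_le (by simp))
    (fun x₀ y hy => deriv_coeff_signedForm hS hφ ht hZ hy)⟩
  rw [mul_neg, neg_nonpos, mul_integral]
  refine integral_nonneg_of_sign fun x₀ y hy => ?_
  rw [sign_coeff_signedForm hS ht ε hy]
  have h1 : coeff (fun x => ε • lieD Z h x • topPow n
      (signedForm ε S.Psi1 (pullback (φ t) S.Psi2) x)) x₀ y =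
    ε * lieD Z h ((extChartAt (𝓡 (4 * n)) x₀).symm y) * coeff (fun x => topPow n
      (signedForm ε S.Psi1 (pullback (φ t) S.Psi2) x)) x₀ y := (mul_assoc _ _ _).symm
  rw [h1, mul_left_comm, real_sign_mul_self]
  exact mul_nonneg (lieD_moser_field hS hφ hX hh ht hZ _) (abs_nonneg _)

theorem deltaF_eq (hS : S.Nondegenerate) (hφ : IsFlow X φ) (hh : Continuous h) (t : ℝ) :
    deltaF S h φ t = 1 / ((2 * n).factorial : ℝ) *
      (Real.exp S.lam * integral (fun x => topPow n (S.Omega x))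
        (fun x => h x • topPow n (signedForm (-1) S.Psi1 (pullback (φ t) S.Psi2) x)) -
      integral (fun x => topPow n (S.Omega x))
        (fun x => h x • topPow n (signedForm 1 S.Psi1 (pullback (φ t) S.Psi2) x))) := by
  have hp : Fplus S.Psi1 (pullback (φ t) S.Psi2) =
      signedForm 1 S.Psi1 (pullback (φ t) S.Psi2) := by
    funext x
    exact congrArg (fun β => (2 : ℝ) • (β - pullback (φ t) S.Psi2 x))
      (one_smul ℝ (S.Psi1 x)).symm
  have hm : Fminus S.Psi1 (pullback (φ t) S.Psi2) =
      signedForm (-1) S.Psi1 (pullback (φ t) S.Psi2) := by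
    funext x
    exact congrArg (fun β => (2 : ℝ) • (β - pullback (φ t) S.Psi2 x))
      (neg_one_smul ℝ (S.Psi1 x)).symm
  have h1 := integral_linear (locallyOriented_topPow (S.contDiffOn_Omega hS) (S.nondeg_Omega hS))
    ((smoothForm_signedForm hS hφ 1 t).contForm_topPow.smul hh)
    ((smoothForm_signedForm hS hφ (-1) t).contForm_topPow.smul hh) (-1) (Real.exp S.lam)
  rw [deltaF, sigmaForm, hp, hm, sub_eq_neg_add, ← neg_one_mul (integral _ _), ← h1]
  congr 2
  funext x
  ext v
  change (0 - h x) * (topPow n _ v - Real.exp S.lam * topPow n _ v) =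
    -1 * (h x * topPow n _ v) + Real.exp S.lam * (h x * topPow n _ v)
  ring

end Variation

end GenKahler

end

theorem propositionl (n : ℕ) (M : Type*) [TopologicalSpace M] [T2Space M] [CompactSpace M]
    [ChartedSpace (EuclideanSpace ℝ (Fin (4 * n))) M] [IsManifold (𝓡 (4 * n)) ∞ M]
    (S : GenKahler.GKStructure (4 * n) M) (hS : S.Nondegenerate)
    (h : M → ℝ) (hsmooth : ContMDiff (𝓡 (4 * n)) 𝓘(ℝ, ℝ) ∞ h)
    (hnorm : GenKahler.integralPow S.Omega h S.Omega = 0)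
    (X : ∀ x : M, TangentSpace (𝓡 (4 * n)) x) (hX : GenKahler.IsHamiltonianField S.Omega h X)
    (φ : ℝ → M → M) (hφ : GenKahler.IsFlow X φ)
    (T : Set ℝ) (hT : T.OrdConnected)
    (hpos : ∀ t ∈ T, GenKahler.PositiveForm S.I
      (GenKahler.part11 S.I (-GenKahler.pullback (φ t) S.Psi2))) :
    MonotoneOn (GenKahler.deltaF S h φ) T := by
  have hder : ∀ t ∈ T, ∃ c : ℝ, 0 ≤ c ∧ HasDerivAt (GenKahler.deltaF S h φ) c t := by
    intro t htT
    have ht := GenKahler.pos_of_part11 S.complexI.sq (hpos t htT)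
    obtain ⟨a, ha, hda⟩ :=
      GenKahler.exists_hasDerivAt_integral_signedForm hS hφ hX hsmooth ht 1
    obtain ⟨b, hb, hdb⟩ :=
      GenKahler.exists_hasDerivAt_integral_signedForm hS hφ hX hsmooth ht (-1)
    refine ⟨1 / ((2 * n).factorial : ℝ) * (Real.exp S.lam * b - a), ?_, ?_⟩
    · have hb' : 0 ≤ Real.exp S.lam * b := mul_nonneg (Real.exp_pos _).le (by linarith)
      exact mul_nonneg (by positivity) (by linarith)
    · rw [funext (GenKahler.deltaF_eq hS hφ hsmooth.continuous)]
      exact ((hdb.const_mul _).sub hda).const_mul _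
  refine monotoneOn_of_deriv_nonneg hT.convex (fun t ht => ?_) (fun t ht => ?_) fun t ht => ?_
  · obtain ⟨c, -, hc⟩ := hder t ht
    exact hc.continuousAt.continuousWithinAt
  · obtain ⟨c, -, hc⟩ := hder t (interior_subset ht)
    exact hc.differentiableAt.differentiableWithinAt
  · obtain ⟨c, hc0, hc⟩ := hder t (interior_subset ht)
    rwa [hc.deriv]
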